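/- Let $(M,g)$ be a spacetime: a smooth connected finite-dimensional (Hausdorff, second countable) manifold with a smooth metric tensor $g$ of index $1$ (signature $(-,+,\dots,+)$), together with a time-orientation, i.e. a continuous choice of one of the two causal cones (the future cone) in each tangent space. A tangent vector $v$ is causal if $g(v,v)<0$, or $g(v,v)=0$ and $v\ne 0$; it is future-directed causal if it lies in the chosen cone. An open set $U\subseteq M$ is convex if it is a normal neighbourhood of each of its points $p$, i.e. $\exp_p$ restricts to a diffeomorphism from a star-shaped open neighbourhood of $0$ in $T_pM$ onto $U$. For $p,q\in U$ write $p<_U q$ if there is a future-directed causal $C^1$ curve from $p$ to $q$ contained in $U$. Fix any auxiliary Riemannian metric $h$ on $M$; a curve $\gamma:[0,1]\to M$ is $H^1$ if it is absolutely continuous and $\int_0^1 h(\dot\gamma,\dot\gamma)\,ds<\infty$. For a continuous curve $\gamma:[0,1]\to M$ consider the properties (i) $\gamma$ is future-directed causal: for every convex open set $U$ and all $t<t'$ in $[0,1]$ with $\gamma([t,t'])\subseteq U$, one has $\gamma(t)<_U\gamma(t')$; (ii) $\gamma$ is $H^1$ and $\dot\gamma(s)$ is a future-directed causal vector for almost every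 $s\in[0,1]$. Theorem. (a) Up to a change of parameter, (i) and (ii) are equivalent: $\gamma$ satisfies (i) if and only if there is a continuous strictly increasing bijection $\sigma:[0,1]\to[0,1]$ such that $\gamma\circ\sigma$ satisfies (ii). (b) For the given parametrization, $\gamma$ satisfies (ii) if and only if it satisfies (i), is $H^1$, and $\dot\gamma(s)\neq 0$ for almost every $s\in[0,1]$. In particular (ii) implies (i), and for $H^1$ curves whose velocity is almost everywhere nonzero (i) holds if and only if $\dot\gamma$ is future-directed causal almost everywhere. -/

import Mathlib

open Set MeasureTheory
open scoped Manifold ContDiff Topology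

/-- A smooth Lorentzian metric (a metric tensor of index one) on a manifold `M` modelled on `E`.
The field `index_one` says that every tangent space contains a timelike vector on whose orthogonal
complement the form is positive definite, i.e. the form has signature `(-, +, …, +)`. -/
structure LorentzianMetric (E : Type*) [NormedAddCommGroup E] [NormedSpace ℝ E]
    (M : Type*) [TopologicalSpace M] [ChartedSpace E M] [IsManifold 𝓘(ℝ, E) ∞ M] where
  val (x : M) : TangentSpace 𝓘(ℝ, E) x →L[ℝ] TangentSpace 𝓘(ℝ, E) x →L[ℝ] ℝ
  symm (x : M) (v w : TangentSpace 𝓘(ℝ, E) x) : val x v w = val x w v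
  index_one (x : M) : ∃ v : TangentSpace 𝓘(ℝ, E) x, val x v v < 0 ∧
    ∀ w : TangentSpace 𝓘(ℝ, E) x, val x v w = 0 → w ≠ 0 → 0 < val x w w
  contMDiff : ContMDiff 𝓘(ℝ, E) (𝓘(ℝ, E).prod 𝓘(ℝ, E →L[ℝ] E →L[ℝ] ℝ)) ∞
    (fun x ↦ Bundle.TotalSpace.mk' (E →L[ℝ] E →L[ℝ] ℝ)
      (E := fun x : M ↦ TangentSpace 𝓘(ℝ, E) x →L[ℝ] TangentSpace 𝓘(ℝ, E) x →L[ℝ] ℝ) x (val x))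

noncomputable section Spacetime

variable {E : Type*} [NormedAddCommGroup E] [NormedSpace ℝ E]
  {M : Type*} [TopologicalSpace M] [ChartedSpace E M] [IsManifold 𝓘(ℝ, E) ∞ M]

namespace LorentzianMetric

/-- Timelike tangent vectors. -/
def IsTimelike (g : LorentzianMetric E M) (x : M) (v : TangentSpace 𝓘(ℝ, E) x) : Prop :=
  g.val x v v < 0

/-- Causal tangent vectors: timelike, or null and nonzero. -/
def IsCausal (g : LorentzianMetric E M) (x : M) (v : TangentSpace 𝓘(ℝ, E) x) : Prop :=
  g.val x v v < 0 ∨ (g.val x v v = 0 ∧ v ≠ 0)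

/-- A time-orientation: a choice `future x` of one of the two causal cones of each tangent space,
which is continuous in the sense that, locally, it is the cone determined by a continuous timelike
vector field `X` (the causal vectors `v` with `g(X, v) < 0` are those in the same cone as `X`). -/
structure TimeOrientation (g : LorentzianMetric E M) where
  future (x : M) : Set (TangentSpace 𝓘(ℝ, E) x)
  continuous_choice (x₀ : M) : ∃ U : Set M, IsOpen U ∧ x₀ ∈ U ∧
    ∃ X : (x : M) → TangentSpace 𝓘(ℝ, E) x,
      ContinuousOn (fun x ↦ (⟨x, X x⟩ : TangentBundle 𝓘(ℝ, E) M)) U ∧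
      ∀ x ∈ U, g.IsTimelike x (X x) ∧
        future x = {v | g.IsCausal x v ∧ g.val x (X x) v < 0}

/-- The metric in the coordinates of the preferred chart at `x₀`: the pullback of `g` by the inverse
of the chart, at the point `y` of `E`, evaluated on the vectors `u`, `w`. -/
def coord (g : LorentzianMetric E M) (x₀ : M) (y u w : E) : ℝ :=
  g.val ((extChartAt 𝓘(ℝ, E) x₀).symm y)
    (mfderiv 𝓘(ℝ, E) 𝓘(ℝ, E) (extChartAt 𝓘(ℝ, E) x₀).symm y u)
    (mfderiv 𝓘(ℝ, E) 𝓘(ℝ, E) (extChartAt 𝓘(ℝ, E) x₀).symm y w)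

/-- `c` is a geodesic of the Levi-Civita connection on the open set `J` of parameters. In a chart,
the equation `∇_{c'} c' = 0`, i.e. `c'' + Γ(c)(c', c') = 0`, is written with the index lowered by
`g`: `g(c'', w) + (∂_{c'} g)(c', w) - (1/2) (∂_w g)(c', c') = 0` for all `w`. -/
def IsGeodesicOn (g : LorentzianMetric E M) (c : ℝ → M) (J : Set ℝ) : Prop :=
  ContMDiffOn 𝓘(ℝ, ℝ) 𝓘(ℝ, E) ∞ c J ∧
  ∀ x₀ : M, ∀ t ∈ J, c t ∈ (chartAt E x₀).source →
    ∀ ξ : ℝ → E, ξ = (fun s ↦ extChartAt 𝓘(ℝ, E) x₀ (c s)) →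
      ∀ w : E,
        g.coord x₀ (ξ t) (deriv (deriv ξ) t) w
          + fderiv ℝ (fun y ↦ g.coord x₀ y (deriv ξ t) w) (ξ t) (deriv ξ t)
          - (1 / 2) * fderiv ℝ (fun y ↦ g.coord x₀ y (deriv ξ t) (deriv ξ t)) (ξ t) w = 0

end LorentzianMetric

/-- The velocity of a curve at the parameter `t`. -/
def velocity (E : Type*) [NormedAddCommGroup E] [NormedSpace ℝ E]
    {M : Type*} [TopologicalSpace M] [ChartedSpace E M]
    (c : ℝ → M) (t : ℝ) : TangentSpace 𝓘(ℝ, E) (c t) :=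
  mfderiv 𝓘(ℝ, ℝ) 𝓘(ℝ, E) c t (1 : ℝ)

/-- The velocity at `t` of a curve defined on the parameter set `J` (one-sided at end points). -/
def velocityWithin (E : Type*) [NormedAddCommGroup E] [NormedSpace ℝ E]
    {M : Type*} [TopologicalSpace M] [ChartedSpace E M]
    (c : ℝ → M) (J : Set ℝ) (t : ℝ) : TangentSpace 𝓘(ℝ, E) (c t) :=
  mfderivWithin 𝓘(ℝ, ℝ) 𝓘(ℝ, E) c J t (1 : ℝ)

namespace LorentzianMetric

/-- `U` is a normal neighbourhood of `p`: the exponential map at `p` restricts to a diffeomorphism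
`e` of a star-shaped open neighbourhood of `0` in the tangent space at `p` (as a vector space, this
is `E`) onto `U`. That `e` is the exponential map is expressed by requiring that `t ↦ e (t v)` be
the geodesic starting at `p` with velocity `v`. -/
def IsNormalNhd (g : LorentzianMetric E M) (U : Set M) (p : M) : Prop :=
  ∃ e : OpenPartialHomeomorph E M,
    e.target = U ∧ (0 : E) ∈ e.source ∧ StarConvex ℝ 0 e.source ∧
    ContMDiffOn 𝓘(ℝ, E) 𝓘(ℝ, E) ∞ e e.source ∧
    ContMDiffOn 𝓘(ℝ, E) 𝓘(ℝ, E) ∞ e.symm e.target ∧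
    ∀ v : E,
      (⟨e ((0 : ℝ) • v), velocity E (fun t : ℝ ↦ e (t • v)) 0⟩ : TangentBundle 𝓘(ℝ, E) M)
        = ⟨p, v⟩ ∧
      g.IsGeodesicOn (fun t : ℝ ↦ e (t • v)) {t : ℝ | t • v ∈ e.source}

/-- Convex open sets: normal neighbourhoods of all their points. -/
def IsConvexNhd (g : LorentzianMetric E M) (U : Set M) : Prop :=
  IsOpen U ∧ ∀ p ∈ U, g.IsNormalNhd U p

namespace TimeOrientation

variable {g : LorentzianMetric E M}

/-- The causal relation `p <_U q`: there is a future-directed causal `C¹` curve from `p` to `q`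
which is entirely contained in `U`. -/
def CausallyPrecedesIn (τ : g.TimeOrientation) (U : Set M) (p q : M) : Prop :=
  ∃ c : ℝ → M, ContMDiffOn 𝓘(ℝ, ℝ) 𝓘(ℝ, E) 1 c (Icc 0 1) ∧ c 0 = p ∧ c 1 = q ∧
    ∀ t ∈ Icc (0 : ℝ) 1, c t ∈ U ∧ velocityWithin E c (Icc 0 1) t ∈ τ.future (c t)

/-- Future-directed causal curves `γ : [0,1] → M`, not necessarily smooth. -/
def IsCausalCurve (τ : g.TimeOrientation) (γ : ℝ → M) : Prop :=
  ContinuousOn γ (Icc 0 1) ∧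
  ∀ U : Set M, g.IsConvexNhd U → ∀ s ∈ Icc (0 : ℝ) 1, ∀ t ∈ Icc (0 : ℝ) 1, s < t →
    MapsTo γ (Icc s t) U → τ.CausallyPrecedesIn U (γ s) (γ t)

end TimeOrientation

end LorentzianMetric

/-- Absolute continuity of a curve `γ : [0,1] → M`: every parameter has a compact interval as
neighbourhood in `[0,1]` on which the curve, read in the chart at the point, is absolutely
continuous. -/
def IsAbsolutelyContinuousCurve (E : Type*) [NormedAddCommGroup E] [NormedSpace ℝ E]
    {M : Type*} [TopologicalSpace M] [ChartedSpace E M] (γ : ℝ → M) : Prop :=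
  ∀ t₀ ∈ Icc (0 : ℝ) 1, ∃ a b : ℝ, a ≤ b ∧ Icc a b ⊆ Icc 0 1 ∧ Icc a b ∈ 𝓝[Icc 0 1] t₀ ∧
    MapsTo γ (Icc a b) (chartAt E (γ t₀)).source ∧
    AbsolutelyContinuousOnInterval (fun t ↦ extChartAt 𝓘(ℝ, E) (γ t₀) (γ t)) a b

/-- Curves `γ : [0,1] → M` of class `H¹`, with respect to an auxiliary Riemannian metric `h`:
absolutely continuous curves with `∫₀¹ h(γ', γ') < ∞`. -/
def IsH1Curve
    (h : Bundle.ContMDiffRiemannianMetric 𝓘(ℝ, E) ∞ E (fun x : M ↦ TangentSpace 𝓘(ℝ, E) x))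
    (γ : ℝ → M) : Prop :=
  IsAbsolutelyContinuousCurve E γ ∧
  IntegrableOn (fun t ↦ h.inner (γ t) (velocity E γ t) (velocity E γ t)) (Icc 0 1)

/-- `H¹` curves `γ : [0,1] → M` whose velocity is future-directed causal almost everywhere. -/
def IsH1CausalCurve {g : LorentzianMetric E M} (τ : g.TimeOrientation)
    (h : Bundle.ContMDiffRiemannianMetric 𝓘(ℝ, E) ∞ E (fun x : M ↦ TangentSpace 𝓘(ℝ, E) x))
    (γ : ℝ → M) : Prop :=
  IsH1Curve h γ ∧
  ∀ᵐ t ∂(volume.restrict (Icc (0 : ℝ) 1)), velocity E γ t ∈ τ.future (γ t)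

/-- Strictly increasing continuous changes of parameter of `[0,1]`. -/
def IsReparametrization (σ : ℝ → ℝ) : Prop :=
  ContinuousOn σ (Icc 0 1) ∧ StrictMonoOn σ (Icc 0 1) ∧ σ 0 = 0 ∧ σ 1 = 1

end Spacetime

/-! Velocity implies causality. Let `γ` satisfy (ii) and stay in a convex set during `[s, t]`. In
normal coordinates at `γ(s)`, with `G` the pulled-back metric, the Gauss lemma says `G_x(x, ·) =
G_0(x, ·)`. Hence the differential of `Q(x) = G_0(x, x)` is `2 G_x(x, ·)`, and it is nonpositive on
future causal vectors wherever the position vector `x` is itself future causal, by the reverse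
Cauchy-Schwarz inequality. So a causal curve should not leave the cone of the origin. The curve
starts at the vertex of that cone, however, where this argument has no room. It is therefore first
moved by maps `Φ η` close to the identity, which keep its velocity causal and push its starting
point into the open cone. For the moved curve `Q` decreases strictly inside the cone, and `η → 0`
gives the closed cone (`eventually_mem_closedCone`). Continuation along `[s, t]` shows that the end
point is future causal at the origin (`mem_future_of_causal_curve`), and the radial geodesic to it
is the required `C¹` curve.

Causality implies velocity. Property (i) only speaks about convex sets, so arbitrarily small ones
are needed; this is Whitehead's theorem (`exists_isConvexNhd`). Inside a small one, a linear
functional that is positive on all nearby cones increases along `γ`. Differentiating, the velocity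
`v` pairs nonnegatively with the dual of the cone at its own point. The closed cone is self-dual
(`causal_of_dual`), so `v` is future causal as soon as it is nonzero (`velocity_mem`).

Reparametrization. Near each parameter some functional `ℓ` dominates the norm on the cones, so its
increments control those of the coordinates. A finite sum of such local time functions is a strictly
increasing continuous function `S` on `[0,1]`. Parametrized proportionally to `S`, the curve is
locally Lipschitz, hence `H¹`. Its velocity is nonzero almost everywhere: at a point of
differentiability with zero velocity every summand of `S` would have derivative zero, although `S`
now grows at constant positive speed.

Whitehead's theorem rests on a smooth local exponential map. The acceleration of a geodesic is
treated as an unknown in a Banach space of continuous curves, and the inverse function theorem is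
applied there. Star-shapedness of the normal domains follows because the squared Euclidean distance
to the centre is convex along short geodesics. -/

section Development

set_option linter.unusedSectionVars false
set_option maxSynthPendingDepth 3

/-! ### Absolutely continuous functions: composition and monotonicity. -/

section AbsolutelyContinuous

theorem LipschitzOnWith.comp_absolutelyContinuousOnInterval {X Y : Type*} [PseudoMetricSpace X]
    [PseudoMetricSpace Y] {K : NNReal} {F : X → Y} {s : Set X} {f : ℝ → X} {a b : ℝ}
    (hF : LipschitzOnWith K F s) (hf : AbsolutelyContinuousOnInterval f a b)
    (hs : MapsTo f (uIcc a b) s) :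
    AbsolutelyContinuousOnInterval (fun t ↦ F (f t)) a b := by
  rw [absolutelyContinuousOnInterval_iff] at hf ⊢
  intro ε hε
  obtain ⟨δ, hδ, h⟩ := hf (ε / (K + 1)) (by positivity)
  refine ⟨δ, hδ, fun I hI hlt ↦ ?_⟩
  have h1 := h I hI hlt
  have h2 : ∑ i ∈ Finset.range I.1, dist (F (f (I.2 i).1)) (F (f (I.2 i).2))
      ≤ K * ∑ i ∈ Finset.range I.1, dist (f (I.2 i).1) (f (I.2 i).2) := by
    rw [Finset.mul_sum]
    exact Finset.sum_le_sum fun i hi ↦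
      hF.dist_le_mul _ (hs (hI.1 i hi).1) _ (hs (hI.1 i hi).2)
  have hK : (0 : ℝ) ≤ K := K.2
  rw [lt_div_iff₀ (by positivity)] at h1
  have h0 : 0 ≤ ∑ i ∈ Finset.range I.1, dist (f (I.2 i).1) (f (I.2 i).2) :=
    Finset.sum_nonneg fun _ _ ↦ dist_nonneg
  nlinarith

/-- The fundamental theorem of calculus for absolutely continuous functions. This is what allows
information on velocities that holds only almost everywhere; continuity alone would not suffice. -/
theorem AbsolutelyContinuousOnInterval.le_of_ae_deriv_nonpos {f : ℝ → ℝ} {a b : ℝ} (hab : a ≤ b)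
    (hf : AbsolutelyContinuousOnInterval f a b)
    (h : ∀ᵐ t, t ∈ Ioo a b → deriv f t ≤ 0) : f b ≤ f a := by
  have h1 := hf.integral_deriv_eq_sub
  have h2 : ∫ x in a..b, deriv f x ≤ 0 := by
    rw [intervalIntegral.integral_of_le hab, integral_Ioc_eq_integral_Ioo]
    apply setIntegral_nonpos_of_ae_restrict
    rw [Filter.EventuallyLE, ae_restrict_iff' measurableSet_Ioo]
    exact h
  linarith

end AbsolutelyContinuous

/-! ### Smoothness of superposition operators on spaces of continuous curves. -/

section Superposition

variable {K : Type*} [TopologicalSpace K] [CompactSpace K]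

/-- Pointwise application of a continuous family of operators to a continuous curve. -/
noncomputable def ContinuousMap.pointwiseApply {F G H : Type*} [NormedAddCommGroup F]
    [NormedSpace ℝ F] [NormedAddCommGroup G] [NormedSpace ℝ G] [NormedAddCommGroup H]
    [NormedSpace ℝ H] (B : H →L[ℝ] F →L[ℝ] G) : C(K, H) →L[ℝ] C(K, F) →L[ℝ] C(K, G) :=
  LinearMap.mkContinuous₂
    (LinearMap.mk₂ ℝ (fun (L : C(K, H)) (β : C(K, F)) ↦
      (⟨fun t ↦ B (L t) (β t), (B.continuous.comp L.continuous).clm_apply β.continuous⟩ : C(K, G)))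
      (fun _ _ _ ↦ by ext; simp) (fun _ _ _ ↦ by ext; simp)
      (fun _ _ _ ↦ by ext; simp) (fun _ _ _ ↦ by ext; simp)) ‖B‖ (by
    intro L β
    refine (ContinuousMap.norm_le _ (by positivity)).2 fun t ↦ ?_
    refine (B.le_opNorm₂ (L t) (β t)).trans ?_
    gcongr
    · exact L.norm_coe_le_norm t
    · exact β.norm_coe_le_norm t)

@[simp] theorem ContinuousMap.pointwiseApply_apply {F G H : Type*} [NormedAddCommGroup F]
    [NormedSpace ℝ F] [NormedAddCommGroup G] [NormedSpace ℝ G] [NormedAddCommGroup H]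
    [NormedSpace ℝ H] (B : H →L[ℝ] F →L[ℝ] G) (L : C(K, H)) (β : C(K, F)) (t : K) :
    ContinuousMap.pointwiseApply B L β t = B (L t) (β t) := rfl

/-- The mean value inequality is applied at each `t` on the segment from `α t` to `β t`. The bound
is uniform in `t` because post-composition with `f'` is continuous for the sup norm. -/
theorem ContinuousMap.hasFDerivAt_comp {F G H : Type*} [NormedAddCommGroup F] [NormedSpace ℝ F]
    [NormedAddCommGroup G] [NormedSpace ℝ G] [NormedAddCommGroup H] [NormedSpace ℝ H]
    (B : H →L[ℝ] F →L[ℝ] G) (f : C(F, G)) (f' : C(F, H))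
    (hf : ∀ x, HasFDerivAt f (B (f' x)) x) (α : C(K, F)) :
    HasFDerivAt (fun β : C(K, F) ↦ f.comp β)
      (ContinuousMap.pointwiseApply B (f'.comp α)) α := by
  rw [hasFDerivAt_iff_isLittleO, Asymptotics.isLittleO_iff]
  intro c hc
  have hcont : Continuous (fun β : C(K, F) ↦ f'.comp β) := ContinuousMap.continuous_postcomp f'
  obtain ⟨δ, hδ, h⟩ := Metric.continuous_iff.1 hcont α (c / (‖B‖ + 1)) (by positivity)
  filter_upwards [Metric.ball_mem_nhds α hδ] with β hβ
  refine (ContinuousMap.norm_le _ (by positivity)).2 fun t ↦ ?_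
  have key : ‖f (β t) - f (α t) - B (f' (α t)) (β t - α t)‖ ≤ c * ‖β t - α t‖ := by
    refine (convex_segment (α t) (β t)).norm_image_sub_le_of_norm_hasFDerivWithin_le'
      (f := f) (f' := fun x ↦ B (f' x)) (fun x _ ↦ (hf x).hasFDerivWithinAt) ?_
      (left_mem_segment ℝ _ _) (right_mem_segment ℝ _ _)
    rintro x ⟨p, q, hp, hq, hpq, rfl⟩
    have h1 := h (α + q • (β - α)) (by
      rw [dist_eq_norm, add_sub_cancel_left, norm_smul, Real.norm_of_nonneg hq]
      rw [Metric.mem_ball, dist_eq_norm] at hβ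
      have : q ≤ 1 := by linarith
      nlinarith [norm_nonneg (β - α)])
    have h2 : ‖f' (p • α t + q • β t) - f' (α t)‖
        ≤ ‖f'.comp (α + q • (β - α)) - f'.comp α‖ := by
      refine le_trans (le_of_eq ?_) ((f'.comp (α + q • (β - α)) - f'.comp α).norm_coe_le_norm t)
      have : p • α t + q • β t = α t + q • (β t - α t) := by
        obtain rfl : p = 1 - q := by linarith
        module
      rw [this]
      rfl
    rw [dist_eq_norm, lt_div_iff₀ (by positivity)] at h1
    rw [← map_sub]
    refine (B.le_opNorm _).trans ?_
    nlinarith [norm_nonneg B, norm_nonneg (f' (p • α t + q • β t) - f' (α t))]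
  refine key.trans ?_
  gcongr
  exact (β - α).norm_coe_le_norm t

universe u

/-- The derivative is post-composition with `f'` followed by a bounded linear map, so one order is
gained per induction step. `F` and `G` share a universe so that the induction hypothesis covers the
target `F →L[ℝ] G`. -/
theorem ContinuousMap.contDiff_comp_nat (n : ℕ) : ∀ {F G : Type u} [NormedAddCommGroup F]
    [NormedSpace ℝ F] [NormedAddCommGroup G] [NormedSpace ℝ G] (f : C(F, G)),
    ContDiff ℝ n f → ContDiff ℝ n (fun β : C(K, F) ↦ f.comp β) := by
  induction n with
  | zero =>
    intro F G _ _ _ _ f _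
    exact contDiff_zero.2 (ContinuousMap.continuous_postcomp f)
  | succ n ih =>
    intro F G _ _ _ _ f hf
    have h1 : ContDiff ℝ n (fderiv ℝ f) := hf.fderiv_right (by norm_cast)
    let f' : C(F, F →L[ℝ] G) := ⟨fderiv ℝ f, h1.continuous⟩
    have hd : ∀ x, HasFDerivAt f (f' x) x := fun x ↦
      ((hf.differentiable (by simp)) x).hasFDerivAt
    have h2 := ih f' h1
    push_cast
    rw [contDiff_succ_iff_hasFDerivAt]
    let B := ContinuousLinearMap.id ℝ (F →L[ℝ] G)
    exact ⟨fun α ↦ ContinuousMap.pointwiseApply B (f'.comp α),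
      (ContinuousMap.pointwiseApply (K := K) B).contDiff.comp h2,
      fun α ↦ ContinuousMap.hasFDerivAt_comp B f f' hd α⟩

theorem ContinuousMap.contDiff_comp {F G : Type u} [NormedAddCommGroup F]
    [NormedSpace ℝ F] [NormedAddCommGroup G] [NormedSpace ℝ G] (f : C(F, G)) (hf : ContDiff ℝ ∞ f) :
    ContDiff ℝ ∞ (fun β : C(K, F) ↦ f.comp β) :=
  contDiff_infty.2 fun n ↦ ContinuousMap.contDiff_comp_nat n f (contDiff_infty.1 hf n)

end Superposition

/-! ### The smooth inverse function theorem. -/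

section InverseFunction

/-- The inverse function theorem for smooth maps, with smoothness of the inverse on its domain. -/
theorem ContDiffOn.exists_openPartialHomeomorph {X Y : Type*} [NormedAddCommGroup X]
    [NormedSpace ℝ X] [CompleteSpace X] [NormedAddCommGroup Y] [NormedSpace ℝ Y]
    {f : X → Y} {s : Set X} (hs : IsOpen s) (hf : ContDiffOn ℝ ∞ f s) {a : X} (ha : a ∈ s)
    (f' : X ≃L[ℝ] Y) (hf' : HasFDerivAt f (f' : X →L[ℝ] Y) a) :
    ∃ Φ : OpenPartialHomeomorph X Y, (Φ : X → Y) = f ∧ a ∈ Φ.source ∧ Φ.source ⊆ s ∧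
      ContDiffOn ℝ ∞ Φ.symm Φ.target := by
  have hfa : ContDiffAt ℝ ∞ f a := hf.contDiffAt (hs.mem_nhds ha)
  let Φ₀ := hfa.toOpenPartialHomeomorph f hf' (by simp)
  -- Restricting to the open set of points with invertible derivative makes the local inverse smooth
  -- on its whole domain, not only at one point.
  have hopen : IsOpen {x | x ∈ s ∧ fderiv ℝ f x ∈ range ((↑) : (X ≃L[ℝ] Y) → X →L[ℝ] Y)} := by
    have hc : ContinuousOn (fderiv ℝ f) s := hf.continuousOn_fderiv_of_isOpen hs (by simp)
    exact hc.isOpen_inter_preimage hs (ContinuousLinearEquiv.isOpen)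
  let Φ := Φ₀.restrOpen _ hopen
  have hΦ : (Φ : X → Y) = f := rfl
  refine ⟨Φ, hΦ, ⟨hfa.mem_toOpenPartialHomeomorph_source hf' (by simp), ha, f', hf'.fderiv.symm⟩,
    fun x hx ↦ hx.2.1, fun y hy ↦ ?_⟩
  have hx := Φ.map_target hy
  obtain ⟨-, hxs, e, he⟩ := hx
  have hd : ContDiffAt ℝ ∞ f (Φ.symm y) := hf.contDiffAt (hs.mem_nhds hxs)
  refine (Φ.contDiffAt_symm hy (f₀' := e) ?_ hd).contDiffWithinAt
  rw [he]
  exact (hd.differentiableAt (by simp)).hasFDerivAt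

end InverseFunction

/-! ### Local exponential map of a spray. -/

section LocalExponential

universe u
variable {E : Type u} [NormedAddCommGroup E] [NormedSpace ℝ E]

/-- The primitive, vanishing at `0`, of a continuous curve on `[-1, 1]`. -/
noncomputable def curvePrimitive (β : C(Icc (-1 : ℝ) 1, E)) (t : ℝ) : E :=
  ∫ s in (0 : ℝ)..t, IccExtend (by norm_num : (-1 : ℝ) ≤ 1) β s

/-- The second primitive, vanishing to first order at `0`, of a continuous curve on `[-1, 1]`. -/
noncomputable def curvePrimitive₂ (β : C(Icc (-1 : ℝ) 1, E)) (t : ℝ) : E :=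
  ∫ s in (0 : ℝ)..t, curvePrimitive β s

theorem continuous_IccExtend_curve (β : C(Icc (-1 : ℝ) 1, E)) :
    Continuous (IccExtend (by norm_num : (-1 : ℝ) ≤ 1) β) := β.continuous.Icc_extend'

theorem curvePrimitive_zero_right (β : C(Icc (-1 : ℝ) 1, E)) : curvePrimitive β 0 = 0 := by
  simp [curvePrimitive]

theorem curvePrimitive₂_zero_right (β : C(Icc (-1 : ℝ) 1, E)) : curvePrimitive₂ β 0 = 0 := by
  simp [curvePrimitive₂]

theorem norm_curvePrimitive_le (β : C(Icc (-1 : ℝ) 1, E)) (t : ℝ) :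
    ‖curvePrimitive β t‖ ≤ ‖β‖ * |t| := by
  have := intervalIntegral.norm_integral_le_of_norm_le_const (a := 0) (b := t) (C := ‖β‖)
    (f := IccExtend (by norm_num : (-1 : ℝ) ≤ 1) β) fun x _ ↦ β.norm_coe_le_norm _
  simpa [curvePrimitive] using this

section Complete
variable [CompleteSpace E]

theorem hasDerivAt_curvePrimitive (β : C(Icc (-1 : ℝ) 1, E)) (t : ℝ) :
    HasDerivAt (curvePrimitive β) (IccExtend (by norm_num : (-1 : ℝ) ≤ 1) β t) t :=
  (continuous_IccExtend_curve β).integral_hasStrictDerivAt 0 t |>.hasDerivAt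

theorem continuous_curvePrimitive (β : C(Icc (-1 : ℝ) 1, E)) : Continuous (curvePrimitive β) :=
  continuous_iff_continuousAt.2 fun t ↦ (hasDerivAt_curvePrimitive β t).continuousAt

theorem hasDerivAt_curvePrimitive₂ (β : C(Icc (-1 : ℝ) 1, E)) (t : ℝ) :
    HasDerivAt (curvePrimitive₂ β) (curvePrimitive β t) t :=
  (continuous_curvePrimitive β).integral_hasStrictDerivAt 0 t |>.hasDerivAt

theorem continuous_curvePrimitive₂ (β : C(Icc (-1 : ℝ) 1, E)) : Continuous (curvePrimitive₂ β) :=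
  continuous_iff_continuousAt.2 fun t ↦ (hasDerivAt_curvePrimitive₂ β t).continuousAt

theorem curvePrimitive_add (β γ : C(Icc (-1 : ℝ) 1, E)) (t : ℝ) :
    curvePrimitive (β + γ) t = curvePrimitive β t + curvePrimitive γ t := by
  rw [curvePrimitive, curvePrimitive, curvePrimitive, ← intervalIntegral.integral_add
    ((continuous_IccExtend_curve β).intervalIntegrable _ _)
    ((continuous_IccExtend_curve γ).intervalIntegrable _ _)]
  rfl

theorem curvePrimitive_smul (c : ℝ) (β : C(Icc (-1 : ℝ) 1, E)) (t : ℝ) :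
    curvePrimitive (c • β) t = c • curvePrimitive β t := by
  rw [curvePrimitive, curvePrimitive, ← intervalIntegral.integral_smul]
  rfl

theorem curvePrimitive₂_add (β γ : C(Icc (-1 : ℝ) 1, E)) (t : ℝ) :
    curvePrimitive₂ (β + γ) t = curvePrimitive₂ β t + curvePrimitive₂ γ t := by
  rw [curvePrimitive₂, curvePrimitive₂, curvePrimitive₂, ← intervalIntegral.integral_add
    ((continuous_curvePrimitive β).intervalIntegrable _ _)
    ((continuous_curvePrimitive γ).intervalIntegrable _ _)]
  simp only [curvePrimitive_add]

theorem curvePrimitive₂_smul (c : ℝ) (β : C(Icc (-1 : ℝ) 1, E)) (t : ℝ) :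
    curvePrimitive₂ (c • β) t = c • curvePrimitive₂ β t := by
  rw [curvePrimitive₂, curvePrimitive₂, ← intervalIntegral.integral_smul]
  simp only [curvePrimitive_smul]

theorem norm_curvePrimitive₂_le (β : C(Icc (-1 : ℝ) 1, E)) {t : ℝ} (ht : t ∈ Icc (-1 : ℝ) 1) :
    ‖curvePrimitive₂ β t‖ ≤ ‖β‖ := by
  have ht' : |t| ≤ 1 := abs_le.2 ht
  have := intervalIntegral.norm_integral_le_of_norm_le_const (a := 0) (b := t) (C := ‖β‖)
    (f := curvePrimitive β) fun x hx ↦ by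
      refine (norm_curvePrimitive_le β x).trans ?_
      have : |x| ≤ 1 := by
        rw [abs_le]
        rcases mem_uIoc.1 hx with h | h <;> constructor <;> linarith [h.1, h.2, ht.1, ht.2]
      nlinarith [norm_nonneg β]
  rw [sub_zero] at this
  refine this.trans ?_
  nlinarith [norm_nonneg β]

/-- The second primitive of `s ↦ T² β(T s)` is the second primitive of `β` at `T s`. -/
noncomputable def curveRescale (T : ℝ) (β : C(Icc (-1 : ℝ) 1, E)) : C(Icc (-1 : ℝ) 1, E) :=
  ⟨fun s ↦ T ^ 2 • IccExtend (by norm_num : (-1 : ℝ) ≤ 1) β (T * s),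
    continuous_const.smul ((continuous_IccExtend_curve β).comp
      (continuous_const.mul continuous_subtype_val))⟩

theorem curvePrimitive_rescale (T : ℝ) (β : C(Icc (-1 : ℝ) 1, E)) {t : ℝ}
    (ht : t ∈ Icc (-1 : ℝ) 1) :
    curvePrimitive (curveRescale T β) t = T • curvePrimitive β (T * t) := by
  have h : curvePrimitive (curveRescale T β) t
      = ∫ s in (0 : ℝ)..t, T ^ 2 • IccExtend (by norm_num : (-1 : ℝ) ≤ 1) β (T * s) := by
    refine intervalIntegral.integral_congr fun s hs ↦ ?_
    have hs' : s ∈ Icc (-1 : ℝ) 1 := by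
      rcases mem_uIcc.1 hs with h | h <;> constructor <;> linarith [h.1, h.2, ht.1, ht.2]
    rw [IccExtend_of_mem _ _ hs']
    rfl
  rw [h, intervalIntegral.integral_smul, pow_two, mul_smul,
    intervalIntegral.smul_integral_comp_mul_left, mul_zero]
  rfl

theorem curvePrimitive₂_rescale (T : ℝ) (β : C(Icc (-1 : ℝ) 1, E)) {t : ℝ}
    (ht : t ∈ Icc (-1 : ℝ) 1) :
    curvePrimitive₂ (curveRescale T β) t = curvePrimitive₂ β (T * t) := by
  have h : curvePrimitive₂ (curveRescale T β) t
      = ∫ s in (0 : ℝ)..t, T • curvePrimitive β (T * s) := by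
    refine intervalIntegral.integral_congr fun s hs ↦ ?_
    refine curvePrimitive_rescale T β ?_
    rcases mem_uIcc.1 hs with h | h <;> constructor <;> linarith [h.1, h.2, ht.1, ht.2]
  rw [h, intervalIntegral.integral_smul, intervalIntegral.smul_integral_comp_mul_left, mul_zero]
  rfl

theorem norm_curveRescale_le {T : ℝ} (hT : T ∈ Icc (-1 : ℝ) 1) (β : C(Icc (-1 : ℝ) 1, E)) :
    ‖curveRescale T β‖ ≤ ‖β‖ := by
  refine (ContinuousMap.norm_le _ (norm_nonneg _)).2 fun s ↦ ?_
  change ‖T ^ 2 • β _‖ ≤ _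
  rw [norm_smul, Real.norm_of_nonneg (by positivity)]
  have h1 : T ^ 2 ≤ 1 := by nlinarith [hT.1, hT.2]
  exact (mul_le_of_le_one_left (norm_nonneg _) h1).trans (β.norm_coe_le_norm _)

variable (E) in
/-- The curve with initial position `q`, initial velocity `v` and acceleration `β`, together with
its velocity. -/
noncomputable def curveOfAcceleration :
    E × E × C(Icc (-1 : ℝ) 1, E) →L[ℝ] C(Icc (-1 : ℝ) 1, E × E) :=
  LinearMap.mkContinuous
    { toFun := fun z ↦ ⟨fun t ↦ (z.1 + (t : ℝ) • z.2.1 + curvePrimitive₂ z.2.2 t,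
          z.2.1 + curvePrimitive z.2.2 t),
        ((continuous_const.add (continuous_subtype_val.smul continuous_const)).add
          ((continuous_curvePrimitive₂ z.2.2).comp continuous_subtype_val)).prodMk
          (continuous_const.add ((continuous_curvePrimitive z.2.2).comp continuous_subtype_val))⟩
      map_add' := fun z w ↦ by
        ext t
        · simp only [Prod.fst_add, Prod.snd_add, curvePrimitive₂_add, ContinuousMap.coe_mk,
            ContinuousMap.add_apply, Prod.mk_add_mk]
          module
        · simp only [Prod.fst_add, Prod.snd_add, curvePrimitive_add, ContinuousMap.coe_mk,
            ContinuousMap.add_apply, Prod.mk_add_mk]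
          module
      map_smul' := fun c z ↦ by
        ext t
        · simp only [Prod.smul_fst, Prod.smul_snd, curvePrimitive₂_smul, ContinuousMap.coe_mk,
            ContinuousMap.smul_apply, RingHom.id_apply, Prod.smul_mk]
          module
        · simp only [Prod.smul_fst, Prod.smul_snd, curvePrimitive_smul, ContinuousMap.coe_mk,
            ContinuousMap.smul_apply, RingHom.id_apply, Prod.smul_mk]
          module } 3 (by
    intro z
    refine (ContinuousMap.norm_le _ (by positivity)).2 fun t ↦ ?_
    have ht : |(t : ℝ)| ≤ 1 := abs_le.2 t.2
    have h1 : ‖z.1‖ ≤ ‖z‖ := norm_fst_le z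
    have h2 : ‖z.2.1‖ ≤ ‖z‖ := (norm_fst_le z.2).trans (norm_snd_le z)
    have h3 : ‖z.2.2‖ ≤ ‖z‖ := (norm_snd_le z.2).trans (norm_snd_le z)
    have h4 := norm_curvePrimitive₂_le z.2.2 t.2
    have h5 := norm_curvePrimitive_le z.2.2 t
    refine max_le ?_ ?_
    · refine (norm_add₃_le).trans ?_
      have : ‖(t : ℝ) • z.2.1‖ ≤ ‖z.2.1‖ := by
        rw [norm_smul]; exact mul_le_of_le_one_left (norm_nonneg _) ht
      linarith
    · refine (norm_add_le _ _).trans ?_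
      have : ‖z.2.2‖ * |(t : ℝ)| ≤ ‖z.2.2‖ := mul_le_of_le_one_right (norm_nonneg _) ht
      linarith [norm_nonneg z])

theorem curveOfAcceleration_apply (z : E × E × C(Icc (-1 : ℝ) 1, E)) (t : Icc (-1 : ℝ) 1) :
    curveOfAcceleration E z t = (z.1 + (t : ℝ) • z.2.1 + curvePrimitive₂ z.2.2 t,
      z.2.1 + curvePrimitive z.2.2 t) := rfl

end Complete

/-- Continuity bounds `S` by `1` near `(x₀, 0)`, and homogeneity scales any `v` into that
neighbourhood. -/
theorem exists_quadratic_bound {S : E × E → E} (hS : Continuous S)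
    (hom : ∀ (t : ℝ) (y v : E), S (y, t • v) = t ^ 2 • S (y, v)) (x₀ : E) :
    ∃ δ > 0, ∃ C > 0, ∀ y ∈ Metric.ball x₀ δ, ∀ v, ‖S (y, v)‖ ≤ C * ‖v‖ ^ 2 := by
  have h0 : ∀ y, S (y, 0) = 0 := fun y ↦ by simpa using hom 0 y 0
  obtain ⟨δ, hδ, h⟩ := Metric.continuous_iff.1 hS (x₀, 0) 1 one_pos
  refine ⟨δ, hδ, (2 / δ) ^ 2, by positivity, fun y hy v ↦ ?_⟩
  rcases eq_or_ne v 0 with rfl | hv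
  · simp [h0]
  have hv' : 0 < ‖v‖ := norm_pos_iff.2 hv
  have h1 := h (y, (δ / (2 * ‖v‖)) • v) (by
    rw [Prod.dist_eq, max_lt_iff]
    refine ⟨hy, ?_⟩
    rw [dist_zero_right, norm_smul, Real.norm_of_nonneg (by positivity)]
    field_simp
    linarith)
  rw [h0, dist_zero_right, hom, norm_smul, Real.norm_of_nonneg (by positivity)] at h1
  have h2 : (2 / δ) ^ 2 * ‖v‖ ^ 2 = 1 / (δ / (2 * ‖v‖)) ^ 2 := by field_simp
  rw [h2, le_div_iff₀ (by positivity)]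
  linarith

theorem hasFDerivAt_zero_of_homogeneous {S : E × E → E} (hS : Continuous S)
    (hom : ∀ (t : ℝ) (y v : E), S (y, t • v) = t ^ 2 • S (y, v)) (x₀ : E) :
    HasFDerivAt S (0 : E × E →L[ℝ] E) (x₀, 0) := by
  have h0 : ∀ y, S (y, 0) = 0 := fun y ↦ by simpa using hom 0 y 0
  obtain ⟨δ, hδ, C, hC, h⟩ := exists_quadratic_bound hS hom x₀
  rw [hasFDerivAt_iff_isLittleO, Asymptotics.isLittleO_iff]
  intro c hc
  filter_upwards [Metric.ball_mem_nhds (x₀, (0 : E)) (lt_min hδ (div_pos hc hC))] with z hz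
  rw [Metric.mem_ball, Prod.dist_eq, max_lt_iff] at hz
  have h1 := h z.1 (hz.1.trans_le (min_le_left _ _)) z.2
  have h2 : ‖z.2‖ < c / C := by simpa using hz.2.trans_le (min_le_right _ _)
  have h3 : ‖z.2‖ ≤ ‖z - (x₀, 0)‖ := by simpa using norm_snd_le (z - (x₀, (0 : E)))
  rw [lt_div_iff₀ hC] at h2
  simp only [h0, sub_zero, zero_apply]
  calc ‖S z‖ ≤ C * ‖z.2‖ ^ 2 := h1
    _ = (‖z.2‖ * C) * ‖z.2‖ := by ring
    _ ≤ c * ‖z - (x₀, 0)‖ := by gcongr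

variable [CompleteSpace E]

/-- Local solutions of the second order equation `c'' = S(c, c')`, with `S` smooth and quadratic in
the velocity: the map sending initial data to the solution at time one is smooth, and rescaling
initial velocities corresponds to rescaling time. -/
theorem exists_local_exponential {S : E × E → E} (hS : ContDiff ℝ ∞ S)
    (hom : ∀ (t : ℝ) (y v : E), S (y, t • v) = t ^ 2 • S (y, v)) (x₀ : E) :
    ∃ r > 0, ∃ Exp : E × E → E,
      ContDiffOn ℝ ∞ Exp (Metric.ball x₀ r ×ˢ Metric.ball 0 r) ∧
      ∀ q ∈ Metric.ball x₀ r, ∀ v ∈ Metric.ball (0 : E) r, ∃ c c' : ℝ → E,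
        (∀ t ∈ Icc (-1 : ℝ) 1, Exp (q, t • v) = c t) ∧ c 0 = q ∧ c' 0 = v ∧
        (∀ t, HasDerivAt c (c' t) t) ∧
        ∀ t ∈ Ioo (-1 : ℝ) 1, HasDerivAt c' (S (c t, c' t)) t := by
  let K := Icc (-1 : ℝ) 1
  let X := E × E × C(K, E)
  let f : C(E × E, E) := ⟨S, hS.continuous⟩
  let N : C(K, E × E) → C(K, E) := fun α ↦ f.comp α
  have hN : ContDiff ℝ ∞ N := ContinuousMap.contDiff_comp f hS
  -- The unknown is the acceleration itself: `Ψ` vanishes exactly when the curve with the given data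
  -- solves the equation. Carrying the initial data along in `G` turns the inverse function theorem
  -- into an implicit one with parameters.
  let Ψ : X → C(K, E) := fun z ↦ z.2.2 - N (curveOfAcceleration E z)
  let G : X → X := fun z ↦ (z.1, z.2.1, Ψ z)
  have hΨ : ContDiff ℝ ∞ Ψ :=
    (contDiff_snd.comp contDiff_snd).sub (hN.comp (curveOfAcceleration E).contDiff)
  have hG : ContDiff ℝ ∞ G := contDiff_fst.prodMk ((contDiff_fst.comp contDiff_snd).prodMk hΨ)
  let z₀ : X := (x₀, 0, 0)
  have hS0 : ∀ y, S (y, 0) = 0 := fun y ↦ by simpa using hom 0 y 0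
  have hz₀ : curveOfAcceleration E z₀ = ContinuousMap.const K (x₀, (0 : E)) := by
    ext t
    · simp [curveOfAcceleration_apply, z₀, curvePrimitive₂, curvePrimitive, IccExtend]; rfl
    · simp [curveOfAcceleration_apply, z₀, curvePrimitive, IccExtend]; rfl
  have hNz₀ : N (curveOfAcceleration E z₀) = 0 := by
    rw [hz₀]; ext t; exact hS0 x₀
  have hGz₀ : G z₀ = z₀ := by
    simp only [G, Ψ, hNz₀]; simp [z₀]
  -- `S` vanishes to second order at zero velocity, so `N` has zero derivative at a constant curve
  -- and `G` has the identity as derivative there.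
  have hdN : HasFDerivAt N (0 : C(K, E × E) →L[ℝ] C(K, E)) (curveOfAcceleration E z₀) := by
    let f' : C(E × E, E × E →L[ℝ] E) :=
      ⟨fderiv ℝ S, (hS.continuous_fderiv (by simp))⟩
    have h1 := ContinuousMap.hasFDerivAt_comp (ContinuousLinearMap.id ℝ (E × E →L[ℝ] E)) f f'
      (fun x ↦ ((hS.differentiable (by simp)) x).hasFDerivAt) (curveOfAcceleration E z₀)
    convert h1 using 1
    ext β t
    rw [hz₀]
    have : fderiv ℝ S (x₀, 0) = 0 := (hasFDerivAt_zero_of_homogeneous hS.continuous hom x₀).fderiv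
    change 0 = (fderiv ℝ S (x₀, 0)) (β t)
    rw [this]; rfl
  have hdG : HasFDerivAt G ((ContinuousLinearEquiv.refl ℝ X : X ≃L[ℝ] X) : X →L[ℝ] X) z₀ := by
    have h1 : HasFDerivAt (fun z : X ↦ N (curveOfAcceleration E z)) (0 : X →L[ℝ] C(K, E)) z₀ := by
      have := hdN.comp z₀ (curveOfAcceleration E).hasFDerivAt
      simpa using! this
    have h2 : HasFDerivAt (fun z : X ↦ z.2.2)
        ((ContinuousLinearMap.snd ℝ E C(K, E)).comp (ContinuousLinearMap.snd ℝ E (E × C(K, E)))) z₀ :=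
      ((ContinuousLinearMap.snd ℝ E C(K, E)).comp
        (ContinuousLinearMap.snd ℝ E (E × C(K, E)))).hasFDerivAt
    have h3 : HasFDerivAt (fun z : X ↦ z.2.1)
        ((ContinuousLinearMap.fst ℝ E C(K, E)).comp (ContinuousLinearMap.snd ℝ E (E × C(K, E)))) z₀ :=
      ((ContinuousLinearMap.fst ℝ E C(K, E)).comp
        (ContinuousLinearMap.snd ℝ E (E × C(K, E)))).hasFDerivAt
    have h4 : HasFDerivAt (fun z : X ↦ z.1) (ContinuousLinearMap.fst ℝ E (E × C(K, E))) z₀ :=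
      (ContinuousLinearMap.fst ℝ E (E × C(K, E))).hasFDerivAt
    exact (h4.prodMk (h3.prodMk (h2.sub h1))).congr_fderiv (by rw [sub_zero]; rfl)
  obtain ⟨Φ, hΦ, hz₀s, -, hΦsymm⟩ := hG.contDiffOn.exists_openPartialHomeomorph isOpen_univ
    (mem_univ z₀) (ContinuousLinearEquiv.refl ℝ X) hdG
  obtain ⟨r₀, hr₀, hball⟩ := Metric.isOpen_iff.1 Φ.open_source z₀ hz₀s
  have hmemball (a b : E) (c : C(K, E)) : ((a, b, c) : X) ∈ Metric.ball z₀ r₀ ↔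
      ‖a - x₀‖ < r₀ ∧ ‖b‖ < r₀ ∧ ‖c‖ < r₀ := by
    rw [mem_ball_iff_norm]
    change max ‖a - x₀‖ (max ‖b - 0‖ ‖c - 0‖) < r₀ ↔ _
    simp
  have hz₀t : z₀ ∈ Φ.target := by
    have := Φ.map_source hz₀s
    rwa [hΦ, hGz₀] at this
  have hsymm₀ : Φ.symm z₀ = z₀ := by
    have := Φ.left_inv hz₀s
    rwa [hΦ, hGz₀] at this
  let ι : E × E → X := fun p ↦ (p.1, p.2, 0)
  have hι : ContDiff ℝ ∞ ι := contDiff_fst.prodMk (contDiff_snd.prodMk contDiff_const)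
  have hnear : ∀ᶠ p in 𝓝 (x₀, (0 : E)), ι p ∈ Φ.target ∧ Φ.symm (ι p) ∈ Metric.ball z₀ r₀ := by
    have h1 : ∀ᶠ z in 𝓝 z₀, z ∈ Φ.target ∧ Φ.symm z ∈ Metric.ball z₀ r₀ := by
      refine (Φ.open_target.eventually_mem hz₀t).and ?_
      have := (Φ.continuousAt_symm hz₀t)
      refine this.eventually ?_
      rw [hsymm₀]
      exact Metric.ball_mem_nhds _ hr₀
    exact (show Filter.Tendsto ι (𝓝 (x₀, 0)) (𝓝 z₀) from hι.continuous.continuousAt).eventually h1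
  obtain ⟨r, hr, hrnear⟩ := Metric.eventually_nhds_iff.1 hnear
  have hdom : ∀ p ∈ Metric.ball x₀ r ×ˢ Metric.ball (0 : E) r,
      ι p ∈ Φ.target ∧ Φ.symm (ι p) ∈ Metric.ball z₀ r₀ := fun p hp ↦ hrnear (by
    rw [Prod.dist_eq]; exact max_lt hp.1 hp.2)
  let b : E × E → C(K, E) := fun p ↦ (Φ.symm (ι p)).2.2
  have hb : ∀ p ∈ Metric.ball x₀ r ×ˢ Metric.ball (0 : E) r,
      Φ.symm (ι p) = (p.1, p.2, b p) ∧ b p = N (curveOfAcceleration E (p.1, p.2, b p)) := by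
    intro p hp
    have h1 := Φ.right_inv (hdom p hp).1
    rw [hΦ] at h1
    have e1 : (Φ.symm (ι p)).1 = p.1 := congrArg Prod.fst h1
    have e2 : (Φ.symm (ι p)).2.1 = p.2 := congrArg (fun z : X ↦ z.2.1) h1
    have e3 : Ψ (Φ.symm (ι p)) = 0 := congrArg (fun z : X ↦ z.2.2) h1
    have e4 : Φ.symm (ι p) = (p.1, p.2, b p) := Prod.ext e1 (Prod.ext e2 rfl)
    refine ⟨e4, ?_⟩
    rw [e4] at e3
    exact sub_eq_zero.1 e3
  let one : K := ⟨1, by norm_num, le_rfl⟩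
  refine ⟨r, hr, fun p ↦ (curveOfAcceleration E (p.1, p.2, b p) one).1, ?_, ?_⟩
  · have hbs : ContDiffOn ℝ ∞ b (Metric.ball x₀ r ×ˢ Metric.ball 0 r) := by
      refine (contDiff_snd.comp contDiff_snd).comp_contDiffOn ?_
      exact hΦsymm.comp hι.contDiffOn fun p hp ↦ (hdom p hp).1
    have h1 : ContDiffOn ℝ ∞ (fun p : E × E ↦ ((p.1, p.2, b p) : X))
        (Metric.ball x₀ r ×ˢ Metric.ball 0 r) :=
      contDiffOn_fst.prodMk (contDiffOn_snd.prodMk hbs)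
    have h2 : ContDiff ℝ ∞ (fun z : X ↦ (ContinuousMap.evalCLM ℝ one (curveOfAcceleration E z)).1) :=
      contDiff_fst.comp
        (((ContinuousMap.evalCLM ℝ one).comp (curveOfAcceleration E)).contDiff)
    exact h2.comp_contDiffOn h1
  · intro q hq v hv
    have hqv : (q, v) ∈ Metric.ball x₀ r ×ˢ Metric.ball (0 : E) r := ⟨hq, hv⟩
    obtain ⟨e1, e2⟩ := hb _ hqv
    dsimp only at e1 e2
    set β := b (q, v) with hβ
    refine ⟨fun t ↦ q + t • v + curvePrimitive₂ β t, fun t ↦ v + curvePrimitive β t, ?_, ?_, ?_, ?_, ?_⟩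
    · intro T hT
      have hT' : |T| ≤ 1 := abs_le.2 hT
      have hTv : (q, T • v) ∈ Metric.ball x₀ r ×ˢ Metric.ball (0 : E) r := by
        refine ⟨hq, ?_⟩
        rw [mem_ball_zero_iff] at hv ⊢
        rw [norm_smul]
        exact (mul_le_of_le_one_left (norm_nonneg _) hT').trans_lt hv
      have hmem : ∀ t : ℝ, t ∈ Icc (-1 : ℝ) 1 → T * t ∈ Icc (-1 : ℝ) 1 := fun t ht ↦ by
        refine abs_le.1 ?_
        rw [abs_mul]
        exact mul_le_one₀ hT' (abs_nonneg _) (abs_le.2 ht)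
      -- Injectivity of `Φ` replaces a uniqueness theorem for the equation: the rescaled
      -- acceleration solves it for the data `(q, T • v)`, and it lies in the source of `Φ` because
      -- rescaling does not increase the norm.
      have h1 : b (q, T • v) = curveRescale T β := by
        have hin : ((q, T • v, curveRescale T β) : X) ∈ Φ.source := by
          apply hball
          have := (hdom _ hqv).2
          rw [e1] at this
          rw [hmemball] at this ⊢
          refine ⟨this.1, ?_, (norm_curveRescale_le hT β).trans_lt this.2.2⟩
          rw [norm_smul]
          exact (mul_le_of_le_one_left (norm_nonneg _) hT').trans_lt this.2.1
        have hGin : G (q, T • v, curveRescale T β) = ι (q, T • v) := by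
          refine Prod.ext rfl (Prod.ext rfl ?_)
          refine sub_eq_zero.2 ?_
          ext t
          change T ^ 2 • IccExtend _ β (T * t) = S (curveOfAcceleration E _ t)
          rw [curveOfAcceleration_apply]
          dsimp only
          rw [curvePrimitive₂_rescale T β t.2, curvePrimitive_rescale T β t.2, ← smul_add, hom]
          rw [IccExtend_of_mem _ _ (hmem t t.2)]
          have := congrArg (fun k : C(K, E) ↦ k ⟨T * t, hmem t t.2⟩) e2
          rw [this]
          change _ • S (curveOfAcceleration E _ _) = _
          rw [curveOfAcceleration_apply]
          dsimp only
          rw [smul_smul, mul_comm T]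
        have h2 : Φ.symm (ι (q, T • v)) = (q, T • v, curveRescale T β) := by
          rw [← hGin, ← hΦ]; exact Φ.left_inv hin
        exact congrArg (fun z : X ↦ z.2.2) h2
      dsimp only
      rw [h1, curveOfAcceleration_apply]
      dsimp only
      rw [curvePrimitive₂_rescale T β one.2]
      simp [one]
    · simp [curvePrimitive₂_zero_right]
    · simp [curvePrimitive_zero_right]
    · intro t
      have := ((hasDerivAt_id t).smul_const v).const_add q |>.fun_add (hasDerivAt_curvePrimitive₂ β t)
      simpa using this
    · intro t ht
      have := (hasDerivAt_curvePrimitive β t).const_add v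
      convert this using 1
      have ht' : t ∈ K := ⟨ht.1.le, ht.2.le⟩
      rw [IccExtend_of_mem _ _ ht']
      exact (congrArg (fun k : C(K, E) ↦ k ⟨t, ht'⟩) e2).symm

end LocalExponential

/-! ### Whitehead's theorem in a vector space. -/

section LocalConvexity

universe u
variable {E : Type u} [NormedAddCommGroup E] [NormedSpace ℝ E]

/-- A curve whose acceleration is small compared with its squared velocity stays in every ball
that contains its end points. -/
theorem norm_lt_of_convex_curve {F : Type*} [NormedAddCommGroup F] [InnerProductSpace ℝ F]
    {c c' a : ℝ → F} {ρ : ℝ} (hc : ∀ t, HasDerivAt c (c' t) t)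
    (hc' : ∀ t ∈ Ioo (0 : ℝ) 1, HasDerivAt c' (a t) t)
    (ha : ∀ t ∈ Ioo (0 : ℝ) 1, ‖c t‖ * ‖a t‖ ≤ ‖c' t‖ ^ 2)
    (h0 : ‖c 0‖ < ρ) (h1 : ‖c 1‖ < ρ) {t : ℝ} (ht : t ∈ Icc (0 : ℝ) 1) : ‖c t‖ < ρ := by
  -- `φ'' = 2 (⟪c, a⟫ + ‖c'‖²)` is nonnegative by Cauchy-Schwarz and `ha`, so `φ` is convex and
  -- bounded by its values at the end points.
  let φ : ℝ → ℝ := fun t ↦ inner ℝ (c t) (c t)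
  have hφ : ∀ t, HasDerivAt φ (2 * inner ℝ (c t) (c' t)) t := fun t ↦ by
    have := (hc t).inner ℝ (hc t)
    rwa [real_inner_comm (c t) (c' t), ← two_mul] at this
  have hφ' : deriv φ = fun t ↦ 2 * inner ℝ (c t) (c' t) := funext fun t ↦ (hφ t).deriv
  have hφ2 : ∀ t ∈ Ioo (0 : ℝ) 1,
      HasDerivAt (deriv φ) (2 * (inner ℝ (c t) (a t) + inner ℝ (c' t) (c' t))) t := fun t ht ↦ by
    rw [hφ']
    exact ((hc t).inner ℝ (hc' t ht)).const_mul 2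
  have hconv : ConvexOn ℝ (Icc 0 1) φ := by
    refine convexOn_of_deriv2_nonneg (convex_Icc 0 1)
      (fun t _ ↦ (hφ t).continuousAt.continuousWithinAt)
      (fun t _ ↦ (hφ t).differentiableAt.differentiableWithinAt) ?_ ?_
    · rw [interior_Icc]
      exact fun t ht ↦ (hφ2 t ht).differentiableAt.differentiableWithinAt
    · rw [interior_Icc]
      intro t ht
      rw [show deriv^[2] φ t = deriv (deriv φ) t from rfl, (hφ2 t ht).deriv,
        real_inner_self_eq_norm_sq]
      have := abs_le.1 (abs_real_inner_le_norm (c t) (a t))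
      linarith [this.1, ha t ht]
  have hle := hconv.le_on_segment (x := 0) (y := 1) (z := t) (by simp) (by simp)
    (by rwa [segment_eq_Icc zero_le_one])
  simp only [φ, real_inner_self_eq_norm_sq] at hle
  have hρ : 0 < ρ := (norm_nonneg _).trans_lt h0
  refine lt_of_pow_lt_pow_left₀ 2 hρ.le (hle.trans_lt (max_lt ?_ ?_)) <;> gcongr

/-- Each given curve solves the equation only on `(-1, 1)`, so the equation at `t` is read off from
the curve of `T • v` with `T` slightly larger than `|t|`. Homogeneity of `S` absorbs the factor
`T⁻²`. -/
theorem hasDerivAt_radial {S : E × E → E}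
    (hom : ∀ (t : ℝ) (y v : E), S (y, t • v) = t ^ 2 • S (y, v)) {r : ℝ} {e : E → E}
    (h : ∀ v ∈ Metric.ball (0 : E) r, ∃ c c' : ℝ → E,
      (∀ t ∈ Icc (-1 : ℝ) 1, e (t • v) = c t) ∧ (∀ t, HasDerivAt c (c' t) t) ∧
        ∀ t ∈ Ioo (-1 : ℝ) 1, HasDerivAt c' (S (c t, c' t)) t)
    {v : E} {t : ℝ} (ht : t • v ∈ Metric.ball (0 : E) r) :
    deriv (deriv fun s : ℝ ↦ e (s • v)) t = S (e (t • v), deriv (fun s : ℝ ↦ e (s • v)) t) := by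
  obtain ⟨T, hT0, htT, hTv⟩ : ∃ T : ℝ, 0 < T ∧ |t| < T ∧ T • v ∈ Metric.ball (0 : E) r := by
    rw [mem_ball_zero_iff, norm_smul, Real.norm_eq_abs] at ht
    have hcont : Filter.Tendsto (fun T : ℝ ↦ T * ‖v‖) (𝓝[>] |t|) (𝓝 (|t| * ‖v‖)) :=
      ((continuous_id.mul continuous_const).tendsto' _ _ rfl).mono_left nhdsWithin_le_nhds
    obtain ⟨T, hT, hT'⟩ := ((hcont.eventually (gt_mem_nhds ht)).and self_mem_nhdsWithin).exists
    have hT0 : 0 < T := (abs_nonneg t).trans_lt hT'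
    refine ⟨T, hT0, hT', ?_⟩
    rwa [mem_ball_zero_iff, norm_smul, Real.norm_of_nonneg hT0.le]
  obtain ⟨c, c', hec, hc, hc'⟩ := h _ hTv
  have hmem : ∀ s : ℝ, |s| < T → T⁻¹ * s ∈ Ioo (-1 : ℝ) 1 := fun s hs ↦ by
    refine abs_lt.1 ?_
    rw [abs_mul, abs_of_pos (inv_pos.2 hT0), inv_mul_lt_iff₀ hT0]
    linarith
  have hopen : IsOpen {s : ℝ | |s| < T} := isOpen_lt continuous_abs continuous_const
  have heq : ∀ s : ℝ, |s| < T → e (s • v) = c (T⁻¹ * s) := fun s hs ↦ by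
    rw [← hec _ (Ioo_subset_Icc_self (hmem s hs)), smul_smul]
    congr 2
    field_simp
  have hd : ∀ s : ℝ, |s| < T → HasDerivAt (fun s : ℝ ↦ e (s • v)) (T⁻¹ • c' (T⁻¹ * s)) s := by
    intro s hs
    have h1 : HasDerivAt (fun s ↦ c (T⁻¹ * s)) (T⁻¹ • c' (T⁻¹ * s)) s := by
      have := (hc (T⁻¹ * s)).scomp s ((hasDerivAt_id s).const_mul T⁻¹)
      simpa using! this
    refine h1.congr_of_eventuallyEq ?_
    filter_upwards [hopen.mem_nhds hs] with x hx using heq x hx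
  have hd2 : HasDerivAt (deriv fun s : ℝ ↦ e (s • v))
      (T⁻¹ • T⁻¹ • S (c (T⁻¹ * t), c' (T⁻¹ * t))) t := by
    have h1 : HasDerivAt (fun s ↦ T⁻¹ • c' (T⁻¹ * s))
        (T⁻¹ • T⁻¹ • S (c (T⁻¹ * t), c' (T⁻¹ * t))) t := by
      have := ((hc' (T⁻¹ * t) (hmem t htT)).scomp t ((hasDerivAt_id t).const_mul T⁻¹)).const_smul T⁻¹
      simpa using! this
    refine h1.congr_of_eventuallyEq ?_
    filter_upwards [hopen.mem_nhds htT] with x hx using (hd x hx).deriv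
  rw [hd2.deriv, (hd t htT).deriv, heq t htT, hom, pow_two, smul_smul]

theorem hasFDerivAt_id_of_radial {e : E → E} (he : DifferentiableAt ℝ e 0) {r : ℝ} (hr : 0 < r)
    (h : ∀ v ∈ Metric.ball (0 : E) r, HasDerivAt (fun t : ℝ ↦ e (t • v)) v 0) :
    HasFDerivAt e (ContinuousLinearMap.id ℝ E) 0 := by
  have key : ∀ v ∈ Metric.ball (0 : E) r, fderiv ℝ e 0 v = v := fun v hv ↦ by
    have h1 : HasDerivAt (fun t : ℝ ↦ t • v) v 0 := by
      simpa using (hasDerivAt_id (0 : ℝ)).smul_const v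
    have h2 : HasFDerivAt e (fderiv ℝ e 0) ((0 : ℝ) • v) := by
      rw [zero_smul]; exact he.hasFDerivAt
    exact (h2.comp_hasDerivAt 0 h1).unique (h v hv)
  refine he.hasFDerivAt.congr_fderiv ?_
  ext v
  obtain ⟨k, hk, hkv⟩ : ∃ k : ℝ, k ≠ 0 ∧ k • v ∈ Metric.ball (0 : E) r := by
    refine ⟨r / (2 * (‖v‖ + 1)), by positivity, ?_⟩
    rw [mem_ball_zero_iff, norm_smul, Real.norm_of_nonneg (by positivity), div_mul_eq_mul_div,
      div_lt_iff₀ (by positivity)]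
    nlinarith [norm_nonneg v]
  have := key _ hkv
  rw [map_smul] at this
  exact smul_right_injective E hk this

variable [FiniteDimensional ℝ E]

/-- Whitehead's theorem on convex neighbourhoods, for a second order equation `c'' = S(c, c')` on a
vector space with `S` smooth and quadratic in the velocity. -/
theorem exists_local_convex {S : E × E → E} (hS : ContDiff ℝ ∞ S)
    (hom : ∀ (t : ℝ) (y v : E), S (y, t • v) = t ^ 2 • S (y, v)) (x₀ : E) {W : Set E}
    (hW : W ∈ 𝓝 x₀) :
    ∃ U ⊆ W, IsOpen U ∧ x₀ ∈ U ∧ ∀ q ∈ U, ∃ e : OpenPartialHomeomorph E E,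
      e.target = U ∧ (0 : E) ∈ e.source ∧ StarConvex ℝ 0 e.source ∧
      ContDiffOn ℝ ∞ e e.source ∧ ContDiffOn ℝ ∞ e.symm e.target ∧ e 0 = q ∧
      HasFDerivAt e (ContinuousLinearMap.id ℝ E) 0 ∧
      ∀ (v : E) (t : ℝ), t • v ∈ e.source →
        deriv (deriv fun s : ℝ ↦ e (s • v)) t
          = S (e (t • v), deriv (fun s : ℝ ↦ e (s • v)) t) := by
  obtain ⟨r, hr, Exp, hExp, hcurve⟩ := exists_local_exponential hS hom x₀
  obtain ⟨δ, hδ, C, hC, hquad⟩ := exists_quadratic_bound hS.continuous hom x₀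
  set D := Metric.ball x₀ r ×ˢ Metric.ball (0 : E) r with hD
  have hDopen : IsOpen D := Metric.isOpen_ball.prod Metric.isOpen_ball
  have hExp0 : ∀ q ∈ Metric.ball x₀ r, Exp (q, 0) = q := fun q hq ↦ by
    obtain ⟨c, c', h1, h2, -⟩ := hcurve q hq 0 (Metric.mem_ball_self hr)
    simpa [h2] using h1 0 (by norm_num)
  have hdq : ∀ q ∈ Metric.ball x₀ r,
      HasFDerivAt (fun v ↦ Exp (q, v)) (ContinuousLinearMap.id ℝ E) 0 := fun q hq ↦ by
    have h1 : DifferentiableAt ℝ Exp (q, 0) :=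
      (hExp.contDiffAt (hDopen.mem_nhds ⟨hq, Metric.mem_ball_self hr⟩)).differentiableAt (by simp)
    refine hasFDerivAt_id_of_radial (h1.comp (0 : E)
      ((differentiableAt_const q).prodMk differentiableAt_id)) hr fun v hv ↦ ?_
    obtain ⟨c, c', h1, h2, h3, h4, -⟩ := hcurve q hq v hv
    have := h4 0
    rw [h3] at this
    refine this.congr_of_eventuallyEq ?_
    filter_upwards [Icc_mem_nhds (by norm_num : (-1 : ℝ) < 0) one_pos] with t ht using h1 t ht
  have hx₀r : (x₀, (0 : E)) ∈ D := ⟨Metric.mem_ball_self hr, Metric.mem_ball_self hr⟩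
  have hExpx₀ : ContDiffAt ℝ ∞ Exp (x₀, 0) := hExp.contDiffAt (hDopen.mem_nhds hx₀r)
  have hdExp : HasFDerivAt Exp
      (ContinuousLinearMap.fst ℝ E E + ContinuousLinearMap.snd ℝ E E) (x₀, 0) := by
    have h1 := (hExpx₀.differentiableAt (by simp)).hasFDerivAt
    refine h1.congr_fderiv ?_
    have h2 : (fderiv ℝ Exp (x₀, 0)).comp (ContinuousLinearMap.inr ℝ E E)
        = ContinuousLinearMap.id ℝ E :=
      (h1.comp (0 : E) (hasFDerivAt_prodMk_right x₀ 0)).unique (hdq x₀ hx₀r.1)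
    have h3 : (fderiv ℝ Exp (x₀, 0)).comp (ContinuousLinearMap.inl ℝ E E)
        = ContinuousLinearMap.id ℝ E := by
      refine (h1.comp x₀ (hasFDerivAt_prodMk_left x₀ 0)).unique ((hasFDerivAt_id x₀).congr_of_eventuallyEq ?_)
      filter_upwards [Metric.ball_mem_nhds x₀ hr] with q hq using hExp0 q hq
    ext a
    · simpa using congrArg (fun f ↦ f a) h3
    · simpa using congrArg (fun f ↦ f a) h2
  -- The convexity argument needs an inner product norm, so balls are taken in Euclidean
  -- coordinates. The constant `κ` then satisfies `‖L (S (y, v))‖ ≤ κ ‖L v‖²` near `x₀`.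
  let L : E ≃L[ℝ] EuclideanSpace ℝ (Fin (Module.finrank ℝ E)) := toEuclidean
  let κ := ‖(L : E →L[ℝ] EuclideanSpace ℝ (Fin (Module.finrank ℝ E)))‖ * C *
    ‖(L.symm : EuclideanSpace ℝ (Fin (Module.finrank ℝ E)) →L[ℝ] E)‖ ^ 2
  have hκ : 0 ≤ κ := by positivity
  -- The second condition is what makes the squared distance to `x₀` convex along the geodesics.
  obtain ⟨r₁, hr₁, hr₁r, hr₁Exp⟩ : ∃ r₁ > 0, r₁ ≤ r ∧
      ∀ p ∈ Metric.ball x₀ r₁ ×ˢ Metric.ball (0 : E) r₁,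
        Exp p ∈ Metric.ball x₀ δ ∧ ‖L (Exp p - x₀)‖ * κ ≤ 1 := by
    have h1 : ∀ᶠ p in 𝓝 (x₀, (0 : E)), Exp p ∈ Metric.ball x₀ δ ∧ ‖L (Exp p - x₀)‖ * κ < 1 := by
      have hc := hExpx₀.continuousAt
      refine Filter.Eventually.and (hc.eventually ?_) ?_
      · rw [hExp0 x₀ hx₀r.1]; exact Metric.ball_mem_nhds _ hδ
      · have : ContinuousAt (fun p ↦ ‖L (Exp p - x₀)‖ * κ) (x₀, 0) :=
          ((L.continuous.continuousAt.comp (hc.sub continuousAt_const)).norm.mul continuousAt_const)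
        refine this.eventually (gt_mem_nhds ?_)
        dsimp only
        rw [hExp0 x₀ hx₀r.1]; simp
    obtain ⟨ε, hε, h2⟩ := Metric.eventually_nhds_iff.1 h1
    refine ⟨min ε r, lt_min hε hr, min_le_right _ _, fun p hp ↦ ?_⟩
    have := h2 (y := p) (by
      rw [Prod.dist_eq]
      exact max_lt (lt_of_lt_of_le hp.1 (min_le_left _ _)) (lt_of_lt_of_le hp.2 (min_le_left _ _)))
    exact ⟨this.1, this.2.le⟩
  -- Inverting `(q, v) ↦ (q, Exp (q, v))` treats all base points at once, so that one set `U` can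
  -- serve for every `q`.
  let Θ : E × E → E × E := fun p ↦ (p.1, Exp p)
  have hball_sub : Metric.ball x₀ r₁ ×ˢ Metric.ball (0 : E) r₁ ⊆ D :=
    prod_mono (Metric.ball_subset_ball hr₁r) (Metric.ball_subset_ball hr₁r)
  have hΘ : ContDiffOn ℝ ∞ Θ D := contDiffOn_fst.prodMk hExp
  let f' : (E × E) ≃L[ℝ] E × E := ContinuousLinearEquiv.equivOfInverse
    ((ContinuousLinearMap.fst ℝ E E).prod
      (ContinuousLinearMap.fst ℝ E E + ContinuousLinearMap.snd ℝ E E))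
    ((ContinuousLinearMap.fst ℝ E E).prod
      (ContinuousLinearMap.snd ℝ E E - ContinuousLinearMap.fst ℝ E E))
    (fun p ↦ by ext <;> simp) (fun p ↦ by ext <;> simp)
  have hdΘ : HasFDerivAt Θ (f' : E × E →L[ℝ] E × E) (x₀, 0) := hasFDerivAt_fst.prodMk hdExp
  obtain ⟨Φ, hΦ, hx₀Φ, hΦs, hΦsymm⟩ := (hΘ.mono hball_sub).exists_openPartialHomeomorph
    (Metric.isOpen_ball.prod Metric.isOpen_ball)
    (show (x₀, (0 : E)) ∈ _ from ⟨Metric.mem_ball_self hr₁, Metric.mem_ball_self hr₁⟩) f' hdΘ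
  obtain ⟨r₂, hr₂, hr₂Φ⟩ := Metric.isOpen_iff.1 Φ.open_source _ hx₀Φ
  rw [← ball_prod_same] at hr₂Φ
  set D₂ := Metric.ball x₀ r₂ ×ˢ Metric.ball (0 : E) r₂ with hD₂
  have hD₂open : IsOpen D₂ := Metric.isOpen_ball.prod Metric.isOpen_ball
  -- On a product domain, the vectors admissible at a fixed `q` form a ball.
  let Ψ := Φ.restrOpen D₂ hD₂open
  have hΨ : (Ψ : E × E → E × E) = Θ := hΦ
  have hΨs : Ψ.source = D₂ := inter_eq_right.2 hr₂Φ
  have hΨt : Ψ.target ⊆ Φ.target := fun y hy ↦ by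
    have h1 := Φ.map_source (hr₂Φ (hΨs ▸ Ψ.map_target hy))
    rw [hΦ, ← hΨ, Ψ.right_inv hy] at h1
    exact h1
  have hD₂D : D₂ ⊆ D := (hr₂Φ.trans hΦs).trans hball_sub
  have hx₀D₂ : (x₀, (0 : E)) ∈ D₂ := ⟨Metric.mem_ball_self hr₂, Metric.mem_ball_self hr₂⟩
  have htarget : (x₀, x₀) ∈ Ψ.target := by
    have := Ψ.map_source (hΨs ▸ hx₀D₂)
    rw [hΨ] at this
    simpa [Θ, hExp0 x₀ hx₀r.1] using this
  obtain ⟨ρ, hρ, hρsub⟩ : ∃ ρ > 0, ∀ y, ‖L (y - x₀)‖ < ρ →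
      y ∈ W ∩ Metric.ball x₀ r₂ ∧ ∀ z, ‖L (z - x₀)‖ < ρ → (y, z) ∈ Ψ.target := by
    have h1 : Ψ.target ∩ (W ∩ Metric.ball x₀ r₂) ×ˢ univ ∈ 𝓝 (x₀, x₀) :=
      Filter.inter_mem (Ψ.open_target.mem_nhds htarget) (prod_mem_nhds
        (Filter.inter_mem hW (Metric.ball_mem_nhds _ hr₂)) Filter.univ_mem)
    obtain ⟨ε, hε, h2⟩ := Metric.mem_nhds_iff.1 h1
    have hsymm := (L.symm : EuclideanSpace ℝ (Fin (Module.finrank ℝ E)) →L[ℝ] E).le_opNorm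
    set m := ‖(L.symm : EuclideanSpace ℝ (Fin (Module.finrank ℝ E)) →L[ℝ] E)‖ with hm
    have h3 : ∀ y, ‖L (y - x₀)‖ < ε / (m + 1) → dist y x₀ < ε := fun y hy ↦ by
      rw [lt_div_iff₀ (by positivity)] at hy
      have := hsymm (L (y - x₀))
      simp only [ContinuousLinearEquiv.coe_coe, ContinuousLinearEquiv.symm_apply_apply] at this
      rw [dist_eq_norm]
      nlinarith [norm_nonneg (L (y - x₀))]
    refine ⟨ε / (m + 1), by positivity, fun y hy ↦ ⟨?_, fun z hz ↦ ?_⟩⟩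
    · have := @h2 (y, x₀) (by
        rw [Metric.mem_ball, Prod.dist_eq]; exact max_lt (h3 y hy) (by simpa using hε))
      exact this.2.1
    · exact (@h2 (y, z) (by
        rw [Metric.mem_ball, Prod.dist_eq]; exact max_lt (h3 y hy) (h3 z hz))).1
  let U : Set E := {y | ‖L (y - x₀)‖ < ρ}
  have hUopen : IsOpen U :=
    isOpen_lt (L.continuous.comp (continuous_id.sub continuous_const)).norm continuous_const
  have hx₀U : x₀ ∈ U := by simpa [U] using hρ
  refine ⟨U, fun y hy ↦ (hρsub y hy).1.1, hUopen, hx₀U, fun q hq ↦ ?_⟩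
  have hqr₂ : q ∈ Metric.ball x₀ r₂ := (hρsub q hq).1.2
  have hinvq : ∀ y ∈ U, Ψ.symm (q, y) = (q, (Ψ.symm (q, y)).2) ∧
      (Ψ.symm (q, y)).2 ∈ Metric.ball (0 : E) r₂ ∧ Exp (q, (Ψ.symm (q, y)).2) = y := fun y hy ↦ by
    have h1 := Ψ.right_inv ((hρsub q hq).2 y hy)
    have h2 := Ψ.map_target ((hρsub q hq).2 y hy)
    rw [hΨ] at h1
    rw [hΨs] at h2
    have h3 : (Ψ.symm (q, y)).1 = q := congrArg Prod.fst h1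
    have h4 : Ψ.symm (q, y) = (q, (Ψ.symm (q, y)).2) := Prod.ext h3 rfl
    refine ⟨h4, h2.2, ?_⟩
    rw [← h4]
    exact congrArg Prod.snd h1
  have hι : ContDiff ℝ ∞ (fun v : E ↦ (q, v)) := contDiff_const.prodMk contDiff_id
  have hsmooth : ContDiffOn ℝ ∞ (fun v ↦ Exp (q, v)) (Metric.ball 0 r₂) :=
    hExp.comp hι.contDiffOn fun v hv ↦ hD₂D ⟨hqr₂, hv⟩
  have hsmooth' : ContDiffOn ℝ ∞ (fun y ↦ (Ψ.symm (q, y)).2) U :=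
    contDiff_snd.comp_contDiffOn ((hΦsymm.mono hΨt).comp hι.contDiffOn fun y hy ↦
      (hρsub q hq).2 y hy)
  have hqr : q ∈ Metric.ball x₀ r :=
    (hD₂D (show (q, (0 : E)) ∈ D₂ from ⟨hqr₂, Metric.mem_ball_self hr₂⟩)).1
  let e : OpenPartialHomeomorph E E :=
    { toFun := fun v ↦ Exp (q, v)
      invFun := fun y ↦ (Ψ.symm (q, y)).2
      source := Metric.ball 0 r₂ ∩ (fun v ↦ Exp (q, v)) ⁻¹' U
      target := U
      map_source' := fun v hv ↦ hv.2
      map_target' := fun y hy ↦ ⟨(hinvq y hy).2.1, by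
        rw [mem_preimage, (hinvq y hy).2.2]; exact hy⟩
      left_inv' := fun v hv ↦ by
        have h1 := Ψ.left_inv (x := (q, v)) (hΨs ▸ ⟨hqr₂, hv.1⟩)
        rw [hΨ] at h1
        exact congrArg Prod.snd h1
      right_inv' := fun y hy ↦ (hinvq y hy).2.2
      open_source := hsmooth.continuousOn.isOpen_inter_preimage Metric.isOpen_ball hUopen
      open_target := hUopen
      continuousOn_toFun := hsmooth.continuousOn.mono inter_subset_left
      continuousOn_invFun := hsmooth'.continuousOn }
  have hr₂r : Metric.ball (0 : E) r₂ ⊆ Metric.ball 0 r := fun v hv ↦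
    (hD₂D (show (q, v) ∈ D₂ from ⟨hqr₂, hv⟩)).2
  refine ⟨e, rfl, ⟨Metric.mem_ball_self hr₂, ?_⟩, ?_, hsmooth.mono inter_subset_left, hsmooth',
    hExp0 q hqr, hdq q hqr, fun v t ht ↦ ?_⟩
  · rw [mem_preimage, hExp0 q hqr]; exact hq
  · refine starConvex_zero_iff.2 fun v hv t ht0 ht1 ↦ ⟨?_, ?_⟩
    · have := hv.1
      rw [mem_ball_zero_iff] at this ⊢
      rw [norm_smul, Real.norm_of_nonneg ht0]
      exact (mul_le_of_le_one_left (norm_nonneg _) ht1).trans_lt this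
    -- The geodesic from `q` to `Exp (q, v)` has both ends in the Euclidean ball `U`; by convexity
    -- of the squared distance it stays in `U`, so the source is star-shaped.
    · obtain ⟨c, c', h1, h2, h3, h4, h5⟩ := hcurve q hqr v (hr₂r hv.1)
      have hcd : ∀ t, HasDerivAt (fun t ↦ L (c t - x₀)) (L (c' t)) t := fun t ↦
        (L : E →L[ℝ] EuclideanSpace ℝ (Fin (Module.finrank ℝ E))).hasFDerivAt.comp_hasDerivAt t
          ((h4 t).sub_const x₀)
      have hcd' : ∀ t ∈ Ioo (0 : ℝ) 1, HasDerivAt (fun t ↦ L (c' t)) (L (S (c t, c' t))) t :=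
        fun t ht ↦
          (L : E →L[ℝ] EuclideanSpace ℝ (Fin (Module.finrank ℝ E))).hasFDerivAt.comp_hasDerivAt t
          (h5 t ⟨by linarith [ht.1], ht.2⟩)
      have hmem : ∀ s : ℝ, s ∈ Icc (-1 : ℝ) 1 → s • v ∈ Metric.ball (0 : E) r₂ := fun s hs ↦ by
        have := hv.1
        rw [mem_ball_zero_iff] at this ⊢
        rw [norm_smul]
        exact (mul_le_of_le_one_left (norm_nonneg _) (abs_le.2 hs)).trans_lt this
      have key := norm_lt_of_convex_curve (ρ := ρ) hcd hcd' (fun s hs ↦ ?_) ?_ ?_ ⟨ht0, ht1⟩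
      · change ‖L (Exp (q, t • v) - x₀)‖ < ρ
        rw [h1 t ⟨by linarith, ht1⟩]
        exact key
      · have hs' : s ∈ Icc (-1 : ℝ) 1 := ⟨by linarith [hs.1], hs.2.le⟩
        have h6 := hr₁Exp (q, s • v) (hΦs (hr₂Φ ⟨hqr₂, hmem s hs'⟩))
        rw [h1 s hs'] at h6
        have h7 := hquad (c s) h6.1 (c' s)
        have h8 := (L : E →L[ℝ] EuclideanSpace ℝ (Fin (Module.finrank ℝ E))).le_opNorm
          (S (c s, c' s))
        have h9 := (L.symm : EuclideanSpace ℝ (Fin (Module.finrank ℝ E)) →L[ℝ] E).le_opNorm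
          (L (c' s))
        simp only [ContinuousLinearEquiv.coe_coe, ContinuousLinearEquiv.symm_apply_apply] at h8 h9
        calc ‖L (c s - x₀)‖ * ‖L (S (c s, c' s))‖
            ≤ ‖L (c s - x₀)‖ * (‖(L : E →L[ℝ] EuclideanSpace ℝ (Fin (Module.finrank ℝ E)))‖ *
              (C * (‖(L.symm : EuclideanSpace ℝ (Fin (Module.finrank ℝ E)) →L[ℝ] E)‖ *
                ‖L (c' s)‖) ^ 2)) := by
              gcongr
              refine h8.trans ?_
              gcongr
              refine h7.trans ?_
              gcongr
          _ = (‖L (c s - x₀)‖ * κ) * ‖L (c' s)‖ ^ 2 := by simp only [κ]; ring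
          _ ≤ 1 * ‖L (c' s)‖ ^ 2 := by gcongr; exact h6.2
          _ = ‖L (c' s)‖ ^ 2 := one_mul _
      · simp only [h2]; exact hq
      · have := h1 1 (by norm_num)
        rw [one_smul] at this
        rw [← this]
        exact hv.2
  · refine hasDerivAt_radial (e := e) (r := r₂) hom (fun w hw ↦ ?_) ht.1
    obtain ⟨c, c', h1, h2, h3, h4, h5⟩ := hcurve q hqr w (hr₂r hw)
    exact ⟨c, c', h1, h4, h5⟩

end LocalConvexity

/-! ### The geodesic equation in coordinates and the Gauss lemma. -/

section EulerLagrange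

universe u
variable {E : Type u} [NormedAddCommGroup E] [NormedSpace ℝ E]

/-- The Euler-Lagrange expression of the energy of a field `A` of bilinear forms along a curve. -/
noncomputable def eulerLagrange (A : E → E →L[ℝ] E →L[ℝ] ℝ) (ξ : ℝ → E) (t : ℝ) (w : E) : ℝ :=
  A (ξ t) (deriv (deriv ξ) t) w + fderiv ℝ (fun y ↦ A y (deriv ξ t) w) (ξ t) (deriv ξ t)
    - (1 / 2) * fderiv ℝ (fun y ↦ A y (deriv ξ t) (deriv ξ t)) (ξ t) w

theorem fderiv_form_apply {A : E → E →L[ℝ] E →L[ℝ] ℝ} {y : E} (hA : DifferentiableAt ℝ A y)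
    (u w z : E) : fderiv ℝ (fun y ↦ A y u w) y z = fderiv ℝ A y z u w := by
  have h1 : HasFDerivAt (fun y ↦ A y u w) _ y :=
    (hA.hasFDerivAt.clm_apply (hasFDerivAt_const u y)).clm_apply (hasFDerivAt_const w y)
  rw [h1.fderiv]
  simp

theorem eulerLagrange_eq {A : E → E →L[ℝ] E →L[ℝ] ℝ} {ξ : ℝ → E} {t : ℝ}
    (hA : DifferentiableAt ℝ A (ξ t)) (w : E) :
    eulerLagrange A ξ t w = A (ξ t) (deriv (deriv ξ) t) w
      + fderiv ℝ A (ξ t) (deriv ξ t) (deriv ξ t) w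
      - (1 / 2) * fderiv ℝ A (ξ t) w (deriv ξ t) (deriv ξ t) := by
  rw [eulerLagrange, fderiv_form_apply hA, fderiv_form_apply hA]

theorem fderiv_pullback_form {A₁ A₂ : E → E →L[ℝ] E →L[ℝ] ℝ} {φ : E → E} {y : E}
    (hφ : ContDiffAt ℝ ∞ φ y) (hA : DifferentiableAt ℝ A₂ (φ y))
    (h : ∀ᶠ x in 𝓝 y, ∀ u w, A₁ x u w = A₂ (φ x) (fderiv ℝ φ x u) (fderiv ℝ φ x w)) (u w z : E) :
    fderiv ℝ (fun x ↦ A₁ x u w) y z =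
      fderiv ℝ A₂ (φ y) (fderiv ℝ φ y z) (fderiv ℝ φ y u) (fderiv ℝ φ y w)
      + A₂ (φ y) (fderiv ℝ (fderiv ℝ φ) y z u) (fderiv ℝ φ y w)
      + A₂ (φ y) (fderiv ℝ φ y u) (fderiv ℝ (fderiv ℝ φ) y z w) := by
  have hd : HasFDerivAt φ (fderiv ℝ φ y) y := (hφ.differentiableAt (by simp)).hasFDerivAt
  have hdd : HasFDerivAt (fderiv ℝ φ) (fderiv ℝ (fderiv ℝ φ) y) y :=
    ((hφ.fderiv_right (m := 1) (by rw [one_add_one_eq_two]; exact ENat.LEInfty.out)).differentiableAt (by simp)).hasFDerivAt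
  have h1 : HasFDerivAt (fun x ↦ A₂ (φ x) (fderiv ℝ φ x u) (fderiv ℝ φ x w)) _ y :=
    ((hA.hasFDerivAt.comp y hd).clm_apply (hdd.clm_apply (hasFDerivAt_const u y))).clm_apply
      (hdd.clm_apply (hasFDerivAt_const w y))
  have h2 : (fun x ↦ A₁ x u w) =ᶠ[𝓝 y] fun x ↦ A₂ (φ x) (fderiv ℝ φ x u) (fderiv ℝ φ x w) :=
    h.mono fun x hx ↦ hx u w
  rw [h2.fderiv_eq, h1.fderiv]
  simp
  ring

/-- The Euler-Lagrange expression is invariant under changes of coordinates. -/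
theorem eulerLagrange_comp {A₁ A₂ : E → E →L[ℝ] E →L[ℝ] ℝ} {φ : E → E} {ξ : ℝ → E} {t : ℝ}
    (hξ : ContDiffAt ℝ ∞ ξ t) (hφ : ContDiffAt ℝ ∞ φ (ξ t)) (hA : DifferentiableAt ℝ A₂ (φ (ξ t)))
    (hsymm : ∀ u w, A₂ (φ (ξ t)) u w = A₂ (φ (ξ t)) w u)
    (h : ∀ᶠ x in 𝓝 (ξ t), ∀ u w, A₁ x u w = A₂ (φ x) (fderiv ℝ φ x u) (fderiv ℝ φ x w)) (w : E) :
    eulerLagrange A₂ (fun s ↦ φ (ξ s)) t (fderiv ℝ φ (ξ t) w) = eulerLagrange A₁ ξ t w := by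
  have hev : ∀ᶠ s in 𝓝 t, DifferentiableAt ℝ φ (ξ s) ∧ DifferentiableAt ℝ ξ s := by
    have h1 : ∀ᶠ x in 𝓝 (ξ t), ContDiffAt ℝ 1 φ x :=
      (hφ.of_le (by simp)).eventually (by simp)
    have h2 : ∀ᶠ s in 𝓝 t, ContDiffAt ℝ 1 ξ s := (hξ.of_le (by simp)).eventually (by simp)
    filter_upwards [hξ.continuousAt.eventually h1, h2] with s hs hs'
    exact ⟨hs.differentiableAt (by simp), hs'.differentiableAt (by simp)⟩
  have hd1 : deriv (fun s ↦ φ (ξ s)) =ᶠ[𝓝 t] fun s ↦ fderiv ℝ φ (ξ s) (deriv ξ s) := by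
    filter_upwards [hev] with s hs
    exact (hs.1.hasFDerivAt.comp_hasDerivAt s hs.2.hasDerivAt).deriv
  have hdd : HasFDerivAt (fderiv ℝ φ) (fderiv ℝ (fderiv ℝ φ) (ξ t)) (ξ t) :=
    ((hφ.fderiv_right (m := 1) (by rw [one_add_one_eq_two]; exact ENat.LEInfty.out)).differentiableAt (by simp)).hasFDerivAt
  have hξd : HasDerivAt ξ (deriv ξ t) t := (hξ.differentiableAt (by simp)).hasDerivAt
  have hξdd : HasDerivAt (deriv ξ) (deriv (deriv ξ) t) t :=
    by
    have h1 : ContDiffAt ℝ 1 (fun s ↦ fderiv ℝ ξ s 1) t :=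
      (hξ.fderiv_right (m := 1) (by rw [one_add_one_eq_two]; exact ENat.LEInfty.out)).clm_apply contDiffAt_const
    exact (h1.differentiableAt (by simp)).hasDerivAt
  have hd2 : deriv (deriv fun s ↦ φ (ξ s)) t
      = fderiv ℝ (fderiv ℝ φ) (ξ t) (deriv ξ t) (deriv ξ t)
        + fderiv ℝ φ (ξ t) (deriv (deriv ξ) t) := by
    rw [hd1.deriv_eq]
    exact ((hdd.comp_hasDerivAt t hξd).clm_apply hξdd).deriv
  -- Second derivatives of `φ` come from the acceleration and from both derivatives of the metric;
  -- they cancel by symmetry of `D²φ` and of `A₂`.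
  have hsnd : ∀ u v, fderiv ℝ (fderiv ℝ φ) (ξ t) u v = fderiv ℝ (fderiv ℝ φ) (ξ t) v u :=
    fun u v ↦ (hφ.isSymmSndFDerivAt (by simpa using ENat.LEInfty.out)).eq u v
  rw [eulerLagrange_eq hA, eulerLagrange, fderiv_pullback_form hφ hA h,
    fderiv_pullback_form hφ hA h, hd2, hd1.eq_of_nhds, h.self_of_nhds, hsnd w (deriv ξ t),
    hsymm (fderiv ℝ (fderiv ℝ φ) (ξ t) (deriv ξ t) w) (fderiv ℝ φ (ξ t) (deriv ξ t))]
  simp only [map_add, add_apply]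
  ring

/-- Nondegeneracy allows the index to be raised: `S` is the inverse of `A y` applied to the covector
of first-derivative terms. A bump function in the position variable makes `S` global; it preserves
homogeneity in `v` and changes nothing near `x₀`. -/
theorem exists_spray [FiniteDimensional ℝ E] {A : E → E →L[ℝ] E →L[ℝ] ℝ} {Ω : Set E}
    (hΩ : IsOpen Ω) (hA : ContDiffOn ℝ ∞ A Ω)
    (hnd : ∀ y ∈ Ω, ∀ v, (∀ w, A y v w = 0) → v = 0) {x₀ : E} (hx₀ : x₀ ∈ Ω) :
    ∃ S : E × E → E, ContDiff ℝ ∞ S ∧ (∀ (t : ℝ) (y v : E), S (y, t • v) = t ^ 2 • S (y, v)) ∧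
      ∀ᶠ y in 𝓝 x₀, ∀ v w,
        A y (S (y, v)) w + fderiv ℝ A y v v w - (1 / 2) * fderiv ℝ A y w v v = 0 := by
  obtain ⟨R, hR, hball⟩ := Metric.isOpen_iff.1 hΩ x₀ hx₀
  let χ : ContDiffBump x₀ := ⟨R / 4, R / 2, by positivity, by linarith⟩
  have hdA : ContDiffOn ℝ ∞ (fderiv ℝ A) Ω := hA.fderiv_of_isOpen hΩ (by simp)
  let lam : E × E → E →L[ℝ] ℝ := fun p ↦
    (1 / 2 : ℝ) • ((fderiv ℝ A p.1).flip p.2).flip p.2 - fderiv ℝ A p.1 p.2 p.2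
  have hlam : ContDiffOn ℝ ∞ lam (Ω ×ˢ univ) := by
    rw [contDiffOn_clm_apply]
    intro w
    have h1 : ContDiffOn ℝ ∞ (fun p : E × E ↦ fderiv ℝ A p.1) (Ω ×ˢ univ) :=
      hdA.comp contDiffOn_fst fun p hp ↦ hp.1
    have h2 : ContDiffOn ℝ ∞ (fun p : E × E ↦ p.2) (Ω ×ˢ univ) := contDiffOn_snd
    have h3 := ((h1.clm_apply (contDiffOn_const (c := w))).clm_apply h2).clm_apply h2
    have h4 := ((h1.clm_apply h2).clm_apply h2).clm_apply (contDiffOn_const (c := w))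
    exact ((contDiffOn_const (c := (1 / 2 : ℝ))).mul h3).sub h4
  have hrank : Module.finrank ℝ E = Module.finrank ℝ (E →L[ℝ] ℝ) := by
    rw [← (LinearMap.toContinuousLinearMap (𝕜 := ℝ) (E := E) (F' := ℝ)).finrank_eq]
    exact (Subspace.dual_finrank_eq (K := ℝ) (V := E)).symm
  have hequiv : ∀ y ∈ Ω, ∃ f : E ≃L[ℝ] (E →L[ℝ] ℝ), (f : E →L[ℝ] (E →L[ℝ] ℝ)) = A y := by
    intro y hy
    have hinj : Function.Injective (A y : E →ₗ[ℝ] (E →L[ℝ] ℝ)) := by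
      refine (injective_iff_map_eq_zero _).2 fun v hv ↦ hnd y hy v fun w ↦ ?_
      exact congrArg (fun f : E →L[ℝ] ℝ ↦ f w) hv
    refine ⟨(LinearEquiv.ofInjectiveOfFinrankEq _ hinj hrank).toContinuousLinearEquiv, ?_⟩
    ext v w
    rfl
  have hinv : ContDiffOn ℝ ∞ (fun y ↦ (A y).inverse) Ω := fun y hy ↦ by
    obtain ⟨f, hf⟩ := hequiv y hy
    have h1 : ContDiffAt ℝ ∞ ContinuousLinearMap.inverse (A y) := by
      rw [← hf]; exact contDiffAt_map_inverse f
    exact h1.comp_contDiffWithinAt y (hA y hy)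
  let S₀ : E × E → E := fun p ↦ (A p.1).inverse (lam p)
  have hS₀ : ContDiffOn ℝ ∞ S₀ (Ω ×ˢ univ) :=
    (hinv.comp contDiffOn_fst fun p hp ↦ hp.1).clm_apply hlam
  refine ⟨fun p ↦ χ p.1 • S₀ p, ?_, ?_, ?_⟩
  · rw [contDiff_iff_contDiffAt]
    intro p
    by_cases hp : p.1 ∈ Ω
    · exact (χ.contDiff.contDiffAt.comp p contDiffAt_fst).smul
        (hS₀.contDiffAt ((hΩ.prod isOpen_univ).mem_nhds ⟨hp, mem_univ _⟩))
    · have h1 : p.1 ∉ Metric.closedBall x₀ (R / 2) := fun hmem ↦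
        hp (hball (Metric.closedBall_subset_ball (by linarith) hmem))
      have h2 : (fun q : E × E ↦ χ q.1 • S₀ q) =ᶠ[𝓝 p] fun _ ↦ 0 := by
        have h3 : ∀ᶠ q : E × E in 𝓝 p, q.1 ∉ Metric.closedBall x₀ (R / 2) :=
          continuous_fst.continuousAt.eventually (Metric.isClosed_closedBall.isOpen_compl.mem_nhds h1)
        filter_upwards [h3] with q hq
        have : χ q.1 = 0 := χ.zero_of_le_dist (by
          rw [Metric.mem_closedBall, not_le] at hq; exact hq.le)
        rw [this, zero_smul]
      exact contDiffAt_const.congr_of_eventuallyEq h2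
  · intro t y v
    have : lam (y, t • v) = t ^ 2 • lam (y, v) := by
      ext w
      simp [lam]
      ring
    simp only [S₀, this, map_smul]
    rw [smul_comm]
  · filter_upwards [Metric.closedBall_mem_nhds x₀ (by positivity : 0 < R / 4), hΩ.mem_nhds hx₀]
      with y hy hyΩ v w
    have h1 : χ y = 1 := χ.one_of_mem_closedBall hy
    obtain ⟨f, hf⟩ := hequiv y hyΩ
    have h2 : A y (S₀ (y, v)) = lam (y, v) := by
      simp only [S₀]
      rw [← hf, ContinuousLinearMap.inverse_equiv]
      simp
    simp only [h1, one_smul, h2]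
    simp [lam]

/-- The Gauss lemma: if straight lines through the origin satisfy the geodesic equation of `G`,
then radial directions have the same products with all vectors at the origin and along the ray. -/
theorem gauss_lemma {G : E → E →L[ℝ] E →L[ℝ] ℝ} {Ω : Set E} (hΩ : IsOpen Ω)
    (hstar : StarConvex ℝ 0 Ω) (hG : ContDiffOn ℝ ∞ G Ω)
    (hsymm : ∀ y ∈ Ω, ∀ u w, G y u w = G y w u)
    (hgeo : ∀ (v : E) (t : ℝ), t • v ∈ Ω → ∀ w, eulerLagrange G (fun s ↦ s • v) t w = 0)
    {x : E} (hx : x ∈ Ω) (w : E) : G x x w = G 0 x w := by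
  have hdG : ∀ y ∈ Ω, HasFDerivAt G (fderiv ℝ G y) y := fun y hy ↦
    ((hG.contDiffAt (hΩ.mem_nhds hy)).differentiableAt (by simp)).hasFDerivAt
  have hline : ∀ v : E, deriv (fun s : ℝ ↦ s • v) = fun _ ↦ v := fun v ↦ funext fun s ↦ by
    simpa using ((hasDerivAt_id s).smul_const v).deriv
  have hEL : ∀ (v : E) (t : ℝ), t • v ∈ Ω → ∀ w,
      fderiv ℝ G (t • v) v v w = (1 / 2) * fderiv ℝ G (t • v) w v v := fun v t ht w ↦ by
    have := hgeo v t ht w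
    rw [eulerLagrange_eq (hdG _ ht).differentiableAt, hline] at this
    simp at this
    linarith
  have hray : ∀ v ∈ Ω, ∀ t ∈ Icc (0 : ℝ) 1, t • v ∈ Ω := fun v hv t ht ↦
    hstar.smul_mem hv ht.1 ht.2
  have hderiv : ∀ (v : E) (t : ℝ), t • v ∈ Ω → ∀ u w,
      HasDerivAt (fun s : ℝ ↦ G (s • v) u w) (fderiv ℝ G (t • v) v u w) t := fun v t ht u w ↦ by
    have h1 : HasDerivAt (fun s : ℝ ↦ s • v) v t := by simpa using (hasDerivAt_id t).smul_const v
    have h2 := ((hdG _ ht).comp_hasDerivAt t h1)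
    have := (h2.clm_apply (hasDerivAt_const t u)).clm_apply (hasDerivAt_const t w)
    simpa using! this
  -- Taking `w = v` in `hEL`, the derivative of the energy equals half of itself, hence vanishes.
  have henergy : ∀ v ∈ Ω, G v v v = G 0 v v := fun v hv ↦ by
    have := (convex_Icc (0 : ℝ) 1).is_const_of_fderivWithin_eq_zero
      (f := fun s : ℝ ↦ G (s • v) v v)
      (fun t ht ↦ (hderiv v t (hray v hv t ht) v v).differentiableAt.differentiableWithinAt)
      (fun t ht ↦ by
        have h1 := hderiv v t (hray v hv t ht) v v
        have h2 := hEL v t (hray v hv t ht) v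
        have h3 : fderiv ℝ G (t • v) v v v = 0 := by linarith
        rw [h3] at h1
        rw [(h1.hasFDerivAt.hasFDerivWithinAt).fderivWithin (uniqueDiffOn_Icc_zero_one t ht)]
        ext; simp)
      (left_mem_Icc.2 zero_le_one) (right_mem_Icc.2 zero_le_one)
    simpa using this.symm
  -- The identity `G_z(z, z) = G_0(z, z)` is differentiated in the direction `w`.
  have hvar : ∀ y ∈ Ω, ∀ w, fderiv ℝ G y w y y + 2 * G y y w = 2 * G 0 y w := fun y hy w ↦ by
    have h1 : HasFDerivAt (fun z ↦ G z z z) _ y :=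
      ((hdG y hy).clm_apply (hasFDerivAt_id y)).clm_apply (hasFDerivAt_id y)
    have h0Ω : (0 : E) ∈ Ω := by simpa using hray x hx 0 (by simp)
    have h2 : HasFDerivAt (fun z ↦ G 0 z z) _ y :=
      ((G 0).hasFDerivAt (x := y)).clm_apply (hasFDerivAt_id y)
    have h3 : (fun z ↦ G z z z) =ᶠ[𝓝 y] fun z ↦ G 0 z z := by
      filter_upwards [hΩ.mem_nhds hy] with z hz using henergy z hz
    have h4 := congrArg (fun f : E →L[ℝ] ℝ ↦ f w) (h1.unique (h2.congr_of_eventuallyEq h3))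
    simp at h4
    have h5 := hsymm y hy w y
    have h6 := hsymm 0 h0Ω w y
    linarith
  -- `hEL` and `hvar` together say that this product has zero derivative. It vanishes at `s = 0`,
  -- hence also at `s = 1`; the factor `s` hides the singular point of the equation for the
  -- difference.
  have hconst : ∀ t ∈ Ioo (0 : ℝ) 1,
      HasDerivAt (fun s : ℝ ↦ s * (G (s • x) x w - G 0 x w)) 0 t := fun t ht ↦ by
    have htx := hray x hx t (Ioo_subset_Icc_self ht)
    have h1 := (hasDerivAt_id t).mul ((hderiv x t htx x w).sub_const (G 0 x w))
    have h2 := hvar _ htx w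
    simp only [map_smul, smul_apply, smul_eq_mul] at h2
    have h3 := hEL x t htx w
    refine h1.congr_deriv ?_
    simp only [id, one_mul]
    rw [h3]
    have h4 : t * (G (t • x) x w - G 0 x w + t * (1 / 2 * fderiv ℝ G (t • x) w x x)) = 0 := by
      linarith
    exact (mul_eq_zero.1 h4).resolve_left ht.1.ne'
  have hcont : ContinuousOn (fun s : ℝ ↦ s * (G (s • x) x w - G 0 x w)) (Icc 0 1) := fun t ht ↦
    (continuousAt_id.mul ((hderiv x t (hray x hx t ht) x w).continuousAt.sub
      continuousAt_const)).continuousWithinAt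
  obtain ⟨c, hc, hc'⟩ := exists_hasDerivAt_eq_slope (fun s : ℝ ↦ s * (G (s • x) x w - G 0 x w))
    (fun _ ↦ 0) zero_lt_one hcont hconst
  simp at hc'
  linarith

end EulerLagrange

/-! ### Lorentzian cones: duality and stability under perturbation. -/

section Cones

universe u
variable {E : Type u} [NormedAddCommGroup E] [NormedSpace ℝ E]

/-- `F` is the future causal cone of the Lorentzian form `B` that contains the timelike vector `T`;
the constant `c` bounds from below the time component of unit causal vectors. -/
structure IsFutureCone (B : E →L[ℝ] E →L[ℝ] ℝ) (T : E) (c : ℝ) (F : Set E) : Prop where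
  symm : ∀ u w, B u w = B w u
  timelike : B T T < 0
  pos : 0 < c
  bound : ∀ v, B v v ≤ 0 → c * ‖v‖ ≤ |B T v|
  mem_iff : ∀ v, v ∈ F ↔ v ≠ 0 ∧ B v v ≤ 0 ∧ B T v < 0

namespace IsFutureCone

variable {B : E →L[ℝ] E →L[ℝ] ℝ} {T : E} {c : ℝ} {F : Set E}

theorem neg_of_causal (h : IsFutureCone B T c F) {v : E} (hv : B v v ≤ 0) (hT : B T v ≤ 0)
    (h0 : v ≠ 0) : B T v < 0 := by
  have h1 := h.bound v hv
  rw [abs_of_nonpos hT] at h1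
  have := mul_pos h.pos (norm_pos_iff.2 h0)
  linarith

theorem mem_of_causal (h : IsFutureCone B T c F) {v : E} (hv : B v v ≤ 0) (hT : B T v ≤ 0)
    (h0 : v ≠ 0) : v ∈ F :=
  (h.mem_iff v).2 ⟨h0, hv, h.neg_of_causal hv hT h0⟩

theorem mem_self (h : IsFutureCone B T c F) : T ∈ F :=
  (h.mem_iff T).2 ⟨fun h0 ↦ by simpa [h0] using h.timelike, h.timelike.le, h.timelike⟩

theorem norm_le (h : IsFutureCone B T c F) {v : E} (hv : B v v ≤ 0) (hT : B T v ≤ 0) :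
    c * ‖v‖ ≤ -B T v := by
  have h1 := h.bound v hv
  rwa [abs_of_nonpos hT] at h1

/-- The reverse Cauchy-Schwarz inequality, in its qualitative form. -/
theorem nonpos (h : IsFutureCone B T c F) {v w : E} (hv : B v v ≤ 0) (hTv : B T v ≤ 0)
    (hw : B w w ≤ 0) (hTw : B T w ≤ 0) : B v w ≤ 0 := by
  rcases eq_or_ne v 0 with rfl | hv0
  · simp
  rcases eq_or_ne w 0 with rfl | hw0
  · simp
  have h1 := h.neg_of_causal hv hTv hv0
  have h2 := h.neg_of_causal hw hTw hw0
  -- This combination is orthogonal to `T`, hence not timelike; expanding `B z z ≥ 0` gives the sign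
  -- of `B v w`.
  set z := B T w • v - B T v • w with hz
  have hTz : B T z = 0 := by simp [hz]; ring
  have hzz : 0 ≤ B z z := by
    by_contra! hneg
    have h3 := h.bound z hneg.le
    rw [hTz, abs_zero] at h3
    have h4 : z = 0 := by
      by_contra hne
      have := mul_pos h.pos (norm_pos_iff.2 hne)
      linarith
    rw [h4] at hneg
    simp at hneg
  have hexp : B z z = B T w ^ 2 * B v v - 2 * (B T w * B T v) * B v w + B T v ^ 2 * B w w := by
    simp only [hz, map_sub, map_smul, sub_apply, smul_apply, smul_eq_mul]
    rw [h.symm w v]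
    ring
  have h5 : 0 < B T w * B T v := mul_pos_of_neg_of_neg h2 h1
  by_contra! hpos
  nlinarith [mul_pos h5 hpos, sq_nonneg (B T w), sq_nonneg (B T v),
    mul_nonneg (sq_nonneg (B T w)) (neg_nonneg.2 hv), mul_nonneg (sq_nonneg (B T v)) (neg_nonneg.2 hw)]

/-- The closed future cone is self-dual. -/
theorem causal_of_dual (h : IsFutureCone B T c F) {v : E}
    (hv : ∀ z, B z z ≤ 0 → B T z ≤ 0 → B z v ≤ 0) : B v v ≤ 0 ∧ B T v ≤ 0 := by
  have hTv : B T v ≤ 0 := hv T h.timelike.le h.timelike.le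
  refine ⟨?_, hTv⟩
  by_contra! hpos
  set a := -B T T with ha
  have ha0 : 0 < a := by have := h.timelike; linarith
  set α := -B T v / a with hα
  have hα0 : 0 ≤ α := div_nonneg (by linarith) ha0.le
  have hαa : B T v = -(a * α) := by rw [hα]; field_simp
  set w := v - α • T with hw
  have hTw : B T w = 0 := by
    simp only [hw, map_sub, map_smul, smul_eq_mul, hαa]
    rw [ha]; ring
  have hwT : B w T = 0 := by rw [h.symm, hTw]
  have hv' : v = α • T + w := by rw [hw]; abel
  have hvv : B v v = -(a * α ^ 2) + B w w := by
    rw [hv']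
    simp only [map_add, map_smul, add_apply, smul_apply, smul_eq_mul, hTw, hwT]
    rw [show B T T = -a by rw [ha]; ring]; ring
  set m := B w w with hm
  have hm0 : 0 < m := by nlinarith [mul_nonneg ha0.le (sq_nonneg α)]
  -- `β` makes `β • T + w` null and future-directed. If `v = α • T + w` were spacelike, then `α <
  -- β`, and this null vector would pair with `v` to `a β (β - α) > 0`.
  set β := Real.sqrt (m / a) with hβ
  have hβ2 : a * β ^ 2 = m := by
    rw [hβ, Real.sq_sqrt (by positivity)]; field_simp
  have hβ0 : 0 ≤ β := Real.sqrt_nonneg _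
  have hαβ : α < β := by
    refine lt_of_pow_lt_pow_left₀ 2 hβ0 ?_
    by_contra! hle
    nlinarith [mul_le_mul_of_nonneg_left hle ha0.le]
  have h1 : B (β • T + w) (β • T + w) = 0 := by
    simp only [map_add, map_smul, add_apply, smul_apply, smul_eq_mul, hTw, hwT]
    rw [show B T T = -a by rw [ha]; ring, ← hm, ← hβ2]; ring
  have h2 : B T (β • T + w) ≤ 0 := by
    simp only [map_add, map_smul, smul_eq_mul, hTw]
    nlinarith [h.timelike]
  have h3 := hv _ h1.le h2
  have h4 : B (β • T + w) v = -(a * α * β) + m := by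
    conv_lhs => rw [hv']
    simp only [map_add, map_smul, add_apply, smul_apply, smul_eq_mul, hTw, hwT]
    rw [show B T T = -a by rw [ha]; ring, ← hm]; ring
  have h5 : 0 < a * β * (β - α) := by
    have : 0 < β := hα0.trans_lt hαβ
    have := sub_pos.2 hαβ
    positivity
  nlinarith

end IsFutureCone

/-- For a form of index one, the orthogonal complement of every timelike vector is spacelike. -/
theorem pos_of_orthogonal_timelike {B : E →L[ℝ] E →L[ℝ] ℝ} (hsymm : ∀ u w, B u w = B w u)
    (hindex : ∃ v, B v v < 0 ∧ ∀ w, B v w = 0 → w ≠ 0 → 0 < B w w) {T : E} (hT : B T T < 0)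
    {w : E} (hw : B T w = 0) (hw0 : w ≠ 0) : 0 < B w w := by
  obtain ⟨v, hv, hpos⟩ := hindex
  by_contra! hle
  have hwT : B w T = 0 := by rw [hsymm, hw]
  -- `z` lies in the complement of `v`, where the form is positive, yet `B z z ≤ 0`; so `z = 0`, and
  -- pairing with `T` shows that `w` is orthogonal to `v` as well.
  set z := B v w • T - B v T • w with hz
  have h1 : B v z = 0 := by simp [hz]; ring
  have h2 : B z z ≤ 0 := by
    have : B z z = B v w ^ 2 * B T T + B v T ^ 2 * B w w := by
      simp only [hz, map_sub, map_smul, sub_apply, smul_apply, smul_eq_mul, hw, hwT]; ring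
    rw [this]
    nlinarith [mul_nonneg (sq_nonneg (B v w)) (neg_nonneg.2 hT.le),
      mul_nonneg (sq_nonneg (B v T)) (neg_nonneg.2 hle)]
  have h3 : z = 0 := by
    by_contra hne
    exact absurd (hpos z h1 hne) (not_lt.2 h2)
  have h4 : B T z = B v w * B T T := by simp [hz, hw]
  rw [h3, map_zero] at h4
  have h5 : B v w = 0 := (mul_eq_zero.1 h4.symm).resolve_right hT.ne
  exact absurd (hpos w h5 hw0) (not_lt.2 hle)

/-- On the unit sphere `max (A y₀ v v) |A y₀ T v|` is positive, since the complement of `T` is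
spacelike. By compactness it has a positive minimum, half of which persists for nearby `y`. -/
theorem exists_bound_timelike [FiniteDimensional ℝ E] {A : E → E →L[ℝ] E →L[ℝ] ℝ} {y₀ : E}
    (hA : ContinuousAt A y₀) (hsymm : ∀ u w, A y₀ u w = A y₀ w u)
    (hindex : ∃ v, A y₀ v v < 0 ∧ ∀ w, A y₀ v w = 0 → w ≠ 0 → 0 < A y₀ w w) {T : E}
    (hT : A y₀ T T < 0) :
    ∃ c > 0, ∀ᶠ y in 𝓝 y₀, ∀ v, A y v v ≤ 0 → c * ‖v‖ ≤ |A y T v| := by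
  have hcomp : IsCompact (Metric.sphere (0 : E) 1) := isCompact_sphere 0 1
  have hpos : ∀ v ∈ Metric.sphere (0 : E) 1, 0 < max (A y₀ v v) |A y₀ T v| := by
    intro v hv
    have hv0 : v ≠ 0 := by
      rintro rfl
      simp at hv
    by_cases h : A y₀ T v = 0
    · exact lt_max_of_lt_left (pos_of_orthogonal_timelike hsymm hindex hT h hv0)
    · exact lt_max_of_lt_right (abs_pos.2 h)
  have hne : (Metric.sphere (0 : E) 1).Nonempty := by
    have hT0 : T ≠ 0 := fun h ↦ by simp [h] at hT
    refine ⟨‖T‖⁻¹ • T, ?_⟩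
    rw [mem_sphere_zero_iff_norm, norm_smul, norm_inv, norm_norm,
      inv_mul_cancel₀ (norm_ne_zero_iff.2 hT0)]
  have hc0 : Continuous fun v ↦ max (A y₀ v v) |A y₀ T v| := by fun_prop
  obtain ⟨v₀, hv₀, hmin⟩ := hcomp.exists_isMinOn hne hc0.continuousOn
  set m := max (A y₀ v₀ v₀) |A y₀ T v₀| with hm
  have hm0 : 0 < m := hpos v₀ hv₀
  have hev : ∀ᶠ y in 𝓝 y₀, ∀ v ∈ Metric.sphere (0 : E) 1, m / 2 < max (A y v v) |A y T v| := by
    refine hcomp.eventually_forall_of_forall_eventually fun v hv ↦ ?_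
    have hA' : ContinuousAt (fun z : E × E ↦ A z.1) (y₀, v) :=
      ContinuousAt.comp (f := Prod.fst) hA continuousAt_fst
    have hc : ContinuousAt (fun z : E × E ↦ max (A z.1 z.2 z.2) |A z.1 T z.2|) (y₀, v) :=
      ((hA'.clm_apply continuousAt_snd).clm_apply continuousAt_snd).max
        ((hA'.clm_apply continuousAt_const).clm_apply continuousAt_snd).abs
    refine hc.eventually (lt_mem_nhds ?_)
    have : m ≤ max (A y₀ v v) |A y₀ T v| := hmin hv
    dsimp only
    linarith
  refine ⟨m / 2, by positivity, ?_⟩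
  filter_upwards [hev] with y hy v hv
  rcases eq_or_ne v 0 with rfl | hv0
  · simp
  have hn : 0 < ‖v‖ := norm_pos_iff.2 hv0
  have h1 := hy (‖v‖⁻¹ • v) (by
    rw [mem_sphere_zero_iff_norm, norm_smul, norm_inv, norm_norm, inv_mul_cancel₀ hn.ne'])
  simp only [map_smul, smul_apply, smul_eq_mul, abs_mul, abs_inv, abs_norm] at h1
  have h2 : ‖v‖⁻¹ * (‖v‖⁻¹ * A y v v) ≤ 0 := by
    have : 0 ≤ ‖v‖⁻¹ := by positivity
    exact mul_nonpos_of_nonneg_of_nonpos this (mul_nonpos_of_nonneg_of_nonpos this hv)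
  rcases lt_max_iff.1 h1 with h3 | h3
  · linarith
  · rw [inv_mul_eq_div, lt_div_iff₀ hn] at h3
    exact h3.le

/-- Near `y₀`, the future cones of a continuous Lorentzian metric, selected by a continuous field of
covectors `θ` representing a timelike vector, are selected by one constant vector. -/
theorem eventually_isFutureCone [FiniteDimensional ℝ E] {A : E → E →L[ℝ] E →L[ℝ] ℝ} {y₀ : E}
    (hA : ContinuousAt A y₀) (hsymm : ∀ᶠ y in 𝓝 y₀, ∀ u w, A y u w = A y w u)
    (hindex : ∃ v, A y₀ v v < 0 ∧ ∀ w, A y₀ v w = 0 → w ≠ 0 → 0 < A y₀ w w) {T : E}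
    (hT : A y₀ T T < 0) {θ : E → E →L[ℝ] ℝ} (hθ : ContinuousAt θ y₀) (hθ₀ : θ y₀ = A y₀ T)
    {F : E → Set E}
    (hF : ∀ᶠ y in 𝓝 y₀, ∀ v, v ∈ F y ↔ (A y v v < 0 ∨ (A y v v = 0 ∧ v ≠ 0)) ∧ θ y v < 0) :
    ∃ c, ∀ᶠ y in 𝓝 y₀, IsFutureCone (A y) T c (F y) := by
  obtain ⟨c, hc, hbound⟩ := exists_bound_timelike hA hsymm.self_of_nhds hindex hT
  have hT' : ∀ᶠ y in 𝓝 y₀, A y T T < 0 :=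
    ((hA.clm_apply continuousAt_const).clm_apply continuousAt_const).eventually (gt_mem_nhds hT)
  have hnear : ∀ᶠ y in 𝓝 y₀, ‖θ y - A y T‖ < c := by
    have : ContinuousAt (fun y ↦ ‖θ y - A y T‖) y₀ := (hθ.sub (hA.clm_apply continuousAt_const)).norm
    exact this.eventually (gt_mem_nhds (by simpa [hθ₀] using hc))
  refine ⟨c, ?_⟩
  filter_upwards [hbound, hT', hnear, hsymm, hF] with y h1 h2 h3 h4 h5
  refine ⟨h4, h2, hc, h1, fun v ↦ ?_⟩
  rw [h5]
  have hcausal : (A y v v < 0 ∨ (A y v v = 0 ∧ v ≠ 0)) ↔ v ≠ 0 ∧ A y v v ≤ 0 := by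
    constructor
    · rintro (h | h)
      · exact ⟨fun h0 ↦ by simp [h0] at h, h.le⟩
      · exact ⟨h.2, h.1.le⟩
    · rintro ⟨h, h'⟩
      exact (lt_or_eq_of_le h').imp_right fun h'' ↦ ⟨h'', h⟩
  rw [hcausal, and_assoc]
  refine and_congr_right fun hv0 ↦ and_congr_right fun hv ↦ ?_
  have hn : 0 < ‖v‖ := norm_pos_iff.2 hv0
  -- On causal vectors `|A y T v| ≥ c ‖v‖`, so a covector closer than `c` has the same sign there.
  have h6 : |θ y v - A y T v| < c * ‖v‖ :=
    ((θ y - A y T).le_opNorm v).trans_lt (mul_lt_mul_of_pos_right h3 hn)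
  have h7 := h1 v hv
  rw [abs_lt] at h6
  constructor
  · intro h8
    by_contra! h9
    rw [abs_of_nonneg h9] at h7
    linarith
  · intro h9
    rw [abs_of_neg h9] at h7
    linarith

/-- Causal vectors become causal at nearby points after adding a multiple of a timelike vector. -/
theorem exists_causal_perturbation {A : E → E →L[ℝ] E →L[ℝ] ℝ} {y₀ : E}
    (hA : ContDiffAt ℝ 1 A y₀) {T : E} {c : ℝ} {F : E → Set E}
    (hF : ∀ᶠ y in 𝓝 y₀, IsFutureCone (A y) T c (F y)) :
    ∃ C > 0, ∃ R > 0, ∀ y ∈ Metric.ball y₀ R, ∀ z ∈ Metric.ball y₀ R,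
      IsFutureCone (A y) T c (F y) ∧
      ∀ v, A y v v ≤ 0 → A y T v ≤ 0 → (c / 2) * ‖v‖ ≤ -A z T v ∧
        ∀ κ, C * ‖z - y‖ * ‖v‖ ≤ κ →
          A z (v + κ • T) (v + κ • T) ≤ 0 ∧ A z T (v + κ • T) ≤ 0 := by
  obtain ⟨K, s, hs, hK⟩ := hA.exists_lipschitzOnWith
  have hc : 0 < c := hF.self_of_nhds.pos
  have hK0 : (0 : ℝ) ≤ K := K.2
  obtain ⟨R₀, hR₀, hball⟩ := Metric.mem_nhds_iff.1 (Filter.inter_mem hs hF)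
  set R := min R₀ (c / (4 * ((K + 1) * (‖T‖ + 1)))) with hR
  have hR0 : 0 < R := lt_min hR₀ (by positivity)
  -- Moving from `y` to `z` raises the form on `v` by at most `K ‖z - y‖ ‖v‖²`, while adding `κ • T`
  -- lowers it by at least `κ c ‖v‖`; hence the constant `(K + 1) / c`. The radius `R` costs at most
  -- half of the time component of `v`.
  refine ⟨(K + 1) / c, by positivity, R, hR0, fun y hy z hz ↦ ?_⟩
  obtain ⟨hys, hyF⟩ := hball (Metric.ball_subset_ball (min_le_left _ _) hy)
  obtain ⟨hzs, hzF⟩ := hball (Metric.ball_subset_ball (min_le_left _ _) hz)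
  refine ⟨hyF, fun v hv hTv ↦ ?_⟩
  have hlip : ∀ u w, |A z u w - A y u w| ≤ K * ‖z - y‖ * ‖u‖ * ‖w‖ := fun u w ↦ by
    have h1 := hK.dist_le_mul z hzs y hys
    rw [dist_eq_norm, dist_eq_norm] at h1
    refine ((A z - A y).le_opNorm₂ u w).trans ?_
    gcongr
  have hdist : ‖z - y‖ * ((K + 1) * (‖T‖ + 1)) ≤ c / 2 := by
    have h1 : ‖z - y‖ < 2 * R := by
      have := dist_triangle_right z y y₀
      rw [dist_eq_norm] at this
      rw [Metric.mem_ball] at hy hz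
      linarith
    have h2 : R ≤ c / (4 * ((K + 1) * (‖T‖ + 1))) := min_le_right _ _
    rw [le_div_iff₀ (by positivity)] at h2
    have : 0 < (K + 1 : ℝ) * (‖T‖ + 1) := by positivity
    nlinarith
  have hTz : (c / 2) * ‖v‖ ≤ -A z T v := by
    have h1 := hyF.norm_le hv hTv
    have h2 := abs_le.1 (hlip T v)
    have h3 : K * ‖z - y‖ * ‖T‖ * ‖v‖ ≤ (c / 2) * ‖v‖ := by
      refine mul_le_mul_of_nonneg_right ?_ (norm_nonneg v)
      refine le_trans ?_ hdist
      nlinarith [norm_nonneg (z - y), norm_nonneg T, mul_nonneg hK0 (norm_nonneg (z - y)),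
        mul_nonneg (norm_nonneg (z - y)) (norm_nonneg T)]
    linarith [h2.1, h2.2]
  refine ⟨hTz, fun κ hκ ↦ ?_⟩
  have hκ0 : 0 ≤ κ := le_trans (by positivity) hκ
  have hTT := hzF.timelike
  constructor
  · have h1 : A z (v + κ • T) (v + κ • T) = A z v v + 2 * κ * A z T v + κ ^ 2 * A z T T := by
      simp only [map_add, map_smul, add_apply, smul_apply, smul_eq_mul]
      rw [hzF.symm v T]; ring
    rw [h1]
    have h2 := (abs_le.1 (hlip v v)).2
    have h3 : K * ‖z - y‖ * ‖v‖ * ‖v‖ ≤ κ * c * ‖v‖ := by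
      refine mul_le_mul_of_nonneg_right ?_ (norm_nonneg v)
      rw [div_mul_eq_mul_div, div_mul_eq_mul_div, div_le_iff₀ hc] at hκ
      nlinarith [mul_nonneg (norm_nonneg (z - y)) (norm_nonneg v)]
    have h4 : 2 * κ * A z T v ≤ -(κ * c * ‖v‖) := by nlinarith
    have h5 : κ ^ 2 * A z T T ≤ 0 := mul_nonpos_of_nonneg_of_nonpos (sq_nonneg _) hTT.le
    linarith
  · simp only [map_add, map_smul, smul_eq_mul]
    have h2 : 0 ≤ (c / 2) * ‖v‖ := by positivity
    nlinarith

end Cones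

/-! ### Causal curves stay in the cone of the origin of normal coordinates. -/

section Propagation

universe u
variable {E : Type u} [NormedAddCommGroup E] [NormedSpace ℝ E]

/-- An absolutely continuous curve is causal with respect to a field of cones if almost all of its
velocities lie in the cones. -/
def IsACCausalOn (F : E → Set E) (x : ℝ → E) (a b : ℝ) : Prop :=
  AbsolutelyContinuousOnInterval x a b ∧ ∀ᵐ t, t ∈ Ioo a b → ∃ v ∈ F (x t), HasDerivAt x v t

theorem IsACCausalOn.mono {F : E → Set E} {x : ℝ → E} {a b a' b' : ℝ} (h : IsACCausalOn F x a b)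
    (hab' : a' ≤ b') (ha : a ≤ a') (hb : b' ≤ b) : IsACCausalOn F x a' b' := by
  refine ⟨h.1.mono ?_, ?_⟩
  · rw [uIcc_of_le hab', uIcc_of_le (ha.trans (hab'.trans hb))]
    exact Icc_subset_Icc ha hb
  · filter_upwards [h.2] with t ht ht'
    exact ht ⟨ha.trans_lt ht'.1, ht'.2.trans_le hb⟩

theorem IsACCausalOn.continuousOn {F : E → Set E} {x : ℝ → E} {a b : ℝ} (h : IsACCausalOn F x a b)
    (hab : a ≤ b) : ContinuousOn x (Icc a b) := by
  have := h.1.continuousOn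
  rwa [uIcc_of_le hab] at this

/-- The curve is bounded and `f` is Lipschitz on balls, so `f ∘ x` is absolutely continuous and the
sign of its derivative can be integrated. -/
theorem IsACCausalOn.le_of_fderiv_nonpos [FiniteDimensional ℝ E] {F : E → Set E} {x : ℝ → E}
    {a b : ℝ} (hab : a ≤ b) (h : IsACCausalOn F x a b) {f : E → ℝ} (hf : ContDiff ℝ 1 f)
    (hmono : ∀ t ∈ Ioo a b, ∀ v ∈ F (x t), fderiv ℝ f (x t) v ≤ 0) : f (x b) ≤ f (x a) := by
  obtain ⟨R, hR⟩ := h.1.exists_bound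
  obtain ⟨K, hK⟩ := (hf.contDiffOn (s := Metric.closedBall (0 : E) R)).exists_lipschitzOnWith
    (by simp) (convex_closedBall _ _) (isCompact_closedBall _ _)
  have hac := hK.comp_absolutelyContinuousOnInterval h.1
    fun t ht ↦ mem_closedBall_zero_iff.2 (hR t ht)
  refine hac.le_of_ae_deriv_nonpos hab ?_
  filter_upwards [h.2] with t ht htab
  obtain ⟨v, hv, hd⟩ := ht htab
  have h1 := ((hf.differentiable (by simp)) (x t)).hasFDerivAt.comp_hasDerivAt t hd
  have h2 : deriv (fun t ↦ f (x t)) t = fderiv ℝ f (x t) v := h1.deriv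
  rw [h2]
  exact hmono t htab v hv

variable {G : E → E →L[ℝ] E →L[ℝ] ℝ} {Ω : Set E} {F : E → Set E}

/-- A vector that is future causal at the origin is future causal along the ray it spans. -/
theorem mem_future_radial (hΩ : IsOpen Ω) (hstar : StarConvex ℝ 0 Ω) (hG : ContDiffOn ℝ ∞ G Ω)
    (hgauss : ∀ x ∈ Ω, ∀ w, G x x w = G 0 x w)
    (hF : ∀ y ∈ Ω, ∃ T c, ∀ᶠ z in 𝓝 y, IsFutureCone (G z) T c (F z)) {x : E} (hx : x ∈ Ω)
    (hxF : x ∈ F 0) {s : ℝ} (hs : s ∈ Icc (0 : ℝ) 1) : x ∈ F (s • x) := by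
  have hray : ∀ t ∈ Icc (0 : ℝ) 1, t • x ∈ Ω := fun t ht ↦ hstar.smul_mem hx ht.1 ht.2
  have h0Ω : (0 : E) ∈ Ω := by simpa using hray 0 (by simp)
  obtain ⟨T₀, c₀, h0⟩ := hF 0 h0Ω
  obtain ⟨hx0, hxx, -⟩ := (h0.self_of_nhds.mem_iff x).1 hxF
  -- By the Gauss lemma `G_{tx}(x, x) = G_0(x, x)`, so `x` stays causal along its ray.
  have hnull : ∀ t ∈ Icc (0 : ℝ) 1, G (t • x) x x ≤ 0 := fun t ht ↦ by
    rcases eq_or_ne t 0 with rfl | ht0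
    · rwa [zero_smul]
    · have h1 := hgauss _ (hray t ht) x
      simp only [map_smul, smul_apply, smul_eq_mul] at h1
      rw [mul_left_cancel₀ ht0 h1]
      exact hxx
  -- A nonzero causal vector is never orthogonal to `T`, so being future-directed is locally
  -- constant along the ray; connectedness of `[0,1]` does the rest.
  have hloc : ∀ t ∈ Icc (0 : ℝ) 1, ∀ᶠ r in 𝓝[Icc 0 1] t, (x ∈ F (t • x) ↔ x ∈ F (r • x)) := by
    intro t ht
    obtain ⟨T, c, hTc⟩ := hF _ (hray t ht)
    have hsmul : ContinuousAt (fun r : ℝ ↦ r • x) t := by fun_prop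
    have hcone : ∀ᶠ r in 𝓝 t, IsFutureCone (G (r • x)) T c (F (r • x)) := hsmul.eventually hTc
    have hiff : ∀ r ∈ Icc (0 : ℝ) 1, IsFutureCone (G (r • x)) T c (F (r • x)) →
        (x ∈ F (r • x) ↔ G (r • x) T x < 0) := fun r hr hrF ↦ by
      rw [hrF.mem_iff]
      exact ⟨fun h ↦ h.2.2, fun h ↦ ⟨hx0, hnull r hr, h⟩⟩
    have hGc : ContinuousAt (fun r : ℝ ↦ G (r • x) T x) t := by
      have h1 : ContinuousAt (fun r : ℝ ↦ G (r • x)) t :=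
        ContinuousAt.comp (f := fun r : ℝ ↦ r • x)
          (hG.continuousOn.continuousAt (hΩ.mem_nhds (hray t ht))) hsmul
      exact (h1.clm_apply continuousAt_const).clm_apply continuousAt_const
    have htF := hcone.self_of_nhds
    by_cases hneg : G (t • x) T x < 0
    · filter_upwards [hcone.filter_mono nhdsWithin_le_nhds, self_mem_nhdsWithin,
        (hGc.eventually (gt_mem_nhds hneg)).filter_mono nhdsWithin_le_nhds] with r h1 h2 h3
      rw [hiff t ht htF, hiff r h2 h1]
      exact iff_of_true hneg h3
    · have hpos : 0 < G (t • x) T x := by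
        rcases lt_or_eq_of_le (not_lt.1 hneg) with h | h
        · exact h
        · exact absurd (htF.neg_of_causal (hnull t ht) h.symm.le hx0) hneg
      filter_upwards [hcone.filter_mono nhdsWithin_le_nhds, self_mem_nhdsWithin,
        (hGc.eventually (lt_mem_nhds hpos)).filter_mono nhdsWithin_le_nhds] with r h1 h2 h3
      rw [hiff t ht htF, hiff r h2 h1]
      exact iff_of_false hneg (not_lt.2 h3.le)
  have := isPreconnected_Icc.induction₂ (fun t r : ℝ ↦ (x ∈ F (t • x) ↔ x ∈ F (r • x))) hloc
    (fun _ _ _ _ _ _ h1 h2 ↦ h1.trans h2) (fun _ _ _ _ h ↦ h.symm)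
    (left_mem_Icc.2 zero_le_one) hs
  refine this.1 ?_
  rwa [zero_smul]

variable [FiniteDimensional ℝ E]

/-- A causal curve that starts in the closed future cone of the origin stays in it for a while. -/
theorem eventually_mem_closedCone (hΩ : IsOpen Ω) (hstar : StarConvex ℝ 0 Ω)
    (hG : ContDiffOn ℝ ∞ G Ω) (hgauss : ∀ x ∈ Ω, ∀ w, G x x w = G 0 x w)
    (hF : ∀ y ∈ Ω, ∃ T c, ∀ᶠ z in 𝓝 y, IsFutureCone (G z) T c (F z)) {T₀ : E} {c₀ : ℝ}
    (h0 : IsFutureCone (G 0) T₀ c₀ (F 0)) {x : ℝ → E} {a b : ℝ} (hab : a < b)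
    (hx : IsACCausalOn F x a b) (hxa : x a ∈ Ω) (hca : G 0 (x a) (x a) ≤ 0 ∧ G 0 T₀ (x a) ≤ 0) :
    ∀ᶠ t in 𝓝[>] a, G 0 (x t) (x t) ≤ 0 ∧ G 0 T₀ (x t) ≤ 0 := by
  set y₀ := x a with hy₀
  obtain ⟨T, c, hTc⟩ := hF y₀ hxa
  have hT0 : 0 ≤ ‖T‖ := norm_nonneg T
  have hc : 0 < c := hTc.self_of_nhds.pos
  obtain ⟨C, hC, R₁, hR₁, hpert⟩ := exists_causal_perturbation
    ((hG.contDiffAt (hΩ.mem_nhds hxa)).of_le (by simp)) hTc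
  obtain ⟨R₂, hR₂, hR₂Ω⟩ := Metric.isOpen_iff.1 hΩ y₀ hxa
  set R := min R₁ R₂ with hR
  have hR0 : 0 < R := lt_min hR₁ hR₂
  -- the time function and the perturbing diffeomorphisms
  set ℓ : E →L[ℝ] ℝ := -G y₀ T with hℓ
  -- `Φ η` moves `z` by `η m(z) ‖T‖` and adds `η m(z) k ℓ(v) • T` to a velocity `v`. Since `ℓ v ≥ (c
  -- / 2) ‖v‖`, this `k` makes the added multiple large enough for `exists_causal_perturbation`.
  set k := 2 * C * ‖T‖ / c with hk
  have hk0 : 0 ≤ k := by positivity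
  let m : E → ℝ := fun z ↦ Real.exp (k * ℓ (z - y₀))
  have hm : ContDiff ℝ 1 m :=
    Real.contDiff_exp.comp (contDiff_const.mul (ℓ.contDiff.comp (contDiff_id.sub contDiff_const)))
  have hmd : ∀ z, HasFDerivAt m ((m z * k) • ℓ) z := fun z ↦ by
    have h1 : HasFDerivAt (fun z ↦ k * ℓ (z - y₀)) (k • ℓ) z := by
      have := (ℓ.hasFDerivAt (x := z - y₀)).comp z ((hasFDerivAt_id z).sub_const y₀)
      exact this.const_mul k
    have := h1.exp
    rwa [smul_smul] at this
  let Φ : ℝ → E → E := fun η z ↦ z + (η * m z) • T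
  have hΦ : ∀ η, ContDiff ℝ 1 (Φ η) := fun η ↦
    contDiff_id.add ((contDiff_const.mul hm).smul contDiff_const)
  have hΦd : ∀ η z v, fderiv ℝ (Φ η) z v = v + (η * (m z * k * ℓ v)) • T := fun η z v ↦ by
    have h1 : HasFDerivAt (Φ η) _ z := (hasFDerivAt_id z).add (((hmd z).const_mul η).smul_const T)
    rw [h1.fderiv]
    simp [mul_assoc]
  let Q : ℝ → E → ℝ := fun η z ↦ G 0 (Φ η z) (Φ η z)
  have hQ : ∀ η, ContDiff ℝ 1 (Q η) := fun η ↦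
    (((G 0).contDiff.comp (hΦ η)).clm_apply (hΦ η))
  have h0Ω : (0 : E) ∈ Ω := by simpa using hstar.smul_mem hxa le_rfl zero_le_one
  have hQd : ∀ η z v, fderiv ℝ (Q η) z v = 2 * G 0 (Φ η z) (fderiv ℝ (Φ η) z v) := fun η z v ↦ by
    have h1 : HasFDerivAt (Φ η) (fderiv ℝ (Φ η) z) z :=
      (((hΦ η).differentiable (by simp)) z).hasFDerivAt
    have h2 : HasFDerivAt (Q η) _ z :=
      (((G 0).hasFDerivAt (x := Φ η z)).comp z h1).clm_apply h1
    rw [h2.fderiv]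
    simp
    rw [h0.symm (fderiv ℝ (Φ η) z v)]
    ring
  -- the curve stays near its starting point
  have hxc := hx.continuousOn hab.le
  obtain ⟨b', hab', hb'b, hnear⟩ : ∃ b', a < b' ∧ b' ≤ b ∧
      ∀ t ∈ Icc a b', x t ∈ Metric.ball y₀ (R / 2) := by
    have h1 : ∀ᶠ t in 𝓝[Icc a b] a, x t ∈ Metric.ball y₀ (R / 2) :=
      (hxc a (left_mem_Icc.2 hab.le)).eventually (Metric.ball_mem_nhds _ (by positivity))
    rw [nhdsWithin_Icc_eq_nhdsGE hab] at h1
    obtain ⟨u, hu, hu'⟩ := mem_nhdsGE_iff_exists_Icc_subset.1 h1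
    exact ⟨min u b, lt_min hu hab, min_le_right _ _, fun t ht ↦
      hu' ⟨ht.1, ht.2.trans (min_le_left _ _)⟩⟩
  have hx' := hx.mono hab'.le le_rfl hb'b
  have hxc' := hx'.continuousOn hab'.le
  obtain ⟨M, hM⟩ : ∃ M, ∀ z ∈ Metric.ball y₀ (R / 2), m z ≤ M := by
    refine ⟨Real.exp (k * (‖ℓ‖ * (R / 2))), fun z hz ↦ Real.exp_le_exp.2 ?_⟩
    refine mul_le_mul_of_nonneg_left ?_ hk0
    refine (le_abs_self _).trans ((ℓ.le_opNorm _).trans ?_)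
    rw [mem_ball_iff_norm] at hz
    gcongr
  have hM0 : 0 ≤ M := (Real.exp_pos _).le.trans (hM y₀ (Metric.mem_ball_self (by positivity)))
  have hmy₀ : m y₀ = 1 := by simp [m]
  have hTy₀ := hTc.self_of_nhds.mem_self
  -- for small `η`, the perturbed curve starts in the open cone
  have hstart : ∀ᶠ η in 𝓝[>] (0 : ℝ), G 0 (Φ η y₀) (Φ η y₀) < 0 ∧ G 0 T₀ (Φ η y₀) < 0 := by
    have hΦy₀ : ∀ η, Φ η y₀ = y₀ + η • T := fun η ↦ by simp only [Φ, hmy₀, mul_one]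
    simp only [hΦy₀]
    -- At the vertex the timelike `T` itself points into the open cone. Elsewhere the Gauss lemma
    -- gives `G_0(y₀, T) = G_{y₀}(y₀, T) < 0`, so adding a small multiple of `T` lowers the form.
    rcases eq_or_ne y₀ 0 with hzero | hne
    · rw [hzero] at hTc hTy₀ ⊢
      have h1 := hTc.self_of_nhds.timelike
      have h2 := ((h0.mem_iff T).1 hTy₀).2.2
      filter_upwards [self_mem_nhdsWithin] with η hη
      have hη' : (0 : ℝ) < η := hη
      simp only [zero_add, map_smul, smul_apply, smul_eq_mul]
      exact ⟨mul_neg_of_pos_of_neg hη' (mul_neg_of_pos_of_neg hη' h1),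
        mul_neg_of_pos_of_neg hη' h2⟩
    · have h1 : y₀ ∈ F 0 := h0.mem_of_causal hca.1 hca.2 hne
      have h2 : y₀ ∈ F y₀ := by
        simpa using mem_future_radial hΩ hstar hG hgauss hF hxa h1 (s := 1) (by simp)
      have h3 : G 0 y₀ T < 0 := by
        rw [← hgauss _ hxa, hTc.self_of_nhds.symm]
        exact ((hTc.self_of_nhds.mem_iff _).1 h2).2.2
      have h4 : ∀ᶠ η in 𝓝[>] (0 : ℝ), 2 * G 0 y₀ T + η * G 0 T T < 0 := by
        have : ContinuousAt (fun η : ℝ ↦ 2 * G 0 y₀ T + η * G 0 T T) 0 := by fun_prop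
        exact (this.eventually (gt_mem_nhds (by simp; linarith))).filter_mono nhdsWithin_le_nhds
      have h5 : ∀ᶠ η in 𝓝[>] (0 : ℝ), G 0 T₀ (y₀ + η • T) < 0 := by
        have : ContinuousAt (fun η : ℝ ↦ G 0 T₀ (y₀ + η • T)) 0 := by fun_prop
        exact (this.eventually (gt_mem_nhds (by
          simpa using ((h0.mem_iff _).1 h1).2.2))).filter_mono nhdsWithin_le_nhds
      filter_upwards [h4, h5, self_mem_nhdsWithin] with η h6 h7 hη
      refine ⟨?_, h7⟩
      have hη' : (0 : ℝ) < η := hη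
      simp only [map_add, map_smul, add_apply, smul_apply, smul_eq_mul]
      rw [h0.symm T y₀]
      nlinarith [hca.1, mul_neg_of_pos_of_neg hη' h6]
  have hsmall : ∀ᶠ η in 𝓝[>] (0 : ℝ), η * (M * ‖T‖) < R / 2 := by
    have : ContinuousAt (fun η : ℝ ↦ η * (M * ‖T‖)) 0 := by fun_prop
    exact (this.eventually (gt_mem_nhds (by simpa using hR0))).filter_mono nhdsWithin_le_nhds
  -- the perturbed curve stays in the open cone
  have hstay : ∀ᶠ η in 𝓝[>] (0 : ℝ), ∀ t ∈ Icc a b',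
      G 0 (Φ η (x t)) (Φ η (x t)) < 0 ∧ G 0 T₀ (Φ η (x t)) < 0 := by
    filter_upwards [hstart, hsmall, self_mem_nhdsWithin] with η hη1 hη2 hη3
    have hη0 : (0 : ℝ) < η := hη3
    have hnorm : ∀ z, ‖(η * m z) • T‖ = η * m z * ‖T‖ := fun z ↦ by
      rw [norm_smul, Real.norm_of_nonneg (mul_nonneg hη0.le (Real.exp_pos _).le)]
    have hΦball : ∀ z ∈ Metric.ball y₀ (R / 2), Φ η z ∈ Metric.ball y₀ R := fun z hz ↦ by
      have h1 : ‖(η * m z) • T‖ < R / 2 := by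
        rw [hnorm, mul_assoc]
        refine lt_of_le_of_lt ?_ hη2
        exact mul_le_mul_of_nonneg_left (mul_le_mul_of_nonneg_right (hM z hz) hT0) hη0.le
      rw [mem_ball_iff_norm] at hz ⊢
      have h2 : Φ η z - y₀ = (z - y₀) + (η * m z) • T := by simp only [Φ]; abel
      rw [h2]
      exact (norm_add_le _ _).trans_lt (by linarith)
    have hΦc : ContinuousOn (fun t ↦ Φ η (x t)) (Icc a b') :=
      (hΦ η).continuous.comp_continuousOn hxc'
    by_contra! hbad
    let bad : Set ℝ := {t ∈ Icc a b' | ¬ (G 0 (Φ η (x t)) (Φ η (x t)) < 0 ∧ G 0 T₀ (Φ η (x t)) < 0)}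
    have hbadc : IsClosed bad := by
      have hO : IsOpen {z : E | G 0 z z < 0 ∧ G 0 T₀ z < 0} :=
        (isOpen_lt (f := fun z ↦ G 0 z z) (by fun_prop) continuous_const).inter
          (isOpen_lt (f := fun z ↦ G 0 T₀ z) (by fun_prop) continuous_const)
      exact hΦc.preimage_isClosed_of_isClosed isClosed_Icc hO.isClosed_compl
    have hbadne : bad.Nonempty := by
      obtain ⟨t, ht, ht'⟩ := hbad
      exact ⟨t, ht, fun h ↦ absurd h.2 (not_lt.2 (ht' h.1))⟩
    obtain ⟨t₁, ht₁, hmin⟩ := (isCompact_Icc.of_isClosed_subset hbadc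
      fun t ht ↦ ht.1).exists_isLeast hbadne
    have ht₁a : a < t₁ := by
      refine lt_of_le_of_ne ht₁.1.1 fun h ↦ ht₁.2 ?_
      rw [← h]; exact hη1
    have hgood : ∀ t ∈ Ico a t₁, G 0 (Φ η (x t)) (Φ η (x t)) < 0 ∧ G 0 T₀ (Φ η (x t)) < 0 := by
      intro t ht
      by_contra h
      exact absurd (hmin ⟨⟨ht.1, ht.2.le.trans ht₁.1.2⟩, h⟩) (not_le.2 ht.2)
    apply ht₁.2
    -- Up to the first exit time the position vector of the moved curve is future causal at its own
    -- point, and so is its moved velocity. By the Gauss lemma the derivative of `Q η` is twice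
    -- their product there, which is nonpositive.
    have hQle : Q η (x t₁) ≤ Q η (x a) := by
      refine (hx'.mono ht₁a.le le_rfl ht₁.1.2).le_of_fderiv_nonpos ht₁a.le (hQ η) fun t ht v hv ↦ ?_
      obtain ⟨hg1, hg2⟩ := hgood t ⟨ht.1.le, ht.2⟩
      have hxt := hnear t ⟨ht.1.le, ht.2.le.trans ht₁.1.2⟩
      have hyt := hΦball _ hxt
      have hxtR : x t ∈ Metric.ball y₀ R₁ :=
        Metric.ball_subset_ball (by linarith [min_le_left R₁ R₂]) hxt
      have hytR : Φ η (x t) ∈ Metric.ball y₀ R₁ := Metric.ball_subset_ball (min_le_left _ _) hyt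
      have hytΩ : Φ η (x t) ∈ Ω := hR₂Ω (Metric.ball_subset_ball (min_le_right _ _) hyt)
      rw [hQd, hΦd, ← hgauss _ hytΩ]
      obtain ⟨hcx, hpx⟩ := hpert _ hxtR _ hytR
      obtain ⟨hv0, hv1, hv2⟩ := (hcx.mem_iff v).1 hv
      have hℓv : c / 2 * ‖v‖ ≤ ℓ v :=
        ((hpert _ hxtR y₀ (Metric.mem_ball_self hR₁)).2 v hv1 hv2.le).1
      have hκ : C * ‖Φ η (x t) - x t‖ * ‖v‖ ≤ η * (m (x t) * k * ℓ v) := by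
        have h1 : Φ η (x t) - x t = (η * m (x t)) • T := by simp only [Φ]; abel
        rw [h1, hnorm]
        have h2 : C * ‖T‖ * ‖v‖ ≤ k * ℓ v := by
          rw [hk]
          calc C * ‖T‖ * ‖v‖ = 2 * C * ‖T‖ / c * (c / 2 * ‖v‖) := by field_simp
            _ ≤ 2 * C * ‖T‖ / c * ℓ v := by gcongr
        have h3 : 0 ≤ η * m (x t) := mul_nonneg hη0.le (Real.exp_pos _).le
        nlinarith [mul_le_mul_of_nonneg_left h2 h3]
      obtain ⟨hp1, hp2⟩ := (hpx v hv1 hv2.le).2 _ hκ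
      have hcy := (hpert _ hytR _ hytR).1
      have hyne : Φ η (x t) ≠ 0 := fun h ↦ by
        rw [h] at hg2
        simp at hg2
      have hyF0 : Φ η (x t) ∈ F 0 := (h0.mem_iff _).2 ⟨hyne, hg1.le, hg2⟩
      have hyF : Φ η (x t) ∈ F (Φ η (x t)) := by
        simpa using mem_future_radial hΩ hstar hG hgauss hF hytΩ hyF0 (s := 1) (by simp)
      obtain ⟨-, hy1, hy2⟩ := (hcy.mem_iff _).1 hyF
      have := hcy.nonpos hy1 hy2.le hp1 hp2
      linarith
    have h1 : G 0 (Φ η (x t₁)) (Φ η (x t₁)) < 0 := lt_of_le_of_lt hQle hη1.1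
    -- The limit only gives a weak inequality; strictness follows because the point is timelike,
    -- hence nonzero.
    have h2 : G 0 T₀ (Φ η (x t₁)) ≤ 0 := by
      have hcw : ContinuousWithinAt (fun t ↦ G 0 T₀ (Φ η (x t))) (Ico a t₁) t₁ := by
        have := (G 0 T₀).continuous.comp_continuousOn hΦc t₁ ht₁.1
        exact this.mono fun t ht ↦ ⟨ht.1, ht.2.le.trans ht₁.1.2⟩
      have : (𝓝[Ico a t₁] t₁).NeBot := by
        rw [← mem_closure_iff_nhdsWithin_neBot, closure_Ico ht₁a.ne]
        exact right_mem_Icc.2 ht₁a.le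
      refine le_of_tendsto hcw ?_
      filter_upwards [self_mem_nhdsWithin] with t ht using (hgood t ht).2.le
    refine ⟨h1, h0.neg_of_causal h1.le h2 fun h ↦ ?_⟩
    rw [h] at h1
    simp at h1
  have hlim : ∀ t ∈ Icc a b', G 0 (x t) (x t) ≤ 0 ∧ G 0 T₀ (x t) ≤ 0 := by
    intro t ht
    have hΦ0 : Φ 0 (x t) = x t := by simp [Φ]
    have hΦη : Continuous fun η ↦ Φ η (x t) := by fun_prop
    constructor
    · have h1 : Filter.Tendsto (fun η ↦ G 0 (Φ η (x t)) (Φ η (x t))) (𝓝[>] 0)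
          (𝓝 (G 0 (x t) (x t))) := by
        have : Continuous fun η ↦ G 0 (Φ η (x t)) (Φ η (x t)) := by fun_prop
        exact (this.tendsto' 0 _ (by rw [hΦ0])).mono_left nhdsWithin_le_nhds
      refine le_of_tendsto h1 ?_
      filter_upwards [hstay] with η hη using (hη t ht).1.le
    · have h1 : Filter.Tendsto (fun η ↦ G 0 T₀ (Φ η (x t))) (𝓝[>] 0) (𝓝 (G 0 T₀ (x t))) := by
        have : Continuous fun η ↦ G 0 T₀ (Φ η (x t)) := by fun_prop
        exact (this.tendsto' 0 _ (by rw [hΦ0])).mono_left nhdsWithin_le_nhds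
      refine le_of_tendsto h1 ?_
      filter_upwards [hstay] with η hη using (hη t ht).2.le
  filter_upwards [Ioo_mem_nhdsGT hab'] with t ht using hlim t ⟨ht.1.le, ht.2.le⟩

/-- A causal curve starting at the origin of normal coordinates ends in the future cone of the
origin. -/
theorem mem_future_of_causal_curve (hΩ : IsOpen Ω) (hstar : StarConvex ℝ 0 Ω)
    (hG : ContDiffOn ℝ ∞ G Ω) (hgauss : ∀ x ∈ Ω, ∀ w, G x x w = G 0 x w)
    (hF : ∀ y ∈ Ω, ∃ T c, ∀ᶠ z in 𝓝 y, IsFutureCone (G z) T c (F z)) {x : ℝ → E} {a b : ℝ}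
    (hab : a < b) (hxc : ContinuousOn x (Icc a b)) (hxΩ : ∀ t ∈ Icc a b, x t ∈ Ω) (hxa : x a = 0)
    (hx : ∀ t ∈ Icc a b, ∃ a' b', a' < b' ∧ Icc a' b' ⊆ Icc a b ∧ Icc a' b' ∈ 𝓝[Icc a b] t ∧
      IsACCausalOn F x a' b') : x b ∈ F 0 := by
  have h0Ω : (0 : E) ∈ Ω := by rw [← hxa]; exact hxΩ a (left_mem_Icc.2 hab.le)
  obtain ⟨T₀, c₀, hT₀⟩ := hF 0 h0Ω
  have h0 := hT₀.self_of_nhds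
  set s : Set ℝ := {t | G 0 (x t) (x t) ≤ 0 ∧ G 0 T₀ (x t) ≤ 0} with hs
  have hclosed : IsClosed (s ∩ Icc a b) := by
    have hC : IsClosed {z : E | G 0 z z ≤ 0 ∧ G 0 T₀ z ≤ 0} :=
      (isClosed_le (f := fun z ↦ G 0 z z) (by fun_prop) continuous_const).inter
        (isClosed_le (f := fun z ↦ G 0 T₀ z) (by fun_prop) continuous_const)
    have := hxc.preimage_isClosed_of_isClosed isClosed_Icc hC
    rwa [inter_comm] at this
  have hsub : Icc a b ⊆ s := by
    -- Continuation along the interval: the condition is closed and extends a little to the right of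
    -- any point where it holds.
    refine hclosed.Icc_subset_of_forall_mem_nhdsWithin (by simp [hs, hxa]) fun t ht ↦ ?_
    have htab := Ico_subset_Icc_self ht.2
    obtain ⟨a', b', hab', hsub', hnhds, hac⟩ := hx t htab
    have htmem : t ∈ Icc a' b' := mem_of_mem_nhdsWithin htab hnhds
    have htb : t < b' := by
      by_contra! hle
      obtain rfl : t = b' := le_antisymm htmem.2 hle
      have h1 : Icc a' t ∈ 𝓝[≥] t := by
        have : 𝓝[≥] t = 𝓝[Icc t b] t := (nhdsWithin_Icc_eq_nhdsGE ht.2.2).symm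
        rw [this]
        exact nhdsWithin_mono t (Icc_subset_Icc_left htab.1) hnhds
      obtain ⟨u, hu, hu'⟩ := (mem_nhdsGE_iff_exists_Icc_subset).1 h1
      exact absurd (hu' ⟨le_of_lt hu, le_rfl⟩).2 (not_le.2 hu)
    exact eventually_mem_closedCone hΩ hstar hG hgauss hF h0 htb
      (hac.mono htb.le htmem.1 le_rfl) (hxΩ t htab) ht.1
  have hb := hsub (right_mem_Icc.2 hab.le)
  refine h0.mem_of_causal hb.1 hb.2 fun hxb ↦ ?_
  obtain ⟨a', b', hab', hsub', hnhds, hac⟩ := hx b (right_mem_Icc.2 hab.le)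
  have hb'b : b' = b := le_antisymm (hsub' (right_mem_Icc.2 hab'.le)).2
    (mem_of_mem_nhdsWithin (right_mem_Icc.2 hab.le) hnhds).2
  subst hb'b
  have ha'a : a ≤ a' := (hsub' (left_mem_Icc.2 hab'.le)).1
  obtain ⟨d, hd, hdcone⟩ : ∃ d, (a' ≤ d ∧ d < b') ∧
      ∀ t ∈ Icc d b', IsFutureCone (G (x t)) T₀ c₀ (F (x t)) ∧
        ∀ v ∈ F (x t), G 0 T₀ v < 0 := by
    have hpertR := exists_causal_perturbation
      ((hG.contDiffAt (hΩ.mem_nhds h0Ω)).of_le (by simp)) hT₀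
    obtain ⟨C, hC, R, hR, hpert⟩ := hpertR
    have h1 : ∀ᶠ t in 𝓝[Icc a' b'] b', x t ∈ Metric.ball (0 : E) R :=
      ((hxc b' (right_mem_Icc.2 hab.le)).mono hsub').eventually (by
        rw [hxb]; exact Metric.ball_mem_nhds _ hR)
    rw [nhdsWithin_Icc_eq_nhdsLE hab'] at h1
    obtain ⟨u, hu, hu'⟩ := mem_nhdsLE_iff_exists_Icc_subset.1 h1
    refine ⟨max u a', ⟨le_max_right _ _, max_lt hu hab'⟩, fun t ht ↦ ?_⟩
    have hball := hu' ⟨(le_max_left _ _).trans ht.1, ht.2⟩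
    obtain ⟨h2, h3⟩ := hpert _ hball 0 (Metric.mem_ball_self hR)
    refine ⟨h2, fun v hv ↦ ?_⟩
    obtain ⟨hv0, hv1, hv2⟩ := (h2.mem_iff v).1 hv
    have h4 := (h3 v hv1 hv2.le).1
    have h5 : 0 < c₀ / 2 * ‖v‖ := mul_pos (half_pos h2.pos) (norm_pos_iff.2 hv0)
    linarith
  have hacd := hac.mono hd.2.le hd.1 le_rfl
  -- To exclude a return to the origin: near the end the time component is nonincreasing and
  -- nonpositive, and it would end at zero, so it would vanish on `[d, b']`. That contradicts its
  -- negative derivative at a point of differentiability.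
  have hzero : ∀ t ∈ Icc d b', G 0 T₀ (x t) = 0 := fun t ht ↦ by
    have h1 := (hacd.mono ht.2 ht.1 le_rfl).le_of_fderiv_nonpos ht.2 (f := fun z ↦ G 0 T₀ z)
      (G 0 T₀).contDiff (fun r hr v hv ↦ by
        have : fderiv ℝ (fun z ↦ G 0 T₀ z) (x r) = G 0 T₀ := (G 0 T₀).fderiv
        rw [this]
        exact ((hdcone r ⟨ht.1.trans hr.1.le, hr.2.le⟩).2 v hv).le)
    rw [hxb, map_zero] at h1
    exact le_antisymm (hsub ⟨ha'a.trans (hd.1.trans ht.1), ht.2⟩).2 h1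
  have hpos : volume (Ioo d b') ≠ 0 := by simp [hd.2]
  obtain ⟨t, ht, ht'⟩ : ∃ t ∈ Ioo d b', ∃ v ∈ F (x t), HasDerivAt x v t := by
    by_contra! hno
    refine hpos (measure_mono_null (fun t ht ↦ ?_) hacd.2)
    simp only [mem_compl_iff, mem_ofPred_eq, not_forall]
    exact ⟨ht, fun ⟨v, hv, hd⟩ ↦ hno t ht v hv hd⟩
  obtain ⟨v, hv, hdv⟩ := ht'
  have h1 : HasDerivAt (fun r ↦ G 0 T₀ (x r)) (G 0 T₀ v) t :=
    (G 0 T₀).hasFDerivAt.comp_hasDerivAt t hdv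
  have h2 : HasDerivAt (fun r ↦ G 0 T₀ (x r)) 0 t := by
    refine (hasDerivAt_const t (0 : ℝ)).congr_of_eventuallyEq ?_
    filter_upwards [Ioo_mem_nhds ht.1 ht.2] with r hr using hzero r ⟨hr.1.le, hr.2.le⟩
  exact absurd (h1.unique h2) ((hdcone t ⟨ht.1.le, ht.2.le⟩).2 v hv).ne

end Propagation

/-! ### Pulling back tensors by smooth parametrizations. -/

section Parametrizations

universe u
variable {E : Type u} [NormedAddCommGroup E] [NormedSpace ℝ E]
  {M : Type*} [TopologicalSpace M] [ChartedSpace E M] [IsManifold 𝓘(ℝ, E) ∞ M]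

/-- The pullback of a field of bilinear forms on a manifold by a map from the model space. -/
noncomputable def pullForm
    (B : (x : M) → TangentSpace 𝓘(ℝ, E) x →L[ℝ] TangentSpace 𝓘(ℝ, E) x →L[ℝ] ℝ) (ψ : E → M)
    (y : E) : E →L[ℝ] E →L[ℝ] ℝ :=
  let B' : E →L[ℝ] E →L[ℝ] ℝ := B (ψ y)
  let D : E →L[ℝ] E := mfderiv 𝓘(ℝ, E) 𝓘(ℝ, E) ψ y
  B'.bilinearComp D D

/-- Smooth parametrizations of open subsets of a manifold by open subsets of its model space. -/
structure IsSmoothParametrization (ψ : OpenPartialHomeomorph E M) : Prop where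
  smooth : ContMDiffOn 𝓘(ℝ, E) 𝓘(ℝ, E) ∞ ψ ψ.source
  symm_smooth : ContMDiffOn 𝓘(ℝ, E) 𝓘(ℝ, E) ∞ ψ.symm ψ.target

theorem isSmoothParametrization_chart (x₀ : M) :
    IsSmoothParametrization (E := E) (chartAt E x₀).symm := by
  refine ⟨?_, ?_⟩
  · exact contMDiffOn_chart_symm
  · exact contMDiffOn_chart

theorem contMDiffOn_pullVector {ψ : E → M} {s : Set E} (hs : IsOpen s)
    (hψ : ContMDiffOn 𝓘(ℝ, E) 𝓘(ℝ, E) ∞ ψ s) (u : E) :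
    ContMDiffOn 𝓘(ℝ, E) (𝓘(ℝ, E).prod 𝓘(ℝ, E)) ∞
      (fun z ↦ (⟨ψ z, mfderiv 𝓘(ℝ, E) 𝓘(ℝ, E) ψ z u⟩ : TangentBundle 𝓘(ℝ, E) M)) s := by
  have : IsManifold 𝓘(ℝ, E) 1 M := IsManifold.of_le (n := ∞) (by simp)
  have h1 : ContMDiff 𝓘(ℝ, E) (𝓘(ℝ, E).prod 𝓘(ℝ, E)) ∞
      (fun z : E ↦ (⟨z, u⟩ : TangentBundle 𝓘(ℝ, E) E)) :=
    contMDiff_vectorSpace_iff_contDiff.2 contDiff_const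
  have h2 := (hψ.contMDiffOn_tangentMapWithin (m := ∞) (by simp) hs.uniqueMDiffOn).comp
    h1.contMDiffOn (s := s) fun z hz ↦ hz
  refine h2.congr fun z hz ↦ ?_
  simp only [Function.comp, tangentMapWithin, mfderivWithin_of_isOpen hs hz]

theorem contDiffOn_pullForm [FiniteDimensional ℝ E]
    {B : (x : M) → TangentSpace 𝓘(ℝ, E) x →L[ℝ] TangentSpace 𝓘(ℝ, E) x →L[ℝ] ℝ}
    (hB : ContMDiff 𝓘(ℝ, E) (𝓘(ℝ, E).prod 𝓘(ℝ, E →L[ℝ] E →L[ℝ] ℝ)) ∞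
      (fun x ↦ Bundle.TotalSpace.mk' (E →L[ℝ] E →L[ℝ] ℝ)
        (E := fun x : M ↦ TangentSpace 𝓘(ℝ, E) x →L[ℝ] TangentSpace 𝓘(ℝ, E) x →L[ℝ] ℝ) x (B x)))
    {ψ : E → M} {s : Set E} (hs : IsOpen s) (hψ : ContMDiffOn 𝓘(ℝ, E) 𝓘(ℝ, E) ∞ ψ s) :
    ContDiffOn ℝ ∞ (pullForm B ψ) s := by
  rw [contDiffOn_clm_apply]
  intro u
  rw [contDiffOn_clm_apply]
  intro w
  rw [← contMDiffOn_iff_contDiffOn]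
  have h1 : ContMDiffOn 𝓘(ℝ, E) (𝓘(ℝ, E).prod 𝓘(ℝ)) ∞
      (fun z ↦ Bundle.TotalSpace.mk' ℝ (E := Bundle.Trivial M ℝ) (ψ z)
        (B (ψ z) (mfderiv 𝓘(ℝ, E) 𝓘(ℝ, E) ψ z u) (mfderiv 𝓘(ℝ, E) 𝓘(ℝ, E) ψ z w))) s := by
    apply ContMDiffOn.clm_bundle_apply₂ (F₁ := E) (F₂ := E)
    · exact hB.comp_contMDiffOn hψ
    · exact contMDiffOn_pullVector hs hψ u
    · exact contMDiffOn_pullVector hs hψ w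
  intro z hz
  have h2 := h1 z hz
  simp only [Bundle.contMDiffWithinAt_totalSpace] at h2
  exact h2.2

theorem mfderiv_comp_param {ψ₁ ψ₂ : E → M} {φ : E → E} {y : E} (h : ψ₁ =ᶠ[𝓝 y] ψ₂ ∘ φ)
    (hφ : DifferentiableAt ℝ φ y) (hψ₂ : MDifferentiableAt 𝓘(ℝ, E) 𝓘(ℝ, E) ψ₂ (φ y)) (u : E) :
    (mfderiv 𝓘(ℝ, E) 𝓘(ℝ, E) ψ₁ y u : E) = mfderiv 𝓘(ℝ, E) 𝓘(ℝ, E) ψ₂ (φ y) (fderiv ℝ φ y u) := by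
  rw [h.mfderiv_eq, mfderiv_comp y hψ₂ hφ.mdifferentiableAt, mfderiv_eq_fderiv]
  rfl

theorem pullForm_comp (B : (x : M) → TangentSpace 𝓘(ℝ, E) x →L[ℝ] TangentSpace 𝓘(ℝ, E) x →L[ℝ] ℝ)
    {ψ₁ ψ₂ : E → M} {φ : E → E} {y : E} (h : ψ₁ =ᶠ[𝓝 y] ψ₂ ∘ φ) (hφ : DifferentiableAt ℝ φ y)
    (hψ₂ : MDifferentiableAt 𝓘(ℝ, E) 𝓘(ℝ, E) ψ₂ (φ y)) (u w : E) :
    pullForm B ψ₁ y u w = pullForm B ψ₂ (φ y) (fderiv ℝ φ y u) (fderiv ℝ φ y w) := by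
  have h0 : ψ₁ y = ψ₂ (φ y) := h.eq_of_nhds
  have h1 := mfderiv_comp_param h hφ hψ₂ u
  have h2 := mfderiv_comp_param h hφ hψ₂ w
  change (B (ψ₁ y) : E →L[ℝ] E →L[ℝ] ℝ) (mfderiv 𝓘(ℝ, E) 𝓘(ℝ, E) ψ₁ y u : E)
    (mfderiv 𝓘(ℝ, E) 𝓘(ℝ, E) ψ₁ y w : E) = _
  rw [h1, h2, h0]
  rfl

end Parametrizations

/-! ### Metric and time-orientation in a parametrization. -/

section ConeField

universe u
variable {E : Type u} [NormedAddCommGroup E] [NormedSpace ℝ E]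
  {M : Type*} [TopologicalSpace M] [ChartedSpace E M] [IsManifold 𝓘(ℝ, E) ∞ M]

namespace IsSmoothParametrization

variable {ψ ψ₁ ψ₂ : OpenPartialHomeomorph E M}

theorem mdifferentiable (h : IsSmoothParametrization ψ) :
    ψ.MDifferentiable 𝓘(ℝ, E) 𝓘(ℝ, E) :=
  ⟨h.smooth.mdifferentiableOn (by simp), h.symm_smooth.mdifferentiableOn (by simp)⟩

/-- The derivative of a parametrization, as a linear equivalence of model spaces. -/
theorem exists_equiv [FiniteDimensional ℝ E] (h : IsSmoothParametrization ψ) {y : E}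
    (hy : y ∈ ψ.source) : ∃ L : E ≃L[ℝ] E, ∀ u : E, L u = (mfderiv 𝓘(ℝ, E) 𝓘(ℝ, E) ψ y u : E) := by
  have h1 : Function.Bijective (mfderiv 𝓘(ℝ, E) 𝓘(ℝ, E) ψ y) := h.mdifferentiable.mfderiv_bijective hy
  let D : E →L[ℝ] E := mfderiv 𝓘(ℝ, E) 𝓘(ℝ, E) ψ y
  exact ⟨(LinearEquiv.ofBijective (D : E →ₗ[ℝ] E) h1).toContinuousLinearEquiv, fun u ↦ rfl⟩

theorem mfderiv_ne_zero (h : IsSmoothParametrization ψ) {y : E} (hy : y ∈ ψ.source) {u : E} :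
    mfderiv 𝓘(ℝ, E) 𝓘(ℝ, E) ψ y u ≠ 0 ↔ u ≠ 0 := by
  refine not_congr ⟨fun h0 ↦ ?_, fun h0 ↦ ?_⟩
  · exact h.mdifferentiable.mfderiv_injective hy (h0.trans (map_zero _).symm)
  · rw [h0]; exact map_zero _

theorem contDiffAt_transition (h₁ : IsSmoothParametrization ψ₁) (h₂ : IsSmoothParametrization ψ₂)
    {y : E} (hy : y ∈ ψ₁.source) (hy₂ : ψ₁ y ∈ ψ₂.target) :
    ContDiffAt ℝ ∞ (fun z ↦ ψ₂.symm (ψ₁ z)) y := by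
  rw [← contMDiffAt_iff_contDiffAt]
  exact (h₂.symm_smooth.contMDiffAt (ψ₂.open_target.mem_nhds hy₂)).comp y
    (h₁.smooth.contMDiffAt (ψ₁.open_source.mem_nhds hy))

theorem eventually_eq_transition {y : E} (hy : y ∈ ψ₁.source) (hy₂ : ψ₁ y ∈ ψ₂.target) :
    ψ₁ =ᶠ[𝓝 y] ψ₂ ∘ fun z ↦ ψ₂.symm (ψ₁ z) := by
  filter_upwards [(ψ₁.continuousAt hy).eventually (ψ₂.open_target.mem_nhds hy₂)] with z hz
  exact (ψ₂.right_inv hz).symm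

theorem pullForm_transition (h₁ : IsSmoothParametrization ψ₁) (h₂ : IsSmoothParametrization ψ₂)
    (B : (x : M) → TangentSpace 𝓘(ℝ, E) x →L[ℝ] TangentSpace 𝓘(ℝ, E) x →L[ℝ] ℝ)
    {y : E} (hy : y ∈ ψ₁.source) (hy₂ : ψ₁ y ∈ ψ₂.target) (u w : E) :
    pullForm B ψ₁ y u w = pullForm B ψ₂ (ψ₂.symm (ψ₁ y))
      (fderiv ℝ (fun z ↦ ψ₂.symm (ψ₁ z)) y u) (fderiv ℝ (fun z ↦ ψ₂.symm (ψ₁ z)) y w) :=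
  pullForm_comp B (eventually_eq_transition hy hy₂)
    ((h₁.contDiffAt_transition h₂ hy hy₂).differentiableAt (by simp))
    (h₂.mdifferentiable.mdifferentiableAt (ψ₂.map_target hy₂)) u w

end IsSmoothParametrization

namespace LorentzianMetric

theorem pullForm_symm (g : LorentzianMetric E M) (ψ : E → M) (y u w : E) :
    pullForm g.val ψ y u w = pullForm g.val ψ y w u :=
  g.symm (ψ y) (mfderiv 𝓘(ℝ, E) 𝓘(ℝ, E) ψ y u) (mfderiv 𝓘(ℝ, E) 𝓘(ℝ, E) ψ y w)

theorem pullForm_index_one [FiniteDimensional ℝ E] (g : LorentzianMetric E M)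
    {ψ : OpenPartialHomeomorph E M} (hψ : IsSmoothParametrization ψ) {y : E} (hy : y ∈ ψ.source) :
    ∃ v, pullForm g.val ψ y v v < 0 ∧
      ∀ w, pullForm g.val ψ y v w = 0 → w ≠ 0 → 0 < pullForm g.val ψ y w w := by
  obtain ⟨v, hv, hvw⟩ := g.index_one (ψ y)
  obtain ⟨u, hu⟩ := hψ.mdifferentiable.mfderiv_surjective hy v
  refine ⟨u, ?_, fun w hw hw0 ↦ ?_⟩
  · have : g.val (ψ y) (mfderiv 𝓘(ℝ, E) 𝓘(ℝ, E) ψ y u) (mfderiv 𝓘(ℝ, E) 𝓘(ℝ, E) ψ y u) < 0 := by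
      rw [hu]; exact hv
    exact this
  · have h1 : g.val (ψ y) (mfderiv 𝓘(ℝ, E) 𝓘(ℝ, E) ψ y u) (mfderiv 𝓘(ℝ, E) 𝓘(ℝ, E) ψ y w) = 0 := hw
    rw [hu] at h1
    exact hvw _ h1 ((hψ.mfderiv_ne_zero hy).2 hw0)

theorem pullForm_nondegenerate [FiniteDimensional ℝ E] (g : LorentzianMetric E M)
    {ψ : OpenPartialHomeomorph E M} (hψ : IsSmoothParametrization ψ) {y : E} (hy : y ∈ ψ.source)
    {v : E} (hv : ∀ w, pullForm g.val ψ y v w = 0) : v = 0 := by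
  obtain ⟨T, hT, hTw⟩ := g.pullForm_index_one hψ hy
  by_contra h0
  have h1 := hTw v ((g.pullForm_symm _ _ _ _).trans (hv T)) h0
  rw [hv v] at h1
  exact lt_irrefl _ h1

variable {g : LorentzianMetric E M}

/-- The cones of a time-orientation, read in a parametrization. -/
def TimeOrientation.coneField (τ : g.TimeOrientation) (ψ : E → M) (y : E) : Set E :=
  {v | (mfderiv 𝓘(ℝ, E) 𝓘(ℝ, E) ψ y v : TangentSpace 𝓘(ℝ, E) (ψ y)) ∈ τ.future (ψ y)}

theorem TimeOrientation.ne_zero_of_mem (τ : g.TimeOrientation) {x : M} {v : TangentSpace 𝓘(ℝ, E) x}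
    (hv : v ∈ τ.future x) : v ≠ 0 := by
  obtain ⟨U, -, hxU, X, -, hX⟩ := τ.continuous_choice x
  rw [(hX x hxU).2] at hv
  rintro rfl
  have : g.val x (X x) 0 < 0 := hv.2
  rw [map_zero] at this
  exact lt_irrefl _ this

/-- The orienting field `X` is only continuous, so its covector `g(X, ·)` is pulled back to a
continuous `θ`, and `X` is then replaced by the constant vector `T` that represents it at `y₀`. -/
theorem TimeOrientation.exists_isFutureCone [FiniteDimensional ℝ E] (τ : g.TimeOrientation)
    {ψ : OpenPartialHomeomorph E M} (hψ : IsSmoothParametrization ψ) {y₀ : E}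
    (hy₀ : y₀ ∈ ψ.source) :
    ∃ T c, ∀ᶠ y in 𝓝 y₀, IsFutureCone (pullForm g.val ψ y) T c (τ.coneField ψ y) := by
  obtain ⟨U, hU, hxU, X, hXc, hX⟩ := τ.continuous_choice (ψ y₀)
  have hA : ContDiffOn ℝ ∞ (pullForm g.val ψ) ψ.source :=
    contDiffOn_pullForm g.contMDiff ψ.open_source hψ.smooth
  set V := ψ.source ∩ ψ ⁻¹' U with hV
  have hVo : IsOpen V := ψ.continuousOn.isOpen_inter_preimage ψ.open_source hU
  have hyV : y₀ ∈ V := ⟨hy₀, hxU⟩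
  let D : E → E →L[ℝ] E := fun y ↦ mfderiv 𝓘(ℝ, E) 𝓘(ℝ, E) ψ y
  let θ : E → E →L[ℝ] ℝ := fun y ↦
    (show E →L[ℝ] ℝ from (show E →L[ℝ] E →L[ℝ] ℝ from g.val (ψ y)) (X (ψ y))).comp (D y)
  have hθ : ContinuousOn θ V := by
    rw [continuousOn_clm_apply]
    intro w
    have h1 : ContMDiffOn 𝓘(ℝ, E) (𝓘(ℝ, E).prod 𝓘(ℝ)) 0
        (fun z ↦ Bundle.TotalSpace.mk' ℝ (E := Bundle.Trivial M ℝ) (ψ z)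
          (g.val (ψ z) (X (ψ z)) (mfderiv 𝓘(ℝ, E) 𝓘(ℝ, E) ψ z w))) V := by
      have : IsManifold 𝓘(ℝ, E) 1 M := IsManifold.of_le (n := ∞) (by simp)
      apply ContMDiffOn.clm_bundle_apply₂ (F₁ := E) (F₂ := E)
      · exact (g.contMDiff.comp_contMDiffOn (hψ.smooth.mono fun z hz ↦ hz.1)).of_le (by simp)
      · rw [contMDiffOn_zero_iff]
        exact hXc.comp (ψ.continuousOn.mono fun z hz ↦ hz.1) fun z hz ↦ hz.2
      · exact ((contMDiffOn_pullVector ψ.open_source hψ.smooth w).mono fun z hz ↦ hz.1).of_le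
          (by simp)
    have h2 : ContMDiffOn 𝓘(ℝ, E) 𝓘(ℝ) 0 (fun z ↦ θ z w) V := fun z hz ↦ by
      have h3 := h1 z hz
      simp only [Bundle.contMDiffWithinAt_totalSpace] at h3
      exact h3.2
    exact h2.continuousOn
  obtain ⟨T, hT⟩ := hψ.mdifferentiable.mfderiv_surjective hy₀ (X (ψ y₀))
  have hT' : (mfderiv 𝓘(ℝ, E) 𝓘(ℝ, E) ψ y₀ T : E) = X (ψ y₀) := hT
  obtain ⟨c, hc⟩ := eventually_isFutureCone (F := τ.coneField ψ) (T := T)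
    (hA.continuousOn.continuousAt (ψ.open_source.mem_nhds hy₀))
    (Filter.Eventually.of_forall fun y ↦ g.pullForm_symm ψ y) (g.pullForm_index_one hψ hy₀)
    (by
      have : g.val (ψ y₀) (X (ψ y₀)) (X (ψ y₀)) < 0 := (hX _ hxU).1
      rw [← hT] at this
      exact this)
    (hθ.continuousAt (hVo.mem_nhds hyV))
    (by
      ext w
      change (g.val (ψ y₀)) (X (ψ y₀)) (mfderiv 𝓘(ℝ, E) 𝓘(ℝ, E) ψ y₀ w) = _
      rw [← hT]
      rfl)
    (by
      filter_upwards [hVo.mem_nhds hyV] with y hy v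
      have h1 : v ∈ τ.coneField ψ y ↔
        (mfderiv 𝓘(ℝ, E) 𝓘(ℝ, E) ψ y v : TangentSpace 𝓘(ℝ, E) (ψ y)) ∈ τ.future (ψ y) := Iff.rfl
      rw [h1, (hX _ hy.2).2]
      change (_ ∨ (_ ∧ mfderiv 𝓘(ℝ, E) 𝓘(ℝ, E) ψ y v ≠ 0)) ∧ _ ↔ _
      rw [hψ.mfderiv_ne_zero hy.1]
      rfl)
  exact ⟨T, c, hc⟩

end LorentzianMetric

end ConeField

/-! ### Convex neighbourhoods on the manifold. -/

section Geodesics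

universe u
variable {E : Type u} [NormedAddCommGroup E] [NormedSpace ℝ E] [FiniteDimensional ℝ E]
  {M : Type*} [TopologicalSpace M] [ChartedSpace E M] [IsManifold 𝓘(ℝ, E) ∞ M]

theorem velocity_eq_of_hasDerivAt {ψ : E → M} {ξ : ℝ → E} {γ : ℝ → M} {t : ℝ} {v : E}
    (h : γ =ᶠ[𝓝 t] fun s ↦ ψ (ξ s)) (hψ : MDifferentiableAt 𝓘(ℝ, E) 𝓘(ℝ, E) ψ (ξ t))
    (hξ : HasDerivAt ξ v t) :
    (velocity E γ t : E) = mfderiv 𝓘(ℝ, E) 𝓘(ℝ, E) ψ (ξ t) v := by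
  have h1 : mfderiv 𝓘(ℝ, ℝ) 𝓘(ℝ, E) γ t = mfderiv 𝓘(ℝ, ℝ) 𝓘(ℝ, E) (ψ ∘ ξ) t := h.mfderiv_eq
  have h2 := mfderiv_comp t hψ hξ.differentiableAt.mdifferentiableAt
  rw [mfderiv_eq_fderiv] at h2
  change (mfderiv 𝓘(ℝ, ℝ) 𝓘(ℝ, E) γ t : ℝ →L[ℝ] E) (1 : ℝ) = _
  rw [h1, h2, ← hξ.deriv, ← fderiv_apply_one_eq_deriv]
  rfl

/-- All tangent spaces are definitionally `E`, so a vector can be changed together with its base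
point, where rewriting the base point alone would be ill-typed. -/
theorem tangentBundle_mk_eq {x x' : M} {v w : E} (h : x = x') (h' : v = w) :
    (⟨x, v⟩ : TangentBundle 𝓘(ℝ, E) M) = ⟨x', w⟩ := by
  subst h h'; rfl

namespace IsSmoothParametrization

variable {ψ ψ₁ ψ₂ : OpenPartialHomeomorph E M}

theorem fderiv_transition_surjective (h₁ : IsSmoothParametrization ψ₁)
    (h₂ : IsSmoothParametrization ψ₂) {y : E} (hy : y ∈ ψ₁.source) (hy₂ : ψ₁ y ∈ ψ₂.target) :
    Function.Surjective (fderiv ℝ (fun z ↦ ψ₂.symm (ψ₁ z)) y) := by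
  intro w
  obtain ⟨L₁, hL₁⟩ := h₁.exists_equiv hy
  obtain ⟨L₂, hL₂⟩ := h₂.exists_equiv (ψ₂.map_target hy₂)
  refine ⟨L₁.symm (L₂ w), L₂.injective ?_⟩
  rw [hL₂, ← mfderiv_comp_param (eventually_eq_transition hy hy₂)
    ((h₁.contDiffAt_transition h₂ hy hy₂).differentiableAt (by simp))
    (h₂.mdifferentiable.mdifferentiableAt (ψ₂.map_target hy₂)), ← hL₁, L₁.apply_symm_apply]

/-- The geodesic equation does not depend on the parametrization. -/
theorem eulerLagrange_transition (g : LorentzianMetric E M) (h₁ : IsSmoothParametrization ψ₁)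
    (h₂ : IsSmoothParametrization ψ₂) {ξ : ℝ → E} {t : ℝ} (hξ : ContDiffAt ℝ ∞ ξ t)
    (hy : ξ t ∈ ψ₁.source) (hy₂ : ψ₁ (ξ t) ∈ ψ₂.target) :
    (∀ w, eulerLagrange (pullForm g.val ψ₂) (fun s ↦ ψ₂.symm (ψ₁ (ξ s))) t w = 0) ↔
      ∀ w, eulerLagrange (pullForm g.val ψ₁) ξ t w = 0 := by
  have key := eulerLagrange_comp (A₁ := pullForm g.val ψ₁) (A₂ := pullForm g.val ψ₂) hξ
    (h₁.contDiffAt_transition h₂ hy hy₂)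
    (((contDiffOn_pullForm g.contMDiff ψ₂.open_source h₂.smooth).contDiffAt
      (ψ₂.open_source.mem_nhds (ψ₂.map_target hy₂))).differentiableAt (by simp))
    (fun u w ↦ g.pullForm_symm ψ₂ _ u w)
    (by
      filter_upwards [ψ₁.open_source.mem_nhds hy,
        (ψ₁.continuousAt hy).eventually (ψ₂.open_target.mem_nhds hy₂)] with x hx hx₂ u w
      exact h₁.pullForm_transition h₂ g.val hx hx₂ u w)
  refine ⟨fun h w ↦ by rw [← key]; exact h _, fun h w ↦ ?_⟩
  obtain ⟨u, rfl⟩ := h₁.fderiv_transition_surjective h₂ hy hy₂ w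
  rw [key]; exact h u

end IsSmoothParametrization

/-- Whitehead's theorem: every point has arbitrarily small convex neighbourhoods. -/
theorem LorentzianMetric.exists_isConvexNhd (g : LorentzianMetric E M) (p : M) {W : Set M}
    (hW : W ∈ 𝓝 p) : ∃ U ⊆ W, p ∈ U ∧ g.IsConvexNhd U := by
  set ψ : OpenPartialHomeomorph E M := (chartAt E p).symm with hψdef
  have hψ : IsSmoothParametrization ψ := isSmoothParametrization_chart p
  set x₀ : E := ψ.symm p with hx₀def
  have hpt : p ∈ ψ.target := mem_chart_source E p
  have hx₀ : x₀ ∈ ψ.source := ψ.map_target hpt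
  have hψx₀ : ψ x₀ = p := ψ.right_inv hpt
  have hA : ContDiffOn ℝ ∞ (pullForm g.val ψ) ψ.source :=
    contDiffOn_pullForm g.contMDiff ψ.open_source hψ.smooth
  obtain ⟨S, hS, hom, hspray⟩ := exists_spray ψ.open_source hA
    (fun y hy v hv ↦ g.pullForm_nondegenerate hψ hy hv) hx₀
  obtain ⟨U, hUW, hUo, hx₀U, hU⟩ := exists_local_convex hS hom x₀
    (W := {y | ∀ v w, pullForm g.val ψ y (S (y, v)) w + fderiv ℝ (pullForm g.val ψ) y v v w
        - (1 / 2) * fderiv ℝ (pullForm g.val ψ) y w v v = 0} ∩ (ψ.source ∩ ψ ⁻¹' W))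
    (Filter.inter_mem hspray (Filter.inter_mem (ψ.open_source.mem_nhds hx₀)
      ((ψ.continuousAt hx₀) (by rwa [hψx₀]))))
  have hUs : U ⊆ ψ.source := fun y hy ↦ (hUW hy).2.1
  refine ⟨ψ '' U, ?_, ⟨x₀, hx₀U, hψx₀⟩, ψ.isOpen_image_of_subset_source hUo hUs, ?_⟩
  · rintro _ ⟨y, hy, rfl⟩
    exact (hUW hy).2.2
  rintro _ ⟨y, hy, rfl⟩
  obtain ⟨e', he't, he'0, he'star, he'sm, he'symm, he'y, he'd, he'geo⟩ := hU y hy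
  -- Vectors at `ψ y` are read in the preferred chart at `ψ y`, not in `ψ`. Precomposing with `L⁻¹`
  -- gives the rays the prescribed initial velocity.
  obtain ⟨L, hL⟩ := hψ.exists_equiv (hUs hy)
  let e : OpenPartialHomeomorph E M :=
    (L.symm.toHomeomorph.toOpenPartialHomeomorph.trans e').trans ψ
  have hes : e.source = L.symm ⁻¹' e'.source := by
    ext v
    simp only [e, OpenPartialHomeomorph.trans_source, OpenPartialHomeomorph.coe_trans,
      mem_inter_iff, mem_preimage, Homeomorph.toOpenPartialHomeomorph_source, mem_univ, true_and,
      Homeomorph.toOpenPartialHomeomorph_apply, Function.comp_apply]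
    refine ⟨fun h ↦ h.1, fun h ↦ ⟨h, hUs ?_⟩⟩
    rw [← he't]
    exact e'.map_source h
  have hev : ∀ v, e v = ψ (e' (L.symm v)) := fun v ↦ rfl
  have het : e.target = ψ '' U := by
    rw [← e.image_source_eq_target, hes, ← he't, ← e'.image_source_eq_target, ← image_comp]
    ext z
    constructor
    · rintro ⟨v, hv, rfl⟩
      exact ⟨L.symm v, hv, rfl⟩
    · rintro ⟨v, hv, rfl⟩
      exact ⟨L v, by simpa using hv, by simp [hev]⟩
  have he'U : ∀ v ∈ e'.source, e' v ∈ U := fun v hv ↦ he't ▸ e'.map_source hv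
  have hesm : ContMDiffOn 𝓘(ℝ, E) 𝓘(ℝ, E) ∞ e e.source := by
    have h1 : ContMDiffOn 𝓘(ℝ, E) 𝓘(ℝ, E) ∞ (fun v ↦ e' (L.symm v)) e.source := by
      rw [contMDiffOn_iff_contDiffOn]
      exact he'sm.comp L.symm.contDiff.contDiffOn (by rw [hes]; exact fun v hv ↦ hv)
    exact hψ.smooth.comp h1 fun v hv ↦ hUs (he'U _ (by rw [hes] at hv; exact hv))
  refine ⟨e, het, ?_, ?_, hesm, ?_, fun v ↦ ⟨?_, ?_, ?_⟩⟩
  · rw [hes]; simpa using he'0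
  · rw [hes]
    intro v hv a b ha hb hab
    have := he'star hv ha hb hab
    simpa using this
  · have h1 : ContMDiffOn 𝓘(ℝ, E) 𝓘(ℝ, E) ∞ (fun z ↦ L (e'.symm z)) U := by
      rw [contMDiffOn_iff_contDiffOn, ← he't]
      exact L.contDiff.comp_contDiffOn he'symm
    rw [het]
    refine h1.comp (hψ.symm_smooth.mono ?_) ?_
    · rintro _ ⟨z, hz, rfl⟩
      exact ψ.map_source (hUs hz)
    · rintro _ ⟨z, hz, rfl⟩
      change ψ.symm (ψ z) ∈ U
      rwa [ψ.left_inv (hUs hz)]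
  · have h0 : e ((0 : ℝ) • v) = ψ y := by rw [hev, zero_smul, map_zero, he'y]
    refine tangentBundle_mk_eq h0 ?_
    have hξ : HasDerivAt (fun t : ℝ ↦ e' (t • L.symm v)) (L.symm v) 0 := by
      have h1 : HasDerivAt (fun t : ℝ ↦ t • L.symm v) (L.symm v) 0 := by
        simpa using (hasDerivAt_id (0 : ℝ)).smul_const (L.symm v)
      have h2 : HasFDerivAt e' (ContinuousLinearMap.id ℝ E) ((0 : ℝ) • L.symm v) := by
        rwa [zero_smul]
      exact h2.comp_hasDerivAt (0 : ℝ) h1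
    have h1 : e' ((0 : ℝ) • L.symm v) = y := by rw [zero_smul, he'y]
    have h2 := velocity_eq_of_hasDerivAt (ψ := ψ) (γ := fun t : ℝ ↦ e (t • v)) (t := 0)
      (Filter.Eventually.of_forall fun t ↦ by simp [hev]) (by
        rw [h1]; exact hψ.mdifferentiable.mdifferentiableAt (hUs hy)) hξ
    rw [h2, h1, ← hL, L.apply_symm_apply]
  · refine hesm.comp ?_ fun t ht ↦ ht
    rw [contMDiffOn_iff_contDiffOn]
    exact (contDiff_id.smul contDiff_const).contDiffOn
  · intro x₁ t ht ht₁ ξ hξ w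
    have htL : t • L.symm v ∈ e'.source := by
      have : L.symm (t • v) ∈ e'.source := by
        have h1 : t • v ∈ e.source := ht
        rwa [hes] at h1
      rwa [map_smul] at this
    have hy₁ : e' (t • L.symm v) ∈ U := he'U _ htL
    have hξ' : ξ = fun s ↦ (chartAt E x₁).symm.symm (ψ (e' (s • L.symm v))) := by
      rw [hξ]
      funext s
      change extChartAt 𝓘(ℝ, E) x₁ (e (s • v)) = _
      rw [hev, map_smul]
      rfl
    have hζ : ContDiffAt ℝ ∞ (fun s : ℝ ↦ e' (s • L.symm v)) t :=
      (he'sm.contDiffAt (e'.open_source.mem_nhds htL)).comp t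
        (contDiff_id.smul contDiff_const).contDiffAt
    have hy₂ : ψ (e' (t • L.symm v)) ∈ (chartAt E x₁).symm.target := by
      have : e (t • v) ∈ (chartAt E x₁).source := ht₁
      rw [hev, map_smul] at this
      exact this
    change eulerLagrange (pullForm g.val (chartAt E x₁).symm) ξ t w = 0
    rw [hξ']
    -- The definition asks for the geodesic equation in every chart; invariance reduces it to the
    -- chart `ψ`, in which the spray was built.
    refine (hψ.eulerLagrange_transition g (isSmoothParametrization_chart x₁) hζ
      (hUs hy₁) hy₂).2 (fun w ↦ ?_) w
    rw [eulerLagrange_eq ((hA.contDiffAt (ψ.open_source.mem_nhds (hUs hy₁))).differentiableAt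
      (by simp)), he'geo _ _ htL]
    exact (hUW hy₁).1 _ _

end Geodesics

/-! ### From causal velocity to causal curves. -/

section CausalOfVelocity

universe u
variable {E : Type u} [NormedAddCommGroup E] [NormedSpace ℝ E] [FiniteDimensional ℝ E]
  {M : Type*} [TopologicalSpace M] [ChartedSpace E M] [IsManifold 𝓘(ℝ, E) ∞ M]

theorem AbsolutelyContinuousOnInterval.congr {X : Type*} [PseudoMetricSpace X] {f f' : ℝ → X}
    {a b : ℝ} (hf : AbsolutelyContinuousOnInterval f a b) (h : EqOn f f' (uIcc a b)) :
    AbsolutelyContinuousOnInterval f' a b := by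
  rw [absolutelyContinuousOnInterval_iff] at hf ⊢
  intro ε hε
  obtain ⟨δ, hδ, h1⟩ := hf ε hε
  refine ⟨δ, hδ, fun I hI hlt ↦ ?_⟩
  refine lt_of_eq_of_lt (Finset.sum_congr rfl fun i hi ↦ ?_) (h1 I hI hlt)
  rw [h (hI.1 i hi).1, h (hI.1 i hi).2]

theorem exists_Icc_subset_of_mem_nhdsWithin {c d t₀ : ℝ} (hcd : c < d) (ht₀ : t₀ ∈ Icc c d)
    {s : Set ℝ} (hs : s ∈ 𝓝[Icc c d] t₀) :
    ∃ a b, a < b ∧ Icc a b ⊆ Icc c d ∧ Icc a b ∈ 𝓝[Icc c d] t₀ ∧ Icc a b ⊆ s := by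
  obtain ⟨ε, hε, hball⟩ := Metric.mem_nhdsWithin_iff.1 hs
  refine ⟨max c (t₀ - ε / 2), min d (t₀ + ε / 2), ?_, ?_, ?_, ?_⟩
  · have := ht₀.1
    have := ht₀.2
    exact max_lt (lt_min hcd (by linarith)) (lt_min (by linarith) (by linarith))
  · exact Icc_subset_Icc (le_max_left _ _) (min_le_left _ _)
  · filter_upwards [self_mem_nhdsWithin, mem_nhdsWithin_of_mem_nhds
      (Icc_mem_nhds (show t₀ - ε / 2 < t₀ by linarith) (show t₀ < t₀ + ε / 2 by linarith))]
      with r hr hr'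
    exact ⟨max_le hr.1 hr'.1, le_min hr.2 hr'.2⟩
  · intro r hr
    refine hball ⟨?_, (le_max_left _ _).trans hr.1, hr.2.trans (min_le_left _ _)⟩
    have h1 := (le_max_right _ _).trans hr.1
    have h2 := hr.2.trans (min_le_right _ _)
    rw [Metric.mem_ball, Real.dist_eq, abs_lt]
    constructor <;> linarith

/-- Absolute continuity of a curve does not depend on the parametrization. -/
theorem IsSmoothParametrization.exists_Icc_absolutelyContinuous {ψ₁ ψ : OpenPartialHomeomorph E M}
    (hψ₁ : IsSmoothParametrization ψ₁) (hψ : IsSmoothParametrization ψ) {γ : ℝ → M} {a b t₀ : ℝ}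
    (hab : a ≤ b) (hnhds : Icc a b ∈ 𝓝[Icc 0 1] t₀) (hmaps : MapsTo γ (Icc a b) ψ₁.target)
    (hac : AbsolutelyContinuousOnInterval (fun t ↦ ψ₁.symm (γ t)) a b)
    (ht₀ : t₀ ∈ Icc (0 : ℝ) 1) (hγt₀ : γ t₀ ∈ ψ.target) :
    ∃ a b : ℝ, a < b ∧ Icc a b ⊆ Icc 0 1 ∧ Icc a b ∈ 𝓝[Icc 0 1] t₀ ∧
      MapsTo γ (Icc a b) ψ.target ∧
      AbsolutelyContinuousOnInterval (fun t ↦ ψ.symm (γ t)) a b := by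
  set ξ : ℝ → E := fun t ↦ ψ₁.symm (γ t) with hξ
  have htab : t₀ ∈ Icc a b := mem_of_mem_nhdsWithin ht₀ hnhds
  have hψξ : ∀ t ∈ Icc a b, ψ₁ (ξ t) = γ t := fun t ht ↦ ψ₁.right_inv (hmaps ht)
  have hy : ξ t₀ ∈ ψ₁.source := ψ₁.map_target (hmaps htab)
  have hy₂ : ψ₁ (ξ t₀) ∈ ψ.target := by rwa [hψξ t₀ htab]
  obtain ⟨K, s, hs, hK⟩ := ((hψ₁.contDiffAt_transition hψ hy hy₂).of_le
    (by simp : (1 : WithTop ℕ∞) ≤ ∞)).exists_lipschitzOnWith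
  have hξc : ContinuousOn ξ (Icc a b) := by
    have := hac.continuousOn
    rwa [uIcc_of_le hab] at this
  have hev : {t | ξ t ∈ s ∧ ψ₁ (ξ t) ∈ ψ.target} ∩ Icc a b ∈ 𝓝[Icc 0 1] t₀ := by
    have h1 : {t | ξ t ∈ s ∧ ψ₁ (ξ t) ∈ ψ.target} ∈ 𝓝[Icc a b] t₀ :=
      (hξc t₀ htab).eventually (Filter.inter_mem hs
        ((ψ₁.continuousAt hy).eventually (ψ.open_target.mem_nhds hy₂)))
    have h2 : 𝓝[Icc (0 : ℝ) 1] t₀ ≤ 𝓝[Icc a b] t₀ := le_inf inf_le_left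
      (Filter.le_principal_iff.2 hnhds)
    exact Filter.inter_mem (h2 h1) hnhds
  obtain ⟨a', b', hab', hsub', hnhds', hsub''⟩ :=
    exists_Icc_subset_of_mem_nhdsWithin zero_lt_one ht₀ hev
  have hsubab : Icc a' b' ⊆ Icc a b := fun t ht ↦ (hsub'' ht).2
  refine ⟨a', b', hab', hsub', hnhds', fun t ht ↦ ?_, ?_⟩
  · rw [← hψξ t (hsubab ht)]
    exact (hsub'' ht).1.2
  · have h1 := hK.comp_absolutelyContinuousOnInterval (f := ξ) (a := a') (b := b')
      (hac.mono (by rwa [uIcc_of_le hab'.le, uIcc_of_le hab]))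
      (by rw [uIcc_of_le hab'.le]; exact fun t ht ↦ (hsub'' ht).1.1)
    refine h1.congr fun t ht ↦ ?_
    rw [uIcc_of_le hab'.le] at ht
    simp only [hψξ t (hsubab ht)]

/-- Absolute continuity of a curve can be tested in any parametrization. -/
theorem IsAbsolutelyContinuousCurve.exists_Icc {γ : ℝ → M} (hγ : IsAbsolutelyContinuousCurve E γ)
    {ψ : OpenPartialHomeomorph E M} (hψ : IsSmoothParametrization ψ) {t₀ : ℝ}
    (ht₀ : t₀ ∈ Icc (0 : ℝ) 1) (hγt₀ : γ t₀ ∈ ψ.target) :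
    ∃ a b : ℝ, a < b ∧ Icc a b ⊆ Icc 0 1 ∧ Icc a b ∈ 𝓝[Icc 0 1] t₀ ∧
      MapsTo γ (Icc a b) ψ.target ∧
      AbsolutelyContinuousOnInterval (fun t ↦ ψ.symm (γ t)) a b := by
  obtain ⟨a, b, hab, -, hnhds, hmaps, hac⟩ := hγ t₀ ht₀
  exact (isSmoothParametrization_chart (γ t₀)).exists_Icc_absolutelyContinuous hψ hab hnhds
    hmaps hac ht₀ hγt₀

/-- Where its velocity does not vanish, a curve is differentiable in every parametrization. -/
theorem IsSmoothParametrization.exists_hasDerivAt {ψ : OpenPartialHomeomorph E M}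
    (hψ : IsSmoothParametrization ψ) {γ : ℝ → M} {t : ℝ} (ht : γ t ∈ ψ.target)
    (hv : velocity E γ t ≠ 0) :
    ∃ v, HasDerivAt (fun s ↦ ψ.symm (γ s)) v t ∧
      (velocity E γ t : E) = mfderiv 𝓘(ℝ, E) 𝓘(ℝ, E) ψ (ψ.symm (γ t)) v := by
  have hd : MDifferentiableAt 𝓘(ℝ, ℝ) 𝓘(ℝ, E) γ t := by
    by_contra h
    refine hv ?_
    rw [velocity, mfderiv_zero_of_not_mdifferentiableAt h]
    rfl
  have h1 : DifferentiableAt ℝ (fun s ↦ ψ.symm (γ s)) t := by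
    rw [← mdifferentiableAt_iff_differentiableAt]
    exact (hψ.mdifferentiable.mdifferentiableAt_symm ht).comp t hd
  refine ⟨_, h1.hasDerivAt, velocity_eq_of_hasDerivAt ?_
    (hψ.mdifferentiable.mdifferentiableAt (ψ.map_target ht)) h1.hasDerivAt⟩
  filter_upwards [hd.continuousAt.eventually (ψ.open_target.mem_nhds ht)] with s hs
  exact (ψ.right_inv hs).symm

namespace LorentzianMetric

variable {g : LorentzianMetric E M}

theorem TimeOrientation.mem_future_congr (τ : g.TimeOrientation) {x x' : M} {v w : E}
    (h : x = x') (h' : v = w) : v ∈ (τ.future x : Set E) ↔ w ∈ (τ.future x' : Set E) := by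
  subst h h'; rfl

/-- The rays of `e` are geodesics, so by invariance straight lines solve the geodesic equation of
the metric pulled back by `e`. -/
theorem gauss_lemma_normal (g : LorentzianMetric E M) {e : OpenPartialHomeomorph E M}
    (he : IsSmoothParametrization e) (hstar : StarConvex ℝ 0 e.source)
    (hgeo : ∀ v : E, g.IsGeodesicOn (fun t : ℝ ↦ e (t • v)) {t : ℝ | t • v ∈ e.source})
    {x : E} (hx : x ∈ e.source) (w : E) : pullForm g.val e x x w = pullForm g.val e 0 x w := by
  refine gauss_lemma e.open_source hstar (contDiffOn_pullForm g.contMDiff e.open_source he.smooth)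
    (fun y _ u w ↦ g.pullForm_symm e y u w) (fun v t ht ↦ ?_) hx w
  have hy₂ : e (t • v) ∈ (chartAt E (e (t • v))).symm.target := mem_chart_source E _
  refine (he.eulerLagrange_transition g (isSmoothParametrization_chart (e (t • v)))
    (contDiff_id.smul contDiff_const).contDiffAt ht hy₂).1 fun w ↦ ?_
  exact (hgeo v).2 (e (t • v)) t ht (mem_chart_source E _) _ rfl w

/-- Absolutely continuous curves with future-directed causal velocity are causal curves. -/
theorem TimeOrientation.isCausalCurve_of_velocity (τ : g.TimeOrientation) {γ : ℝ → M}
    (hγc : ContinuousOn γ (Icc 0 1)) (hγ : IsAbsolutelyContinuousCurve E γ)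
    (hv : ∀ᵐ t ∂(volume.restrict (Icc (0 : ℝ) 1)), velocity E γ t ∈ τ.future (γ t)) :
    τ.IsCausalCurve γ := by
  rw [ae_restrict_iff' measurableSet_Icc] at hv
  refine ⟨hγc, fun U hU s hs t ht hst hmaps ↦ ?_⟩
  have hsub : Icc s t ⊆ Icc 0 1 := Icc_subset_Icc hs.1 ht.2
  obtain ⟨e, rfl, he0, hstar, hsm, hsymm, hexp⟩ := hU.2 _ (hmaps (left_mem_Icc.2 hst.le))
  have he : IsSmoothParametrization e := ⟨hsm, hsymm⟩
  have hbase : e 0 = γ s := by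
    have := congrArg Bundle.TotalSpace.proj (hexp 0).1
    simpa using this
  have hgauss : ∀ x ∈ e.source, ∀ w, pullForm g.val e x x w = pullForm g.val e 0 x w :=
    fun x hx w ↦ g.gauss_lemma_normal he hstar (fun v ↦ (hexp v).2) hx w
  have hG : ContDiffOn ℝ ∞ (pullForm g.val e) e.source :=
    contDiffOn_pullForm g.contMDiff e.open_source he.smooth
  have hF : ∀ y ∈ e.source, ∃ T c, ∀ᶠ z in 𝓝 y,
      IsFutureCone (pullForm g.val e z) T c (τ.coneField e z) :=
    fun y hy ↦ τ.exists_isFutureCone he hy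
  set x : ℝ → E := fun r ↦ e.symm (γ r) with hx
  have hxΩ : ∀ r ∈ Icc s t, x r ∈ e.source := fun r hr ↦ e.map_target (hmaps hr)
  have hfut : x t ∈ τ.coneField e 0 := by
    refine mem_future_of_causal_curve e.open_source hstar hG hgauss hF hst
      (e.symm.continuousOn.comp (hγc.mono hsub) hmaps) hxΩ ?_ fun r hr ↦ ?_
    · rw [hx]
      simp only
      rw [← hbase, e.left_inv he0]
    obtain ⟨a, b, hab, hsub₁, hnhds, hmaps₁, hac⟩ := hγ.exists_Icc he (hsub hr) (hmaps hr)
    obtain ⟨a', b', hab', hsub', hnhds', hsub''⟩ :=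
      exists_Icc_subset_of_mem_nhdsWithin hst hr (nhdsWithin_mono r hsub hnhds)
    refine ⟨a', b', hab', hsub', hnhds', hac.mono ?_, ?_⟩
    · rwa [uIcc_of_le hab'.le, uIcc_of_le hab.le]
    · filter_upwards [hv] with q hq hq'
      have hqm : q ∈ Icc a' b' := Ioo_subset_Icc_self hq'
      have hqv := hq (hsub₁ (hsub'' hqm))
      have hqt := hmaps (hsub' hqm)
      -- `velocity` is zero by default where the curve is not differentiable, so a velocity in a
      -- cone forces differentiability.
      obtain ⟨v, hvd, hvel⟩ := he.exists_hasDerivAt hqt (τ.ne_zero_of_mem hqv)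
      refine ⟨v, ?_, hvd⟩
      exact (τ.mem_future_congr (e.right_inv hqt).symm hvel).1 hqv
  -- The radial geodesic is the witness; its velocity in normal coordinates is the constant `x t`.
  refine ⟨fun r ↦ e (r • x t), ?_, ?_, ?_, fun r hr ↦ ?_⟩
  · refine (hsm.of_le (by simp)).comp (t := e.source) ?_ fun r hr ↦
      hstar.smul_mem (hxΩ t (right_mem_Icc.2 hst.le)) hr.1 hr.2
    rw [contMDiffOn_iff_contDiffOn]
    exact (contDiff_id.smul contDiff_const).contDiffOn
  · simp [hbase]
  · simp only [one_smul]
    exact e.right_inv (hmaps (right_mem_Icc.2 hst.le))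
  · have hr' : r • x t ∈ e.source := hstar.smul_mem (hxΩ t (right_mem_Icc.2 hst.le)) hr.1 hr.2
    refine ⟨e.map_source hr', ?_⟩
    have hline : HasDerivAt (fun q : ℝ ↦ q • x t) (x t) r := by
      simpa using (hasDerivAt_id r).smul_const (x t)
    have hmd := he.mdifferentiable.mdifferentiableAt hr'
    have hvel := velocity_eq_of_hasDerivAt (γ := fun q : ℝ ↦ e (q • x t)) (ψ := e) (t := r)
      Filter.EventuallyEq.rfl hmd hline
    -- The geodesic extends beyond `[0,1]` because the source of `e` is open, so one-sided
    -- velocities at the ends are two-sided ones.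
    have hwithin : velocityWithin E (fun q : ℝ ↦ e (q • x t)) (Icc 0 1) r =
        velocity E (fun q : ℝ ↦ e (q • x t)) r := by
      have h1 : MDifferentiableAt 𝓘(ℝ, ℝ) 𝓘(ℝ, E) (fun q : ℝ ↦ e (q • x t)) r :=
        hmd.comp r hline.differentiableAt.mdifferentiableAt
      exact congrArg (fun D : ℝ →L[ℝ] E ↦ D 1) (mfderivWithin_eq_mfderiv
        ((uniqueDiffOn_Icc zero_lt_one r hr).uniqueMDiffWithinAt) h1)
    rw [hwithin]
    exact (τ.mem_future_congr rfl hvel).2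
      (mem_future_radial e.open_source hstar hG hgauss hF (hxΩ t (right_mem_Icc.2 hst.le)) hfut hr)

end LorentzianMetric

end CausalOfVelocity

/-! ### From causal curves to causal velocity. -/

section VelocityOfCausal

universe u
variable {E : Type u} [NormedAddCommGroup E] [NormedSpace ℝ E] [FiniteDimensional ℝ E]
  {M : Type*} [TopologicalSpace M] [ChartedSpace E M] [IsManifold 𝓘(ℝ, E) ∞ M]

namespace LorentzianMetric.TimeOrientation

variable {g : LorentzianMetric E M} {τ : g.TimeOrientation} {ψ : OpenPartialHomeomorph E M}
  {γ : ℝ → M}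

/-- A linear functional that is positive on the future cones over `U` increases along the causal
relation of `U`. -/
theorem CausallyPrecedesIn.lt (hψ : IsSmoothParametrization ψ) {U : Set M} {p q : M}
    (h : τ.CausallyPrecedesIn U p q) (hU : U ⊆ ψ.target) {f : E →L[ℝ] ℝ}
    (hf : ∀ x ∈ U, ∀ v ∈ τ.coneField ψ (ψ.symm x), 0 < f v) : f (ψ.symm p) < f (ψ.symm q) := by
  obtain ⟨c, hc, rfl, rfl, hcU⟩ := h
  have hmono : StrictMonoOn (fun t ↦ f (ψ.symm (c t))) (Icc (0 : ℝ) 1) := by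
    refine strictMonoOn_of_deriv_pos (convex_Icc _ _)
      (f.continuous.comp_continuousOn (ψ.symm.continuousOn.comp hc.continuousOn
        fun t ht ↦ hU (hcU t ht).1)) fun t ht ↦ ?_
    rw [interior_Icc] at ht
    obtain ⟨htU, htv⟩ := hcU t (Ioo_subset_Icc_self ht)
    have hvel : velocityWithin E c (Icc 0 1) t = velocity E c t :=
      congrArg (fun D : ℝ →L[ℝ] E ↦ D 1) (mfderivWithin_of_mem_nhds (Icc_mem_nhds ht.1 ht.2))
    rw [hvel] at htv
    obtain ⟨v, hv, hv'⟩ := hψ.exists_hasDerivAt (hU htU) (τ.ne_zero_of_mem htv)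
    have h1 : HasDerivAt (fun t ↦ f (ψ.symm (c t))) (f v) t := f.hasFDerivAt.comp_hasDerivAt t hv
    rw [h1.deriv]
    exact hf _ htU v ((τ.mem_future_congr (ψ.right_inv (hU htU)).symm hv').1 htv)
  exact hmono (left_mem_Icc.2 zero_le_one) (right_mem_Icc.2 zero_le_one) zero_lt_one

/-- Locally along a causal curve, the linear functionals that are positive on the neighbouring
cones are increasing. -/
theorem IsCausalCurve.exists_Icc_strictMonoOn (hγ : τ.IsCausalCurve γ)
    (hψ : IsSmoothParametrization ψ) {t₀ : ℝ} (ht₀ : t₀ ∈ Icc (0 : ℝ) 1) (hγt₀ : γ t₀ ∈ ψ.target)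
    {W : Set E} (hW : W ∈ 𝓝 (ψ.symm (γ t₀))) :
    ∃ a b : ℝ, a < b ∧ Icc a b ⊆ Icc 0 1 ∧ Icc a b ∈ 𝓝[Icc 0 1] t₀ ∧
      MapsTo γ (Icc a b) ψ.target ∧
      ∀ f : E →L[ℝ] ℝ, (∀ y ∈ W, ∀ v ∈ τ.coneField ψ y, 0 < f v) →
        StrictMonoOn (fun t ↦ f (ψ.symm (γ t))) (Icc a b) := by
  -- Causal curves are constrained only in convex sets; Whitehead's theorem supplies one so small
  -- that `f` is positive on all its cones.
  obtain ⟨U, hUW, hpU, hU⟩ := g.exists_isConvexNhd (γ t₀) (W := ψ.target ∩ ψ.symm ⁻¹' W)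
    (Filter.inter_mem (ψ.open_target.mem_nhds hγt₀) (ψ.symm.continuousAt hγt₀ hW))
  obtain ⟨a, b, hab, hsub, hnhds, habU⟩ := exists_Icc_subset_of_mem_nhdsWithin zero_lt_one ht₀
    (hγ.1 t₀ ht₀ (hU.1.mem_nhds hpU))
  refine ⟨a, b, hab, hsub, hnhds, fun t ht ↦ (hUW (habU ht)).1, fun f hf s hs t ht hst ↦ ?_⟩
  exact (hγ.2 U hU s (hsub hs) t (hsub ht) hst fun r hr ↦
    habU ⟨hs.1.trans hr.1, hr.2.trans ht.2⟩).lt hψ (fun x hx ↦ (hUW hx).1)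
    fun x hx ↦ hf _ (hUW hx).2

/-- Where the velocity of a causal curve does not vanish, it is future-directed causal. -/
theorem IsCausalCurve.velocity_mem (hγ : τ.IsCausalCurve γ) {t : ℝ} (ht : t ∈ Ioo (0 : ℝ) 1)
    (hv : velocity E γ t ≠ 0) : velocity E γ t ∈ τ.future (γ t) := by
  set ψ : OpenPartialHomeomorph E M := (chartAt E (γ t)).symm with hψdef
  have hψ : IsSmoothParametrization ψ := isSmoothParametrization_chart _
  have hγt : γ t ∈ ψ.target := mem_chart_source E _
  have ht' : t ∈ Icc (0 : ℝ) 1 := Ioo_subset_Icc_self ht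
  obtain ⟨v, hvd, hvel⟩ := hψ.exists_hasDerivAt hγt hv
  set y₀ := ψ.symm (γ t) with hy₀
  have hy₀s : y₀ ∈ ψ.source := ψ.map_target hγt
  refine (τ.mem_future_congr (ψ.right_inv hγt).symm hvel).2 ?_
  have hv0 : v ≠ 0 := by
    refine (hψ.mfderiv_ne_zero hy₀s).1 fun h0 ↦ hv ?_
    exact hvel.trans h0
  obtain ⟨T, c, hTc⟩ := τ.exists_isFutureCone hψ hy₀s
  have h0 := hTc.self_of_nhds
  obtain ⟨C, hC, R, hR, hpert⟩ := exists_causal_perturbation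
    (((contDiffOn_pullForm g.contMDiff ψ.open_source hψ.smooth).contDiffAt
      (ψ.open_source.mem_nhds hy₀s)).of_le (by simp)) hTc
  set B := pullForm g.val ψ y₀ with hB
  have hc : 0 < c := h0.pos
  have hdual : ∀ z, B z z ≤ 0 → B T z ≤ 0 → B z v ≤ 0 := by
    intro z hz hTz
    -- `-B z` is nonnegative on the cone at `y₀` but perhaps not on nearby cones; the term `ε • -B
    -- T` makes it positive on cones close enough to `y₀`.
    have hε : ∀ ε > (0 : ℝ), 0 ≤ (-B z + ε • -B T) v := by
      intro ε hε
      -- Within distance `δ`, correcting `w` to a causal vector at `y₀` changes `B z w` by at most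
      -- `C δ |B z T| ‖w‖`, less than the gain `ε (c / 2) ‖w‖`.
      obtain ⟨δ, hδ, hδR, hδε⟩ : ∃ δ > 0, δ ≤ R ∧ C * δ * |B z T| < ε * (c / 2) := by
        refine ⟨min R (ε * (c / 2) / (C * (|B z T| + 1))), lt_min hR (by positivity),
          min_le_left _ _, ?_⟩
        calc C * min R (ε * (c / 2) / (C * (|B z T| + 1))) * |B z T|
            ≤ C * (ε * (c / 2) / (C * (|B z T| + 1))) * |B z T| := by
              gcongr; exact min_le_right _ _
          _ = ε * (c / 2) * (|B z T| / (|B z T| + 1)) := by field_simp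
          _ < ε * (c / 2) * 1 := by
              gcongr
              rw [div_lt_one (by positivity)]
              linarith
          _ = _ := mul_one _
      obtain ⟨a, b, hab, -, hnhds, -, hmono⟩ := hγ.exists_Icc_strictMonoOn hψ ht' hγt
        (Metric.ball_mem_nhds y₀ hδ)
      have hpos := hmono (-B z + ε • -B T) fun y hy w hw ↦ by
        have hyR : y ∈ Metric.ball y₀ R := Metric.ball_subset_ball hδR hy
        obtain ⟨hcy, hpy⟩ := hpert y hyR y₀ (Metric.mem_ball_self hR)
        obtain ⟨hw0, hw1, hw2⟩ := (hcy.mem_iff w).1 hw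
        obtain ⟨hw3, hw4⟩ := hpy w hw1 hw2.le
        obtain ⟨h1, h2⟩ := hw4 _ le_rfl
        have h3 := h0.nonpos hz hTz h1 h2
        rw [map_add, map_smul, smul_eq_mul] at h3
        have hwn : 0 < ‖w‖ := norm_pos_iff.2 hw0
        have hdist : ‖y₀ - y‖ < δ := by
          rw [← dist_eq_norm, dist_comm]; exact hy
        have h4 : -(C * ‖y₀ - y‖ * ‖w‖ * B z T) ≤ C * δ * |B z T| * ‖w‖ := by
          calc -(C * ‖y₀ - y‖ * ‖w‖ * B z T) = C * ‖y₀ - y‖ * ‖w‖ * -B z T := by ring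
            _ ≤ C * ‖y₀ - y‖ * ‖w‖ * |B z T| := by
              gcongr
              exact neg_le_abs _
            _ ≤ C * δ * ‖w‖ * |B z T| := by gcongr
            _ = _ := by ring
        have h5 : C * δ * |B z T| * ‖w‖ < ε * (c / 2) * ‖w‖ := by gcongr
        have h6 : ε * (c / 2) * ‖w‖ ≤ ε * -B T w := by
          rw [mul_assoc]; gcongr
        simp only [add_apply, neg_apply, smul_apply, smul_eq_mul]
        linarith
      have hd : HasDerivAt (fun s ↦ (-B z + ε • -B T) (ψ.symm (γ s))) ((-B z + ε • -B T) v) t :=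
        (-B z + ε • -B T).hasFDerivAt.comp_hasDerivAt t hvd
      have hnhds' : Icc a b ∈ 𝓝 t := by
        rwa [nhdsWithin_eq_nhds.2 (Icc_mem_nhds ht.1 ht.2)] at hnhds
      have := hpos.monotoneOn.derivWithin_nonneg (x := t)
      rwa [derivWithin_of_mem_nhds hnhds', hd.deriv] at this
    have hlim : Filter.Tendsto (fun ε : ℝ ↦ (-B z + ε • -B T) v) (𝓝[>] 0) (𝓝 (-B z v)) := by
      have : Continuous fun ε : ℝ ↦ (-B z + ε • -B T) v := by fun_prop
      exact (this.tendsto' 0 _ (by simp)).mono_left nhdsWithin_le_nhds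
    have := ge_of_tendsto hlim (by filter_upwards [self_mem_nhdsWithin] with ε hε' using hε ε hε')
    linarith
  obtain ⟨hvv, hTv⟩ := h0.causal_of_dual hdual
  exact h0.mem_of_causal hvv hTv hv0

/-- Causal curves are invariant under changes of parameter. -/
theorem IsCausalCurve.comp (hγ : τ.IsCausalCurve γ) {σ : ℝ → ℝ} (hσ : IsReparametrization σ) :
    τ.IsCausalCurve (γ ∘ σ) := by
  obtain ⟨hσc, hσm, hσ0, hσ1⟩ := hσ
  have hmaps : MapsTo σ (Icc 0 1) (Icc 0 1) := fun t ht ↦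
    ⟨hσ0 ▸ hσm.monotoneOn (left_mem_Icc.2 zero_le_one) ht ht.1,
      hσ1 ▸ hσm.monotoneOn ht (right_mem_Icc.2 zero_le_one) ht.2⟩
  refine ⟨hγ.1.comp hσc hmaps, fun U hU s hs t ht hst hsub ↦ ?_⟩
  refine hγ.2 U hU _ (hmaps hs) _ (hmaps ht) (hσm hs ht hst) fun r hr ↦ ?_
  obtain ⟨q, hq, rfl⟩ := intermediate_value_Icc hst.le
    (hσc.mono (Icc_subset_Icc hs.1 ht.2)) hr
  exact hsub hq

theorem IsCausalCurve.of_comp (hγ : ContinuousOn γ (Icc 0 1)) {σ : ℝ → ℝ}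
    (hσ : IsReparametrization σ) (h : τ.IsCausalCurve (γ ∘ σ)) : τ.IsCausalCurve γ := by
  obtain ⟨hσc, hσm, hσ0, hσ1⟩ := hσ
  have hsurj : Icc 0 1 ⊆ σ '' Icc 0 1 := by
    have := intermediate_value_Icc zero_le_one hσc
    rwa [hσ0, hσ1] at this
  refine ⟨hγ, fun U hU s hs t ht hst hsub ↦ ?_⟩
  obtain ⟨s', hs', rfl⟩ := hsurj hs
  obtain ⟨t', ht', rfl⟩ := hsurj ht
  refine h.2 U hU s' hs' t' ht' ((hσm.lt_iff_lt hs' ht').1 hst) fun r hr ↦ hsub ?_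
  have hr' : r ∈ Icc (0 : ℝ) 1 := ⟨hs'.1.trans hr.1, hr.2.trans ht'.2⟩
  exact ⟨hσm.monotoneOn hs' hr' hr.1, hσm.monotoneOn hr' ht' hr.2⟩

end LorentzianMetric.TimeOrientation

end VelocityOfCausal

/-! ### Locally Lipschitz curves are of class H¹. -/

section LocallyLipschitz

universe u
variable {E : Type u} [NormedAddCommGroup E] [NormedSpace ℝ E] [FiniteDimensional ℝ E]
  {M : Type*} [TopologicalSpace M] [ChartedSpace E M] [IsManifold 𝓘(ℝ, E) ∞ M]

/-- In a parametrization, the coordinates of the velocity are the derivatives of the coordinates,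
even where the curve is not differentiable. -/
theorem IsSmoothParametrization.velocity_eq_deriv {ψ : OpenPartialHomeomorph E M}
    (hψ : IsSmoothParametrization ψ) {γ : ℝ → M} {t : ℝ} (ht : ∀ᶠ s in 𝓝 t, γ s ∈ ψ.target) :
    (velocity E γ t : E) =
      mfderiv 𝓘(ℝ, E) 𝓘(ℝ, E) ψ (ψ.symm (γ t)) (deriv (fun s ↦ ψ.symm (γ s)) t) := by
  by_cases hv : velocity E γ t = 0
  · by_cases hd : DifferentiableAt ℝ (fun s ↦ ψ.symm (γ s)) t
    · refine velocity_eq_of_hasDerivAt ?_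
        (hψ.mdifferentiable.mdifferentiableAt (ψ.map_target ht.self_of_nhds)) hd.hasDerivAt
      filter_upwards [ht] with s hs
      exact (ψ.right_inv hs).symm
    · have h1 : (mfderiv 𝓘(ℝ, E) 𝓘(ℝ, E) ψ (ψ.symm (γ t)) (0 : E) : E) = 0 := map_zero _
      rw [← deriv_zero_of_not_differentiableAt hd] at h1
      exact Eq.trans hv h1.symm
  · obtain ⟨v, hv1, hv2⟩ := hψ.exists_hasDerivAt ht.self_of_nhds hv
    have h1 := hv1.deriv
    subst h1
    exact hv2

/-- Curves that are locally Lipschitz continuous in suitable parametrizations. -/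
def IsLocallyLipschitzCurve (E : Type*) [NormedAddCommGroup E] [NormedSpace ℝ E]
    {M : Type*} [TopologicalSpace M] [ChartedSpace E M] [IsManifold 𝓘(ℝ, E) ∞ M]
    (γ : ℝ → M) : Prop :=
  ∀ t₀ ∈ Icc (0 : ℝ) 1, ∃ ψ : OpenPartialHomeomorph E M, IsSmoothParametrization ψ ∧
    ∃ a b : ℝ, a < b ∧ Icc a b ⊆ Icc 0 1 ∧ Icc a b ∈ 𝓝[Icc 0 1] t₀ ∧
      MapsTo γ (Icc a b) ψ.target ∧
      ∃ K : NNReal, LipschitzOnWith K (fun t ↦ ψ.symm (γ t)) (Icc a b)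

/-- In coordinates the velocity is bounded by the Lipschitz constant, so the energy density is
bounded near every parameter; compactness of `[0,1]` makes it integrable. -/
theorem IsLocallyLipschitzCurve.isH1Curve {γ : ℝ → M} (hγ : IsLocallyLipschitzCurve E γ)
    (h : Bundle.ContMDiffRiemannianMetric 𝓘(ℝ, E) ∞ E (fun x : M ↦ TangentSpace 𝓘(ℝ, E) x)) :
    IsH1Curve h γ := by
  constructor
  · intro t₀ ht₀
    obtain ⟨ψ, hψ, a, b, hab, hsub, hnhds, hmaps, K, hK⟩ := hγ t₀ ht₀
    rw [← uIcc_of_le hab.le] at hK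
    obtain ⟨a', b', hab', h1, h2, h3, h4⟩ := hψ.exists_Icc_absolutelyContinuous
      (isSmoothParametrization_chart (γ t₀)) hab.le hnhds hmaps
      hK.absolutelyContinuousOnInterval ht₀ (mem_chart_source E _)
    exact ⟨a', b', hab'.le, h1, h2, h3, h4⟩
  · refine LocallyIntegrableOn.integrableOn_isCompact (fun t₀ ht₀ ↦ ?_) isCompact_Icc
    obtain ⟨ψ, hψ, a, b, hab, hsub, hnhds, hmaps, K, hK⟩ := hγ t₀ ht₀
    refine ⟨Icc a b, hnhds, ?_⟩
    set ξ : ℝ → E := fun t ↦ ψ.symm (γ t) with hξ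
    have hξc : ContinuousOn ξ (Icc a b) := hK.continuousOn
    let P : E → E →L[ℝ] E →L[ℝ] ℝ := pullForm h.inner ψ
    have hPc : ContinuousOn (fun t ↦ P (ξ t)) (Icc a b) :=
      (contDiffOn_pullForm h.contMDiff ψ.open_source hψ.smooth).continuousOn.comp hξc
        fun t ht ↦ ψ.map_target (hmaps ht)
    have heq : ∀ t ∈ Ioo a b, h.inner (γ t) (velocity E γ t) (velocity E γ t) =
        P (ξ t) (deriv ξ t) (deriv ξ t) := fun t ht ↦ by
      have h1 := hψ.velocity_eq_deriv (γ := γ) (t := t) (by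
        filter_upwards [Icc_mem_nhds ht.1 ht.2] with s hs using hmaps hs)
      have h2 : ψ (ξ t) = γ t := ψ.right_inv (hmaps (Ioo_subset_Icc_self ht))
      have h3 : ∀ (x : M) (_ : x = γ t) (v : E) (_ : velocity E γ t = v),
          h.inner (γ t) (velocity E γ t) (velocity E γ t) =
            (show E →L[ℝ] E →L[ℝ] ℝ from h.inner x) v v := by
        intro x hx v hv
        subst hx hv
        rfl
      exact h3 _ h2 _ h1
    obtain ⟨C, hC⟩ := isCompact_Icc.exists_bound_of_continuousOn hPc
    have hmeas : AEStronglyMeasurable (fun t ↦ P (ξ t) (deriv ξ t) (deriv ξ t))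
        (volume.restrict (Icc a b)) := by
      have h1 : AEStronglyMeasurable (fun t ↦ P (ξ t)) (volume.restrict (Icc a b)) :=
        hPc.aestronglyMeasurable measurableSet_Icc
      have h2 : AEStronglyMeasurable (deriv ξ) (volume.restrict (Icc a b)) :=
        (stronglyMeasurable_deriv ξ).aestronglyMeasurable
      exact (ContinuousLinearMap.id ℝ (E →L[ℝ] ℝ)).aestronglyMeasurable_comp₂
        ((ContinuousLinearMap.id ℝ (E →L[ℝ] E →L[ℝ] ℝ)).aestronglyMeasurable_comp₂ h1 h2) h2
    have hint : IntegrableOn (fun t ↦ P (ξ t) (deriv ξ t) (deriv ξ t)) (Icc a b) := by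
      refine Integrable.of_bound hmeas (C * K * K) ?_
      rw [← restrict_Ioo_eq_restrict_Icc, ae_restrict_iff' measurableSet_Ioo]
      refine Filter.Eventually.of_forall fun t ht ↦ ?_
      have h1 := norm_deriv_le_of_lipschitzOn (Icc_mem_nhds ht.1 ht.2) hK
      have h2 := hC t (Ioo_subset_Icc_self ht)
      refine ((P (ξ t)).le_opNorm₂ _ _).trans ?_
      have h3 : 0 ≤ C := (norm_nonneg _).trans h2
      gcongr
    refine hint.congr_fun_ae ?_
    rw [← restrict_Ioo_eq_restrict_Icc]
    filter_upwards [ae_restrict_mem measurableSet_Ioo] with t ht using (heq t ht).symm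

end LocallyLipschitz

/-! ### Inverting a strictly increasing function. -/

section ChangeOfParameter

/-- `S`, normalized affinely, is an increasing bijection of `[0,1]`, and `σ` is its inverse;
continuity of the inverse is automatic for order isomorphisms. -/
theorem exists_isReparametrization_of_strictMonoOn {S : ℝ → ℝ} (hS : ContinuousOn S (Icc 0 1))
    (hmono : StrictMonoOn S (Icc 0 1)) :
    ∃ σ, IsReparametrization σ ∧
      ∀ r ∈ Icc (0 : ℝ) 1, σ r ∈ Icc (0 : ℝ) 1 ∧ S (σ r) = S 0 + r * (S 1 - S 0) := by
  have h0 : (0 : ℝ) ∈ Icc (0 : ℝ) 1 := left_mem_Icc.2 zero_le_one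
  have h1 : (1 : ℝ) ∈ Icc (0 : ℝ) 1 := right_mem_Icc.2 zero_le_one
  have hD : 0 < S 1 - S 0 := sub_pos.2 (hmono h0 h1 zero_lt_one)
  let N : ℝ → ℝ := fun t ↦ (S t - S 0) / (S 1 - S 0)
  have hN0 : N 0 = 0 := by simp [N]
  have hN1 : N 1 = 1 := by simp [N, hD.ne']
  have hNmono : StrictMonoOn N (Icc 0 1) := fun s hs t ht hst ↦
    div_lt_div_of_pos_right (by linarith [hmono hs ht hst]) hD
  have hNmem : ∀ t ∈ Icc (0 : ℝ) 1, N t ∈ Icc (0 : ℝ) 1 := fun t ht ↦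
    ⟨hN0 ▸ hNmono.monotoneOn h0 ht ht.1, hN1 ▸ hNmono.monotoneOn ht h1 ht.2⟩
  have hNsurj : Icc (0 : ℝ) 1 ⊆ N '' Icc 0 1 := by
    have hNc : ContinuousOn N (Icc 0 1) := (hS.sub continuousOn_const).div_const _
    have := intermediate_value_Icc zero_le_one hNc
    rwa [hN0, hN1] at this
  let f : Icc (0 : ℝ) 1 → Icc (0 : ℝ) 1 := fun t ↦ ⟨N t, hNmem t t.2⟩
  have hf : StrictMono f := fun s t hst ↦ hNmono s.2 t.2 hst
  have hfs : Function.Surjective f := fun r ↦ by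
    obtain ⟨t, ht, htr⟩ := hNsurj r.2
    exact ⟨⟨t, ht⟩, Subtype.ext htr⟩
  let e := hf.orderIsoOfSurjective f hfs
  have hinv : ∀ r : Icc (0 : ℝ) 1, N (e.symm r) = r := fun r ↦
    congrArg Subtype.val (e.apply_symm_apply r)
  let σ : ℝ → ℝ := fun r ↦ e.symm (projIcc 0 1 zero_le_one r)
  have hσ : ∀ r ∈ Icc (0 : ℝ) 1, N (σ r) = r := fun r hr ↦ by
    rw [show σ r = e.symm (projIcc 0 1 zero_le_one r) from rfl, hinv, projIcc_of_mem _ hr]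
  have hσmem : ∀ r, σ r ∈ Icc (0 : ℝ) 1 := fun r ↦ (e.symm _).2
  refine ⟨σ, ⟨?_, fun s hs t ht hst ↦ ?_, ?_, ?_⟩, fun r hr ↦ ⟨hσmem r, ?_⟩⟩
  · exact (continuous_subtype_val.comp (e.symm.continuous.comp continuous_projIcc)).continuousOn
  · rw [← hNmono.lt_iff_lt (hσmem s) (hσmem t), hσ s hs, hσ t ht]
    exact hst
  · exact hNmono.injOn (hσmem 0) h0 ((hσ 0 h0).trans hN0.symm)
  · exact hNmono.injOn (hσmem 1) h1 ((hσ 1 h1).trans hN1.symm)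
  · have h2 : (S (σ r) - S 0) / (S 1 - S 0) = r := hσ r hr
    rw [div_eq_iff hD.ne'] at h2
    linarith

end ChangeOfParameter

/-! ### Local time functions and the Lipschitz parametrization. -/

section TimeFunctions

universe u
variable {E : Type u} [NormedAddCommGroup E] [NormedSpace ℝ E] [FiniteDimensional ℝ E]
  {M : Type*} [TopologicalSpace M] [ChartedSpace E M] [IsManifold 𝓘(ℝ, E) ∞ M]

/-- A linear time function on a piece of a curve: it increases along the curve and controls the
increments of the coordinates. -/
structure IsLocalTime (γ : ℝ → M) (ψ : OpenPartialHomeomorph E M) (ℓ : E →L[ℝ] ℝ) (K : NNReal)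
    (a b : ℝ) : Prop where
  param : IsSmoothParametrization ψ
  lt : a < b
  subset : Icc a b ⊆ Icc 0 1
  maps : MapsTo γ (Icc a b) ψ.target
  strictMono : StrictMonoOn (fun t ↦ ℓ (ψ.symm (γ t))) (Icc a b)
  norm_le : ∀ s ∈ Icc a b, ∀ t ∈ Icc a b, s ≤ t →
    ‖ψ.symm (γ t) - ψ.symm (γ s)‖ ≤ K * (ℓ (ψ.symm (γ t)) - ℓ (ψ.symm (γ s)))

/-- On nearby cones `ℓ v ≥ (c / 2) ‖v‖`, so `ℓ - (c / 4) • φ` is still positive there for every `φ`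
of norm at most one, and increases along `γ`. Choosing `φ` to norm the increment of the coordinates
bounds that increment by `4 / c` times the increment of `ℓ`. -/
theorem LorentzianMetric.TimeOrientation.IsCausalCurve.exists_isLocalTime
    {g : LorentzianMetric E M} {τ : g.TimeOrientation} {γ : ℝ → M} (hγ : τ.IsCausalCurve γ) {t₀ : ℝ}
    (ht₀ : t₀ ∈ Icc (0 : ℝ) 1) :
    ∃ (ψ : OpenPartialHomeomorph E M) (ℓ : E →L[ℝ] ℝ) (K : NNReal) (a b : ℝ),
      IsLocalTime γ ψ ℓ K a b ∧ Icc a b ∈ 𝓝[Icc 0 1] t₀ := by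
  set ψ : OpenPartialHomeomorph E M := (chartAt E (γ t₀)).symm with hψdef
  have hψ : IsSmoothParametrization ψ := isSmoothParametrization_chart _
  have hγt : γ t₀ ∈ ψ.target := mem_chart_source E _
  set y₀ := ψ.symm (γ t₀) with hy₀
  have hy₀s : y₀ ∈ ψ.source := ψ.map_target hγt
  obtain ⟨T, c, hTc⟩ := τ.exists_isFutureCone hψ hy₀s
  have hc : 0 < c := hTc.self_of_nhds.pos
  obtain ⟨C, hC, R, hR, hpert⟩ := exists_causal_perturbation
    (((contDiffOn_pullForm g.contMDiff ψ.open_source hψ.smooth).contDiffAt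
      (ψ.open_source.mem_nhds hy₀s)).of_le (by simp)) hTc
  set ℓ : E →L[ℝ] ℝ := -pullForm g.val ψ y₀ T with hℓ
  have hcone : ∀ y ∈ Metric.ball y₀ R, ∀ v ∈ τ.coneField ψ y, 0 < ‖v‖ ∧ c / 2 * ‖v‖ ≤ ℓ v := by
    intro y hy v hv
    obtain ⟨hcy, hpy⟩ := hpert y hy y₀ (Metric.mem_ball_self hR)
    obtain ⟨hv0, hv1, hv2⟩ := (hcy.mem_iff v).1 hv
    exact ⟨norm_pos_iff.2 hv0, (hpy v hv1 hv2.le).1⟩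
  obtain ⟨a, b, hab, hsub, hnhds, hmaps, hmono⟩ := hγ.exists_Icc_strictMonoOn hψ ht₀ hγt
    (Metric.ball_mem_nhds y₀ hR)
  refine ⟨ψ, ℓ, ⟨4 / c, by positivity⟩, a, b, ⟨hψ, hab, hsub, hmaps, ?_, ?_⟩, hnhds⟩
  · refine hmono ℓ fun y hy v hv ↦ ?_
    obtain ⟨h1, h2⟩ := hcone y hy v hv
    exact (mul_pos (half_pos hc) h1).trans_le h2
  · intro s hs t ht hst
    obtain ⟨φ, hφ, hφv⟩ := exists_dual_vector'' ℝ (ψ.symm (γ t) - ψ.symm (γ s))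
    have h1 := hmono (ℓ - (c / 4) • φ) fun y hy v hv ↦ by
      obtain ⟨h1, h2⟩ := hcone y hy v hv
      have h3 : φ v ≤ ‖v‖ := (le_abs_self _).trans
        ((φ.le_opNorm v).trans (mul_le_of_le_one_left (norm_nonneg v) hφ))
      have h4 : c / 4 * φ v ≤ c / 4 * ‖v‖ := mul_le_mul_of_nonneg_left h3 (by positivity)
      have h5 : 0 < c / 4 * ‖v‖ := by positivity
      simp only [sub_apply, smul_apply, smul_eq_mul]
      linarith
    have h2 := h1.monotoneOn hs ht hst
    simp only [sub_apply, smul_apply, smul_eq_mul] at h2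
    rw [map_sub] at hφv
    change _ ≤ 4 / c * _
    rw [← sub_nonneg, div_mul_eq_mul_div, le_sub_iff_add_le, zero_add, le_div_iff₀ hc]
    simp only [RCLike.ofReal_real_eq_id, id_eq] at hφv
    rw [← hφv]
    linarith

/-- The local time function, continued by constants. -/
noncomputable def clampedTime (γ : ℝ → M) (ψ : OpenPartialHomeomorph E M) (ℓ : E →L[ℝ] ℝ) (a b : ℝ)
    (t : ℝ) : ℝ :=
  ℓ (ψ.symm (γ (max a (min b t))))

namespace IsLocalTime

variable {γ : ℝ → M} {ψ : OpenPartialHomeomorph E M} {ℓ : E →L[ℝ] ℝ} {K : NNReal} {a b : ℝ}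

theorem clamp_mem (h : IsLocalTime γ ψ ℓ K a b) (t : ℝ) : max a (min b t) ∈ Icc a b :=
  ⟨le_max_left _ _, max_le h.lt.le (min_le_left _ _)⟩

theorem clampedTime_eq {t : ℝ} (ht : t ∈ Icc a b) :
    clampedTime γ ψ ℓ a b t = ℓ (ψ.symm (γ t)) := by
  rw [clampedTime, min_eq_right ht.2, max_eq_right ht.1]

theorem continuous_clampedTime (h : IsLocalTime γ ψ ℓ K a b) (hγ : ContinuousOn γ (Icc 0 1)) :
    Continuous (clampedTime γ ψ ℓ a b) := by
  have h1 : ContinuousOn (fun t ↦ ℓ (ψ.symm (γ t))) (Icc a b) :=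
    ℓ.continuous.comp_continuousOn (ψ.symm.continuousOn.comp (hγ.mono h.subset) h.maps)
  exact h1.comp_continuous (by fun_prop) h.clamp_mem

theorem monotone_clampedTime (h : IsLocalTime γ ψ ℓ K a b) :
    Monotone (clampedTime γ ψ ℓ a b) := fun _ _ hst ↦
  h.strictMono.monotoneOn (h.clamp_mem _) (h.clamp_mem _)
    (max_le_max le_rfl (min_le_min le_rfl hst))

theorem clampedTime_lt (h : IsLocalTime γ ψ ℓ K a b) {s m t : ℝ} (hm : m ∈ Icc a b) (hsm : s < m)
    (hmt : m < t) : clampedTime γ ψ ℓ a b s < clampedTime γ ψ ℓ a b t := by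
  refine h.strictMono (h.clamp_mem _) (h.clamp_mem _) ?_
  rcases eq_or_lt_of_le hm.2 with hmb | hmb
  · have h1 : max a (min b t) = b := by
      rw [min_eq_left (hmb ▸ hmt.le), max_eq_right h.lt.le]
    rw [h1]
    exact max_lt h.lt ((min_le_right _ _).trans_lt (hmb ▸ hsm))
  · refine lt_of_le_of_lt (b := m) (max_le hm.1 ((min_le_right _ _).trans hsm.le)) ?_
    exact (lt_min hmb hmt).trans_le (le_max_right _ _)

/-- At a zero of the velocity, the derivative of the time function vanishes. -/
theorem hasDerivAt_clampedTime_zero (h : IsLocalTime γ ψ ℓ K a b) {σ : ℝ → ℝ} {r : ℝ}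
    (hσ : ContinuousAt σ r) (ha : σ r ≠ a) (hb : σ r ≠ b)
    (hd : σ r ∈ Ioo a b → DifferentiableAt ℝ (fun q ↦ ψ.symm (γ (σ q))) r)
    (hv : velocity E (γ ∘ σ) r = 0) :
    HasDerivAt (fun q ↦ clampedTime γ ψ ℓ a b (σ q)) 0 r := by
  rcases lt_or_gt_of_ne ha with ha | ha
  · refine (hasDerivAt_const r (ℓ (ψ.symm (γ a)))).congr_of_eventuallyEq ?_
    filter_upwards [hσ.eventually (gt_mem_nhds ha)] with q hq
    rw [clampedTime, max_eq_left ((min_le_right _ _).trans hq.le)]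
  rcases lt_or_gt_of_ne hb with hb | hb
  · have hev : ∀ᶠ q in 𝓝 r, σ q ∈ Ioo a b := hσ.eventually (Ioo_mem_nhds ha hb)
    have h1 := hd ⟨ha, hb⟩
    have hmem : σ r ∈ Icc a b := ⟨ha.le, hb.le⟩
    have h2 := h.param.velocity_eq_deriv (γ := γ ∘ σ) (t := r)
      (hev.mono fun q hq ↦ h.maps (Ioo_subset_Icc_self hq))
    have h3 : deriv (fun q ↦ ψ.symm ((γ ∘ σ) q)) r = 0 := by
      by_contra h0
      exact (h.param.mfderiv_ne_zero (ψ.map_target (h.maps hmem))).2 h0 (h2.symm.trans hv)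
    have h4 : HasDerivAt (fun q ↦ ℓ (ψ.symm (γ (σ q)))) (ℓ 0) r := by
      rw [← h3]
      exact ℓ.hasFDerivAt.comp_hasDerivAt r h1.hasDerivAt
    rw [map_zero] at h4
    refine h4.congr_of_eventuallyEq ?_
    filter_upwards [hev] with q hq
    exact clampedTime_eq (Ioo_subset_Icc_self hq)
  · refine (hasDerivAt_const r (ℓ (ψ.symm (γ b)))).congr_of_eventuallyEq ?_
    filter_upwards [hσ.eventually (lt_mem_nhds hb)] with q hq
    rw [clampedTime, min_eq_left hq.le, max_eq_right h.lt.le]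

end IsLocalTime

/-- Causal curves have finite covers by pieces with local time functions. -/
theorem LorentzianMetric.TimeOrientation.IsCausalCurve.exists_finite_isLocalTime
    {g : LorentzianMetric E M} {τ : g.TimeOrientation} {γ : ℝ → M} (hγ : τ.IsCausalCurve γ) :
    ∃ (ι : Type) (_ : Fintype ι) (ψ : ι → OpenPartialHomeomorph E M) (ℓ : ι → E →L[ℝ] ℝ)
      (K : ι → NNReal) (a b : ι → ℝ), (∀ i, IsLocalTime γ (ψ i) (ℓ i) (K i) (a i) (b i)) ∧
        ∀ t ∈ Icc (0 : ℝ) 1, ∃ i, Icc (a i) (b i) ∈ 𝓝[Icc 0 1] t := by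
  choose ψ ℓ K a b hT hnhds using fun t : Icc (0 : ℝ) 1 ↦ hγ.exists_isLocalTime t.2
  -- The covering sets consist of the points of which the interval is a neighbourhood, since mere
  -- membership would not give local statements at the overlaps.
  obtain ⟨s, hs, hcov⟩ := (isCompact_Icc (a := (0 : ℝ)) (b := 1)).elim_nhdsWithin_subcover
    (fun t ↦ {r | ∃ h : t ∈ Icc (0 : ℝ) 1, Icc (a ⟨t, h⟩) (b ⟨t, h⟩) ∈ 𝓝[Icc 0 1] r})
    (fun t ht ↦ by
      have h1 : ∀ᶠ x in 𝓝[Icc (0 : ℝ) 1] t, x ∈ Icc (a ⟨t, ht⟩) (b ⟨t, ht⟩) := hnhds ⟨t, ht⟩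
      filter_upwards [eventually_eventually_nhdsWithin.2 h1] with r hr
      exact ⟨ht, hr⟩)
  refine ⟨s, inferInstance, fun i ↦ ψ ⟨i, hs i i.2⟩, fun i ↦ ℓ ⟨i, hs i i.2⟩,
    fun i ↦ K ⟨i, hs i i.2⟩, fun i ↦ a ⟨i, hs i i.2⟩, fun i ↦ b ⟨i, hs i i.2⟩,
    fun i ↦ hT _, fun t ht ↦ ?_⟩
  obtain ⟨i, hi, h1, h2⟩ := mem_iUnion₂.1 (hcov ht)
  exact ⟨⟨i, hi⟩, h2⟩

/-- Causal curves have a parametrization that is locally Lipschitz continuous and whose velocity is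
almost everywhere nonzero. -/
theorem LorentzianMetric.TimeOrientation.IsCausalCurve.exists_isReparametrization
    {g : LorentzianMetric E M} {τ : g.TimeOrientation} {γ : ℝ → M} (hγ : τ.IsCausalCurve γ) :
    ∃ σ, IsReparametrization σ ∧ IsLocallyLipschitzCurve E (γ ∘ σ) ∧
      ∀ᵐ t ∂(volume.restrict (Icc (0 : ℝ) 1)), velocity E (γ ∘ σ) t ≠ 0 := by
  obtain ⟨ι, _, ψ, ℓ, K, a, b, hT, hcov⟩ := hγ.exists_finite_isLocalTime
  let u : ι → ℝ → ℝ := fun i ↦ clampedTime γ (ψ i) (ℓ i) (a i) (b i)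
  -- Every clamped time is nondecreasing, and one whose piece contains the midpoint of `s < t`
  -- increases strictly, so `S` is strictly increasing. Its increments dominate those of each
  -- summand.
  let S : ℝ → ℝ := fun t ↦ ∑ i, u i t
  have hSc : Continuous S := continuous_finsetSum _ fun i _ ↦ (hT i).continuous_clampedTime hγ.1
  have hSmono : StrictMonoOn S (Icc 0 1) := fun s hs t ht hst ↦ by
    obtain ⟨i, hi⟩ := hcov ((s + t) / 2) ⟨by linarith [hs.1, ht.1], by linarith [hs.2, ht.2]⟩
    have hm := mem_of_mem_nhdsWithin
      (show (s + t) / 2 ∈ Icc (0 : ℝ) 1 from ⟨by linarith [hs.1, ht.1], by linarith [hs.2, ht.2]⟩) hi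
    exact Finset.sum_lt_sum (fun j _ ↦ (hT j).monotone_clampedTime hst.le)
      ⟨i, Finset.mem_univ i, (hT i).clampedTime_lt hm (by linarith) (by linarith)⟩
  have hSu : ∀ i s t, s ≤ t → u i t - u i s ≤ S t - S s := fun i s t hst ↦ by
    have h1 : S t - S s = ∑ j, (u j t - u j s) := (Finset.sum_sub_distrib _ _).symm
    rw [h1]
    exact Finset.single_le_sum (f := fun j ↦ u j t - u j s)
      (fun j _ ↦ sub_nonneg.2 ((hT j).monotone_clampedTime hst)) (Finset.mem_univ i)
  have hD : 0 < S 1 - S 0 := sub_pos.2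
    (hSmono (left_mem_Icc.2 zero_le_one) (right_mem_Icc.2 zero_le_one) zero_lt_one)
  obtain ⟨σ, hσ, hSσ⟩ := exists_isReparametrization_of_strictMonoOn hSc.continuousOn hSmono
  let D : NNReal := ⟨S 1 - S 0, hD.le⟩
  have hlip : ∀ i, LipschitzOnWith (K i * D) (fun r ↦ (ψ i).symm ((γ ∘ σ) r))
      (Icc 0 1 ∩ σ ⁻¹' Icc (a i) (b i)) := by
    intro i
    have key : ∀ s ∈ Icc 0 1 ∩ σ ⁻¹' Icc (a i) (b i), ∀ t ∈ Icc 0 1 ∩ σ ⁻¹' Icc (a i) (b i), s ≤ t →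
        ‖(ψ i).symm (γ (σ t)) - (ψ i).symm (γ (σ s))‖ ≤ K i * (S 1 - S 0) * (t - s) := by
      intro s hs t ht hst
      have hst' : σ s ≤ σ t := hσ.2.1.monotoneOn hs.1 ht.1 hst
      refine ((hT i).norm_le _ hs.2 _ ht.2 hst').trans ?_
      rw [mul_assoc]
      refine mul_le_mul_of_nonneg_left ?_ (K i).2
      have h1 := hSu i _ _ hst'
      rw [(hSσ s hs.1).2, (hSσ t ht.1).2] at h1
      simp only [u, IsLocalTime.clampedTime_eq hs.2, IsLocalTime.clampedTime_eq ht.2] at h1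
      linarith
    refine LipschitzOnWith.of_dist_le_mul fun s hs t ht ↦ ?_
    have hKD : ((K i * D : NNReal) : ℝ) = K i * (S 1 - S 0) := rfl
    rw [hKD, Real.dist_eq]
    rcases le_total s t with hst | hst
    · rw [dist_comm, dist_eq_norm, abs_sub_comm, abs_of_nonneg (sub_nonneg.2 hst)]
      exact key s hs t ht hst
    · rw [dist_eq_norm, abs_of_nonneg (sub_nonneg.2 hst)]
      exact key t ht s hs hst
  refine ⟨σ, hσ, fun r hr ↦ ?_, ?_⟩
  · obtain ⟨i, hi⟩ := hcov (σ r) (hSσ r hr).1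
    have h1 : σ ⁻¹' Icc (a i) (b i) ∈ 𝓝[Icc 0 1] r :=
      (tendsto_nhdsWithin_of_tendsto_nhds_of_eventually_within _ (hσ.1 r hr)
        (by filter_upwards [self_mem_nhdsWithin] with q hq using (hSσ q hq).1)) hi
    obtain ⟨a', b', hab', hsub', hnhds', h2⟩ :=
      exists_Icc_subset_of_mem_nhdsWithin zero_lt_one hr h1
    exact ⟨ψ i, (hT i).param, a', b', hab', hsub', hnhds', fun q hq ↦ (hT i).maps (h2 hq),
      K i * D, (hlip i).mono fun q hq ↦ ⟨hsub' hq, h2 hq⟩⟩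
  · rw [← restrict_Ioo_eq_restrict_Icc, ae_restrict_iff' measurableSet_Ioo]
    -- By injectivity, `σ` meets the finitely many break points of the clamped times only on a null
    -- set.
    have hne : ∀ x : ℝ, ∀ᵐ r, r ∈ Icc (0 : ℝ) 1 → σ r ≠ x := fun x ↦ by
      have h1 : (Icc (0 : ℝ) 1 ∩ σ ⁻¹' {x}).Subsingleton := fun s hs t ht ↦
        hσ.2.1.injOn hs.1 ht.1 (hs.2.trans ht.2.symm)
      filter_upwards [h1.countable.ae_notMem volume] with r hr hr' hx
      exact hr ⟨hr', hx⟩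
    -- Lipschitz functions are differentiable almost everywhere; hence a zero velocity below is a
    -- genuine zero derivative and not the default value.
    have hall : ∀ᵐ r, ∀ i, (r ∈ Icc (0 : ℝ) 1 → σ r ≠ a i) ∧ (r ∈ Icc (0 : ℝ) 1 → σ r ≠ b i) ∧
        (r ∈ Icc 0 1 ∩ σ ⁻¹' Icc (a i) (b i) → DifferentiableWithinAt ℝ
          (fun r ↦ (ψ i).symm ((γ ∘ σ) r)) (Icc 0 1 ∩ σ ⁻¹' Icc (a i) (b i)) r) := by
      rw [ae_all_iff]
      intro i
      filter_upwards [hne (a i), hne (b i), (hlip i).ae_differentiableWithinAt_of_mem (μ := volume)]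
        with r h1 h2 h3
      exact ⟨h1, h2, h3⟩
    filter_upwards [hall] with r hr hr01 hv
    have hr01' := Ioo_subset_Icc_self hr01
    have hσr : ContinuousAt σ r := hσ.1.continuousAt (Icc_mem_nhds hr01.1 hr01.2)
    -- With zero velocity all summands have derivative zero, whereas `S ∘ σ` is affine with slope `S
    -- 1 - S 0 > 0`.
    have h1 : HasDerivAt (fun q ↦ S (σ q)) (∑ _i : ι, (0 : ℝ)) r :=
      HasDerivAt.fun_sum fun i _ ↦ by
        obtain ⟨h1, h2, h3⟩ := hr i
        refine (hT i).hasDerivAt_clampedTime_zero hσr (h1 hr01') (h2 hr01') (fun hi ↦ ?_) hv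
        refine (h3 ⟨hr01', Ioo_subset_Icc_self hi⟩).differentiableAt
          (Filter.inter_mem (Icc_mem_nhds hr01.1 hr01.2) ?_)
        exact hσr (Icc_mem_nhds hi.1 hi.2)
    have h2 : HasDerivAt (fun q ↦ S (σ q)) (S 1 - S 0) r := by
      have h3 : HasDerivAt (fun q ↦ S 0 + q * (S 1 - S 0)) (S 1 - S 0) r := by
        simpa using ((hasDerivAt_id r).mul_const (S 1 - S 0)).const_add (S 0)
      refine h3.congr_of_eventuallyEq ?_
      filter_upwards [Icc_mem_nhds hr01.1 hr01.2] with q hq using (hSσ q hq).2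
    have h3 := h1.unique h2
    rw [Finset.sum_const_zero] at h3
    linarith

end TimeFunctions

end Development

/-! ### The equivalences. -/

theorem mainTheorem5
    {E : Type*} [NormedAddCommGroup E] [NormedSpace ℝ E] [FiniteDimensional ℝ E]
    {M : Type*} [TopologicalSpace M] [ChartedSpace E M] [IsManifold 𝓘(ℝ, E) ∞ M]
    [T2Space M] [SecondCountableTopology M] [ConnectedSpace M]
    (g : LorentzianMetric E M) (τ : g.TimeOrientation)
    (h : Bundle.ContMDiffRiemannianMetric 𝓘(ℝ, E) ∞ E (fun x : M ↦ TangentSpace 𝓘(ℝ, E) x))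
    (γ : ℝ → M) (hγ : ContinuousOn γ (Icc 0 1)) :
    (τ.IsCausalCurve γ ↔
      ∃ σ : ℝ → ℝ, IsReparametrization σ ∧ IsH1CausalCurve τ h (γ ∘ σ)) ∧
    (IsH1CausalCurve τ h γ ↔
      τ.IsCausalCurve γ ∧ IsH1Curve h γ ∧
        ∀ᵐ t ∂(volume.restrict (Icc (0 : ℝ) 1)), velocity E γ t ≠ 0) := by
  have hcomp : ∀ {σ : ℝ → ℝ}, IsReparametrization σ → ContinuousOn (γ ∘ σ) (Icc 0 1) :=
    fun {σ} hσ ↦ hγ.comp hσ.1 fun t ht ↦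
      ⟨hσ.2.2.1 ▸ hσ.2.1.monotoneOn (left_mem_Icc.2 zero_le_one) ht ht.1,
        hσ.2.2.2 ▸ hσ.2.1.monotoneOn ht (right_mem_Icc.2 zero_le_one) ht.2⟩
  have hvel : ∀ {β : ℝ → M}, τ.IsCausalCurve β →
      (∀ᵐ t ∂(volume.restrict (Icc (0 : ℝ) 1)), velocity E β t ≠ 0) →
      ∀ᵐ t ∂(volume.restrict (Icc (0 : ℝ) 1)), velocity E β t ∈ τ.future (β t) := by
    intro β hβ h0
    -- The end points form a null set and are dropped, because `velocity` is a two-sided derivative.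
    rw [← restrict_Ioo_eq_restrict_Icc] at h0 ⊢
    filter_upwards [h0, ae_restrict_mem measurableSet_Ioo] with t ht ht'
    exact hβ.velocity_mem ht' ht
  refine ⟨⟨fun hc ↦ ?_, ?_⟩, fun hH ↦ ⟨?_, hH.1, ?_⟩, ?_⟩
  · obtain ⟨σ, hσ, hlip, hne⟩ := hc.exists_isReparametrization
    exact ⟨σ, hσ, hlip.isH1Curve h, hvel (hc.comp hσ) hne⟩
  · rintro ⟨σ, hσ, hH⟩
    exact .of_comp hγ hσ (τ.isCausalCurve_of_velocity (hcomp hσ) hH.1.1 hH.2)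
  · exact τ.isCausalCurve_of_velocity hγ hH.1.1 hH.2
  · filter_upwards [hH.2] with t ht using τ.ne_zero_of_mem ht
  · rintro ⟨hc, hH1, hne⟩
    exact ⟨hH1, hvel hc hne⟩
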